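/- Let $\mathbb T^3=\mathbb R^3/\mathbb Z^3$, let $T>0$, and write $L^q_t(X_x)=L^q(0,T;X(\mathbb T^3))$. Let $q\in[1,\infty]$, $p\in[1,3)$ and $1\le s<p^\star:=\frac{3p}{3-p}$, and let $q',s'$ be the conjugate exponents of $q,s$. Let $(a_\varepsilon)_{\varepsilon>0}$ be a family of real-valued functions in $L^q_t(W^{1,p}_x)$ and $(b_\varepsilon)_{\varepsilon>0}$ a family of real-valued functions in $L^{q'}_t(L^{s'}_x)$, and let $a\in L^q_t(W^{1,p}_x)$ and $b\in L^{q'}_t(L^{s'}_x)$ be such that, as $\varepsilon\to0^+$, $$a_\varepsilon\rightharpoonup a\ \text{ weakly-}\star\text{ in } L^q_t(W^{1,p}_x),\qquad b_\varepsilon\rightharpoonup b\ \text{ weakly-}\star\text{ in } L^{q'}_t(L^{s'}_x).$$ Here $f_\varepsilon\rightharpoonup f$ weakly-$\star$ in $L^{\alpha}_t(L^{\beta}_x)$ means that $\int_0^T\!\!\int_{\mathbb T^3} f_\varepsilon\, g\,dx\,dt\to\int_0^T\!\!\int_{\mathbb T^3} f\, g\,dx\,dt$ for all $g$ in the closure of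 $\mathscr C^0([0,T]\times\mathbb T^3)$ in $L^{\alpha'}_t(L^{\beta'}_x)$ (which is the whole space if $\alpha,\beta>1$), and weak-$\star$ convergence in $L^q_t(W^{1,p}_x)$ means weak-$\star$ convergence in $L^q_t(L^p_x)$ of the functions and of their first-order weak partial derivatives in $x$. Assume that for some $m\in\mathbb Z$ the distributional time derivatives $(\partial_t b_\varepsilon)_{\varepsilon>0}$ form a bounded family in $L^{q'}_t(H^{-m}_x)$. Then $ab$ and all the products $a_\varepsilon b_\varepsilon$ belong to $L^1([0,T]\times\mathbb T^3)$ and, up to a subsequence, $a_\varepsilon b_\varepsilon\rightharpoonup ab$ in the sense of measures: every sequence of positive numbers $\varepsilon_n\to0$ has a subsequence $(\varepsilon_{n_k})_k$ such that, for every $\theta\in\mathscr C^0([0,T]\times\mathbb T^3)$, $$\int_0^T\!\!\int_{\mathbb T^3} a_{\varepsilon_{n_k}} b_{\varepsilon_{n_k}}\,\theta\,dx\,dt\longrightarrow\int_0^T\!\!\int_{\mathbb T^3} a\,b\,\theta\,dx\,dt\qquad(k\to\infty).$$ -/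

import Mathlib

open MeasureTheory Filter Topology
open scoped ENNReal NNReal ContDiff

noncomputable section

namespace WeakProduct

/-- The torus `𝕋³ = ℝ³ / ℤ³`, with its Lebesgue measure `volume` (of total mass one). -/
abbrev T3 : Type := UnitAddTorus (Fin 3)

/-- Lebesgue measure on the time interval `[0, T]`. -/
def timeMeasure (T : ℝ) : Measure ℝ := volume.restrict (Set.Icc 0 T)

/-- Lebesgue measure on `[0, T] × 𝕋³`. -/
def spaceTime (T : ℝ) : Measure (ℝ × T3) := (timeMeasure T).prod volume

/-- The norm of `L^q(0,T; L^p(𝕋³))`. -/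
def mixedNorm (T : ℝ) (q p : ℝ≥0∞) (f : ℝ × T3 → ℝ) : ℝ≥0∞ :=
  eLpNorm (fun t : ℝ => eLpNorm (fun x : T3 => f (t, x)) p volume) q (timeMeasure T)

/-- `f ∈ L^q(0,T; L^p(𝕋³))`. -/
def MemLqLp (T : ℝ) (q p : ℝ≥0∞) (f : ℝ × T3 → ℝ) : Prop :=
  AEStronglyMeasurable f (spaceTime T) ∧ mixedNorm T q p f < ⊤

/-- Smooth functions on `𝕋³`: their periodic lift to `ℝ³` is `C^∞`. -/
def IsSmoothOnTorus (φ : T3 → ℝ) : Prop :=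
  ContDiff ℝ ∞ (fun y : Fin 3 → ℝ => φ (fun i => (y i : UnitAddCircle)))

/-- The classical partial derivative `∂φ/∂xᵢ` on `𝕋³`. -/
def torusPartial (i : Fin 3) (φ : T3 → ℝ) (x : T3) : ℝ :=
  deriv (fun h : ℝ => φ (x + Pi.single i (h : UnitAddCircle))) 0

/-- `v` is the weak partial derivative `∂u/∂xᵢ` on `𝕋³` (for integrable `u`, `v`). -/
def HasWeakPartial (i : Fin 3) (u v : T3 → ℝ) : Prop :=
  ∀ φ : T3 → ℝ, IsSmoothOnTorus φ →
    ∫ x, u x * torusPartial i φ x = - ∫ x, v x * φ x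

/-- `f ∈ L^q(0,T; W^{1,p}(𝕋³))`, with weak spatial gradient `Df = (Df 0, Df 1, Df 2)`. -/
def MemLqW1p (T : ℝ) (q p : ℝ≥0∞) (f : ℝ × T3 → ℝ) (Df : Fin 3 → ℝ × T3 → ℝ) : Prop :=
  MemLqLp T q p f ∧ (∀ i, MemLqLp T q p (Df i)) ∧
    ∀ᵐ t ∂timeMeasure T, ∀ i, HasWeakPartial i (fun x => f (t, x)) (fun x => Df i (t, x))

/-- The predual of `L^q(0,T; L^p(𝕋³))`: the closure of the continuous functions on
`[0,T] × 𝕋³` in `L^{q'}(0,T; L^{p'}(𝕋³))`, where `q'` and `p'` are the conjugate exponents.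
If `q` and `p` are both `> 1`, so that `q'` and `p'` are finite, continuous functions are dense
and this is all of `L^{q'}(0,T; L^{p'}(𝕋³))`.  If `q = 1` or `p = 1`, then `L^q(0,T; L^p(𝕋³))`
is not a dual space; it is regarded as a space of measures in the corresponding variable, so that
`L^∞` is replaced by continuous functions in that variable. Testing with fewer functions makes the
weak-* convergence below a weaker requirement than with all of `L^{q'}(0,T; L^{p'}(𝕋³))`. -/
def MemPredual (T : ℝ) (q p : ℝ≥0∞) (g : ℝ × T3 → ℝ) : Prop :=
  MemLqLp T q.conjExponent p.conjExponent g ∧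
    ∀ δ : ℝ≥0∞, 0 < δ → ∃ h : ℝ × T3 → ℝ, Continuous h ∧
      mixedNorm T q.conjExponent p.conjExponent (fun z => g z - h z) ≤ δ

/-- Weak-* convergence `f ε ⇀ f₀` in `L^q(0,T; L^p(𝕋³))` as `ε → 0⁺`. -/
def WeakStarLqLp (T : ℝ) (q p : ℝ≥0∞) (f : ℝ → ℝ × T3 → ℝ) (f₀ : ℝ × T3 → ℝ) : Prop :=
  ∀ g : ℝ × T3 → ℝ, MemPredual T q p g →
    Tendsto (fun ε : ℝ => ∫ z, f ε z * g z ∂spaceTime T) (𝓝[>] 0)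
      (𝓝 (∫ z, f₀ z * g z ∂spaceTime T))

/-- Weak-* convergence `f ε ⇀ f₀` in `L^q(0,T; W^{1,p}(𝕋³))` as `ε → 0⁺`, where `Df ε` and `Df₀`
are the weak spatial gradients: the functionals of the predual are
`f ↦ ∫∫ f g₀ + ∑ᵢ ∂ᵢf gᵢ` with `g₀, …, g₃` in the predual of `L^q(0,T; L^p(𝕋³))`. -/
def WeakStarLqW1p (T : ℝ) (q p : ℝ≥0∞) (f : ℝ → ℝ × T3 → ℝ) (Df : ℝ → Fin 3 → ℝ × T3 → ℝ)
    (f₀ : ℝ × T3 → ℝ) (Df₀ : Fin 3 → ℝ × T3 → ℝ) : Prop :=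
  WeakStarLqLp T q p f f₀ ∧ ∀ i, WeakStarLqLp T q p (fun ε => Df ε i) (Df₀ i)

/-- The `k`-th Fourier coefficient `∫ u(x) e^{-2πi k·x} dx` of `u : 𝕋³ → ℝ`. -/
def fourierCoeffT3 (u : T3 → ℝ) (k : Fin 3 → ℤ) : ℂ :=
  ∫ x : T3, (u x : ℂ) * UnitAddTorus.mFourier (-k) x

/-- The norm of `H^r(𝕋³)`, `r ∈ ℤ`, of the distribution with Fourier coefficients `c`:
`(∑ₖ (1 + |k|²)^r |c k|²)^{1/2}`. For `m ∈ ℕ`, `H^{-m}` is the dual of `H^m`. -/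
def sobolevNorm (r : ℤ) (c : (Fin 3 → ℤ) → ℂ) : ℝ≥0∞ :=
  (∑' k : Fin 3 → ℤ, ENNReal.ofReal ((1 + ∑ i, (k i : ℝ) ^ 2) ^ r) * ‖c k‖ₑ ^ 2) ^ (1 / 2 : ℝ)

/-- The distributional time derivative `∂ₜ b` on `(0,T) × 𝕋³` belongs to
`L^q(0,T; H^r(𝕋³))` and its norm there is at most `C`. The derivative is a function `w` of time with
values in `H^r(𝕋³)`, given by its Fourier coefficients; the identity `∂ₜ b = w` is tested with
`ψ(t) e^{-2πi k·x}`, `ψ ∈ C_c^∞(0,T)`, `k ∈ ℤ³`. -/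
def TimeDerivBound (T : ℝ) (q : ℝ≥0∞) (r : ℤ) (b : ℝ × T3 → ℝ) (C : ℝ≥0) : Prop :=
  ∃ w : ℝ → (Fin 3 → ℤ) → ℂ,
    (∀ k, AEStronglyMeasurable (fun t => w t k) (timeMeasure T)) ∧
    eLpNorm (fun t => sobolevNorm r (w t)) q (timeMeasure T) ≤ C ∧
    ∀ (ψ : ℝ → ℝ) (k : Fin 3 → ℤ), ContDiff ℝ ∞ ψ → HasCompactSupport ψ →
      tsupport ψ ⊆ Set.Ioo 0 T →
      ∫ t, ((deriv ψ t : ℝ) : ℂ) * fourierCoeffT3 (fun x => b (t, x)) k ∂timeMeasure T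
        = - ∫ t, (ψ t : ℂ) * w t k ∂timeMeasure T

end WeakProduct

end

/-! The factor a is compact in space and the factor b is compact in time; the product passes to the
limit because a smoothing of a in space reduces everything to functions of time alone. Let K_N be
`torusKernel N`, a trigonometric polynomial that approximates the identity. The kernel K_N(x - y) is
a finite sum of products φ_j(x) ψ_j(y). Hence, once a_ε is replaced by K_N * a_ε, the integral of
a_ε b_ε against α(t) g(x) becomes a finite sum of integrals ∫ α A_j B_j dt, where A_j = ∫ a_ε ψ_j dx
converges weakly and is bounded in L^q(0,T), and B_j = ∫ b_ε φ_j g dx converges strongly in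
L^{q'}(0,T). Such products converge (`tendsto_integral_mul_of_weak_of_strong`). By Stone–Weierstrass
the functions α(t) g(x) span a dense space of test functions, and the products a_ε b_ε are bounded
in L^1.

The replacement costs an error that is small uniformly in ε. The difference K_n - K_{n+1} is the
divergence of a field G_n with L^1 norm of order (n+1)^{-3/2} and bounded sup norm. Telescoping
gives a - K_N * a as the sum over n ≥ N of the ∂_i a * G_n^i. Young's inequality, interpolated
between the two norms of G_n, bounds the n-th term from L^p to L^σ by a multiple of (n+1)^{-(3/2)(1
- 1/p + 1/σ)}, which is summable exactly when 1/σ > 1/p - 1/3 (`eLpNorm_torusConv_sub_le`). The same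
estimate yields the Sobolev embedding, hence the integrability of the products.

For the strong convergence of B_j, first take an exponential as weight: B_j is then a Fourier
coefficient, with time derivative bounded in L^{q'} whatever the order m. A scalar function is
controlled in L^{q'} by finitely many local averages plus the mass of its derivative on short
intervals (`exists_averages_control`), and the averages converge by weak convergence. Density of
trigonometric polynomials extends this to continuous weights (`pairingConverges`).

The uniform bounds come from weak-* convergence by Banach–Steinhaus, applied on ℓ^1 to series of
nearly norming continuous functions (`exists_mixedNorm_le`). The limit is identified directly at
every stage, so the whole sequence converges. -/

noncomputable section

namespace WeakProduct

/-! ### Lebesgue norms of functions with values in [0, ∞]. -/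

section ENNRealLp

variable {α β : Type*} [MeasurableSpace α] [MeasurableSpace β] {μ : Measure α} {ν : Measure β}

/-- The `L^p` norms of the slices of a measurable function depend measurably on the parameter. -/
lemma measurable_eLpNorm_slice [SFinite ν] {F : α × β → ℝ≥0∞} (hF : Measurable F) (p : ℝ≥0∞) :
    Measurable (fun t => eLpNorm (fun x => F (t, x)) p ν) := by
  rcases eq_or_ne p 0 with rfl | hp0
  · simp
  rcases eq_or_ne p ⊤ with rfl | hp
  -- An essential supremum is at most c exactly when the superlevel set {F > c} is null, and the
  -- measure of a slice is measurable in the parameter.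
  · refine measurable_of_Iic fun c => ?_
    have : (fun t => eLpNorm (fun x => F (t, x)) ⊤ ν) ⁻¹' Set.Iic c
        = {t | ν (Prod.mk t ⁻¹' {z | c < F z}) = 0} := by
      ext t
      simp only [Set.mem_preimage, Set.mem_Iic, Set.mem_ofPred_eq, eLpNorm_exponent_top,
        eLpNormEssSup, enorm_eq_self]
      constructor
      · intro h
        have h2 : ∀ᵐ x ∂ν, F (t, x) ≤ c :=
          (ENNReal.ae_le_essSup (fun x => F (t, x))).mono fun x hx => hx.trans h
        simpa [ae_iff] using h2
      · intro h
        refine essSup_le_of_ae_le c ?_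
        change ∀ᵐ x ∂ν, F (t, x) ≤ c
        simpa [ae_iff] using h
    rw [this]
    exact measurable_measure_prodMk_left (measurableSet_lt measurable_const hF)
      (measurableSet_singleton 0)
  · simp only [eLpNorm_eq_lintegral_rpow_enorm_toReal hp0 hp, enorm_eq_self]
    exact ((hF.pow_const _).lintegral_prod_right').pow_const _

lemma aemeasurable_eLpNorm_slice [SFinite ν] {F : α × β → ℝ≥0∞}
    (hF : AEMeasurable F (μ.prod ν)) (p : ℝ≥0∞) : AEMeasurable (fun t => eLpNorm (fun x => F (t, x)) p ν) μ := by
  refine ⟨fun t => eLpNorm (fun x => hF.mk F (t, x)) p ν,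
    measurable_eLpNorm_slice hF.measurable_mk p, ?_⟩
  filter_upwards [Measure.ae_ae_of_ae_prod (ν := ν) hF.ae_eq_mk] with t ht
  exact eLpNorm_congr_ae ht

/-- Hölder's inequality for functions with values in `[0, ∞]`. -/
lemma lintegral_mul_le_eLpNorm_mul_eLpNorm {q q' : ℝ≥0∞} [hqq : q.HolderConjugate q']
    {F G : α → ℝ≥0∞} (hF : AEMeasurable F μ) (hG : AEMeasurable G μ) :
    ∫⁻ t, F t * G t ∂μ ≤ eLpNorm F q μ * eLpNorm G q' μ := by
  have key : ∀ {F G : α → ℝ≥0∞}, AEMeasurable F μ →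
      ∫⁻ t, F t * G t ∂μ ≤ eLpNorm F 1 μ * eLpNorm G ⊤ μ := by
    intro F G hF
    rw [eLpNorm_one_eq_lintegral_enorm, eLpNorm_exponent_top, ← lintegral_mul_const'' _ (by simpa)]
    refine lintegral_mono_ae ?_
    filter_upwards [ENNReal.ae_le_essSup G] with t ht
    simp only [enorm_eq_self, eLpNormEssSup]
    gcongr
  rcases eq_or_ne q ⊤ with rfl | hq
  · have : q' = 1 := ENNReal.HolderConjugate.unique ⊤ q' 1
    subst this
    rw [mul_comm]
    simp_rw [mul_comm (F _)]
    exact key hG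
  rcases eq_or_ne q' ⊤ with rfl | hq'
  · have : q = 1 := ENNReal.HolderConjugate.unique ⊤ q 1
    subst this
    exact key hF
  have h := ENNReal.HolderConjugate.toReal_of_ne_top (p := q) (q := q') hq hq'
  have := ENNReal.lintegral_mul_le_Lp_mul_Lq μ h hF hG
  rw [eLpNorm_eq_lintegral_rpow_enorm_toReal (ENNReal.HolderConjugate.ne_zero q q') hq,
    eLpNorm_eq_lintegral_rpow_enorm_toReal (ENNReal.HolderConjugate.ne_zero q' q) hq']
  simpa using this

/-- Fatou's lemma for the norms of an increasing sequence. -/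
lemma eLpNorm_iSup_le {F : ℕ → α → ℝ≥0∞} (hF : ∀ n, AEMeasurable (F n) μ) (hmono : Monotone F)
    (p : ℝ≥0∞) : eLpNorm (fun t => ⨆ n, F n t) p μ ≤ ⨆ n, eLpNorm (F n) p μ := by
  rcases eq_or_ne p 0 with rfl | hp0
  · simp
  rcases eq_or_ne p ⊤ with rfl | hp
  · simp only [eLpNorm_exponent_top, eLpNormEssSup, enorm_eq_self]
    refine essSup_le_of_ae_le _ ?_
    have : ∀ᵐ t ∂μ, ∀ n, F n t ≤ essSup (F n) μ :=
      ae_all_iff.2 fun n => ENNReal.ae_le_essSup (F n)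
    filter_upwards [this] with t ht
    exact iSup_mono ht
  · simp only [eLpNorm_eq_lintegral_rpow_enorm_toReal hp0 hp, enorm_eq_self]
    have hp1 : 0 < p.toReal := ENNReal.toReal_pos hp0 hp
    have h1 : ∀ t, (⨆ n, F n t) ^ p.toReal = ⨆ n, F n t ^ p.toReal := fun t =>
      (ENNReal.orderIsoRpow p.toReal hp1).map_iSup _
    simp_rw [h1]
    rw [lintegral_iSup' (fun n => (hF n).pow_const _)]
    · have h2 : ∀ f : ℕ → ℝ≥0∞, (⨆ n, f n) ^ (1 / p.toReal) = ⨆ n, f n ^ (1 / p.toReal) := fun f =>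
        (ENNReal.orderIsoRpow _ (one_div_pos.2 hp1)).map_iSup _
      rw [h2]
    · refine Eventually.of_forall fun t m n hmn => ?_
      exact ENNReal.rpow_le_rpow (hmono hmn t) hp1.le

/-- The triangle inequality for a series. -/
lemma eLpNorm_tsum_le {F : ℕ → α → ℝ≥0∞} (hF : ∀ n, AEMeasurable (F n) μ) {p : ℝ≥0∞}
    (hp : 1 ≤ p) : eLpNorm (fun t => ∑' n, F n t) p μ ≤ ∑' n, eLpNorm (F n) p μ := by
  simp_rw [ENNReal.tsum_eq_iSup_nat]
  refine (eLpNorm_iSup_le (F := fun N t => ∑ n ∈ Finset.range N, F n t) (fun N => ?_) ?_ p).trans ?_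
  · exact Finset.aemeasurable_fun_sum _ fun n _ => hF n
  · intro m n hmn t
    exact Finset.sum_le_sum_of_subset (Finset.range_mono hmn)
  · refine iSup_mono fun N => ?_
    have := eLpNorm_sum_le (s := Finset.range N) (f := F) (μ := μ)
      (fun i _ => (hF i).aestronglyMeasurable) hp
    rwa [show ∑ i ∈ Finset.range N, F i = fun t => ∑ n ∈ Finset.range N, F n t by
      ext t; simp] at this

/-- The function `(F / ‖F‖_r) ^ (r - 1)` norms `F` in `L^r`, for finite `r`. -/
lemma extremal_rpow {r r' : ℝ≥0∞} [hrr : r.HolderConjugate r'] (hr : r ≠ ⊤)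
    {F : α → ℝ≥0∞} (hF : Measurable F) :
    eLpNorm (fun x => F x ^ (r.toReal - 1) * eLpNorm F r μ ^ (1 - r.toReal)) r' μ ≤ 1 ∧
    (eLpNorm F r μ ≠ ⊤ →
      ∫⁻ x, F x * (F x ^ (r.toReal - 1) * eLpNorm F r μ ^ (1 - r.toReal)) ∂μ = eLpNorm F r μ) := by
  have hr1 : 1 ≤ r := ENNReal.HolderConjugate.one_le r r'
  have hr0 : r ≠ 0 := ENNReal.HolderConjugate.ne_zero r r'
  have hr1' : 1 ≤ r.toReal := by
    simpa using ENNReal.toReal_mono hr hr1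
  set N := eLpNorm F r μ with hN
  have hNr : ∫⁻ x, F x ^ r.toReal ∂μ = N ^ r.toReal := by
    rw [hN, eLpNorm_eq_lintegral_rpow_enorm_toReal hr0 hr, ← ENNReal.rpow_mul]
    simp [show r.toReal ≠ 0 by linarith]
  constructor
  · rcases eq_or_ne r' ⊤ with rfl | hr'
    · have : r = 1 := ENNReal.HolderConjugate.unique ⊤ r 1
      subst this
      simp only [ENNReal.toReal_one, sub_self, ENNReal.rpow_zero, mul_one]
      refine (eLpNorm_exponent_top).le.trans (eLpNormEssSup_le_of_ae_enorm_bound (by simp))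
    have h := ENNReal.HolderConjugate.toReal_of_ne_top (p := r) (q := r') hr hr'
    rw [eLpNorm_eq_lintegral_rpow_enorm_toReal (ENNReal.HolderConjugate.ne_zero r' r) hr']
    have h1 : ∀ x, ‖F x ^ (r.toReal - 1) * N ^ (1 - r.toReal)‖ₑ ^ r'.toReal
        = F x ^ r.toReal * N ^ (-r.toReal) := by
      intro x
      rw [enorm_eq_self, ENNReal.mul_rpow_of_nonneg _ _ h.symm.nonneg, ← ENNReal.rpow_mul,
        ← ENNReal.rpow_mul, h.sub_one_mul_conj, ← neg_sub, neg_mul, h.sub_one_mul_conj]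
    simp_rw [h1]
    rw [lintegral_mul_const _ (hF.pow_const _), hNr]
    refine ENNReal.rpow_le_one ?_ (by simp)
    rw [ENNReal.rpow_neg]
    exact ENNReal.mul_inv_le_one _
  · intro hNt
    rcases eq_or_ne N 0 with h0 | h0
    · have hF0 : F =ᵐ[μ] 0 := by
        have := (eLpNorm_eq_zero_iff hF.aestronglyMeasurable hr0).1 (hN ▸ h0)
        exact this
      rw [h0, lintegral_eq_zero_iff (by fun_prop)]
      filter_upwards [hF0] with x hx
      simp [hx]
    · have h1 : ∀ x, F x * (F x ^ (r.toReal - 1) * N ^ (1 - r.toReal))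
          = F x ^ r.toReal * N ^ (1 - r.toReal) := by
        intro x
        rw [← mul_assoc]
        congr 1
        nth_rw 1 [← ENNReal.rpow_one (F x)]
        rw [← ENNReal.rpow_add_of_nonneg _ _ (by norm_num) (by linarith)]
        congr 1; ring
      simp_rw [h1]
      rw [lintegral_mul_const _ (hF.pow_const _), hNr, ← ENNReal.rpow_add _ _ h0 hNt]
      simp

/-- The `L^q` norm is the supremum of the pairings with the unit ball of `L^{q'}`. -/
lemma exists_lintegral_mul_gt [IsFiniteMeasure μ] {q q' : ℝ≥0∞} [hqq : q.HolderConjugate q']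
    {F : α → ℝ≥0∞} (hF : Measurable F) (hfin : eLpNorm F q μ ≠ ⊤) {M : ℝ≥0∞}
    (hM : M < eLpNorm F q μ) :
    ∃ G : α → ℝ≥0∞, Measurable G ∧ eLpNorm G q' μ ≤ 1 ∧ M < ∫⁻ t, F t * G t ∂μ := by
  rcases eq_or_ne q ⊤ with rfl | hq
  · have : q' = 1 := ENNReal.HolderConjugate.unique ⊤ q' 1
    subst this
    -- An essential supremum need not be attained. An intermediate level M' gives a superlevel set
    -- of positive measure, whose normalised indicator is the test function.
    obtain ⟨M', hMM', hM'⟩ := exists_between hM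
    have hA : MeasurableSet {t | M' < F t} := measurableSet_lt measurable_const hF
    have hA0 : μ {t | M' < F t} ≠ 0 := by
      intro h0
      refine absurd hM' (not_lt.2 ?_)
      rw [eLpNorm_exponent_top]
      refine essSup_le_of_ae_le _ ?_
      change ∀ᵐ t ∂μ, F t ≤ M'
      simpa [ae_iff] using h0
    have hAt : μ {t | M' < F t} ≠ ⊤ := measure_ne_top _ _
    refine ⟨Set.indicator {t | M' < F t} (fun _ => (μ {t | M' < F t})⁻¹),
      measurable_const.indicator hA, ?_, ?_⟩
    · rw [eLpNorm_one_eq_lintegral_enorm]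
      simp only [enorm_eq_self]
      rw [lintegral_indicator_const hA, ENNReal.inv_mul_cancel hA0 hAt]
    · refine hMM'.trans_le ?_
      calc M' = ∫⁻ t, Set.indicator {t | M' < F t} (fun _ => M' * (μ {t | M' < F t})⁻¹) t ∂μ := by
            rw [lintegral_indicator_const hA, mul_assoc, ENNReal.inv_mul_cancel hA0 hAt, mul_one]
        _ ≤ _ := by
            refine lintegral_mono fun t => ?_
            by_cases ht : M' < F t
            · simp only [Set.mem_ofPred_eq, ht, Set.indicator_of_mem]
              gcongr
            · simp [ht]
  · obtain ⟨h1, h2⟩ := extremal_rpow (μ := μ) (r := q) (r' := q') hq hF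
    exact ⟨_, by fun_prop, h1, by rwa [h2 hfin]⟩

end ENNRealLp

/-! ### Approximation by continuous functions. -/

section Approximation

variable {X : Type*} [MeasurableSpace X] {μ : Measure X}

/-- Dominated convergence with a constant majorant. The case Q = ∞ is excluded because almost
everywhere convergence does not control essential suprema. -/
lemma tendsto_eLpNorm_of_bounded [IsFiniteMeasure μ] {Q : ℝ≥0∞} (hQ0 : Q ≠ 0) (hQ : Q ≠ ⊤)
    {u : ℕ → X → ℝ} {g : X → ℝ} {R : ℝ} (hu : ∀ k, AEStronglyMeasurable (u k) μ)
    (hb : ∀ k x, |u k x| ≤ R) (hlim : ∀ᵐ x ∂μ, Tendsto (fun k => u k x) atTop (𝓝 (g x))) :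
    Tendsto (fun k => eLpNorm (u k) Q μ) atTop (𝓝 (eLpNorm g Q μ)) := by
  simp only [eLpNorm_eq_lintegral_rpow_enorm_toReal hQ0 hQ]
  refine (ENNReal.continuous_rpow_const.tendsto _).comp ?_
  refine tendsto_lintegral_of_dominated_convergence' (fun _ => ENNReal.ofReal R ^ Q.toReal)
    (fun k => (hu k).enorm.pow_const _) (fun k => Eventually.of_forall fun x => ?_) ?_ ?_
  · refine ENNReal.rpow_le_rpow ?_ ENNReal.toReal_nonneg
    rw [Real.enorm_eq_ofReal_abs]
    exact ENNReal.ofReal_le_ofReal (hb k x)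
  · rw [lintegral_const]
    exact ENNReal.mul_ne_top (ENNReal.rpow_ne_top_of_nonneg ENNReal.toReal_nonneg
      ENNReal.ofReal_ne_top) (measure_ne_top _ _)
  · filter_upwards [hlim] with x hx
    exact (ENNReal.continuous_rpow_const.tendsto _).comp ((continuous_enorm.tendsto _).comp hx)

/-- Bounded measurable functions are limits almost everywhere of continuous functions with the same
bound. -/
lemma exists_continuous_tendsto_ae [TopologicalSpace X] [NormalSpace X] [BorelSpace X]
    [IsFiniteMeasure μ] [μ.WeaklyRegular] {g : X → ℝ} (hg : AEStronglyMeasurable g μ) {R : ℝ}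
    (hR : ∀ x, |g x| ≤ R) :
    ∃ u : ℕ → X → ℝ, (∀ k, Continuous (u k)) ∧ (∀ k x, |u k x| ≤ R) ∧
      ∀ᵐ x ∂μ, Tendsto (fun k => u k x) atTop (𝓝 (g x)) := by
  rcases isEmpty_or_nonempty X with hX | ⟨⟨x₀⟩⟩
  · exact ⟨fun _ => g, fun _ => continuous_of_discreteTopology, fun _ => hR, by simp⟩
  have hR0 : 0 ≤ R := (abs_nonneg _).trans (hR x₀)
  have hgi : MemLp g 1 μ := MemLp.of_bound hg R (Eventually.of_forall hR)
  have hex : ∀ k : ℕ, ∃ v : BoundedContinuousFunction X ℝ,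
      eLpNorm (g - ⇑v) 1 μ ≤ ENNReal.ofReal (1 / ((k : ℝ) + 1)) := fun k =>
    (hgi.exists_boundedContinuous_eLpNorm_sub_le ENNReal.one_ne_top
      (by simp; positivity)).imp fun v hv => hv.1
  choose v hv using hex
  have hlim : Tendsto (fun k => eLpNorm ((fun x => v k x) - g) 1 μ) atTop (𝓝 0) := by
    refine tendsto_of_tendsto_of_tendsto_of_le_of_le (g := 0)
      (h := fun k : ℕ => ENNReal.ofReal (1 / ((k : ℝ) + 1))) tendsto_const_nhds ?_
      (fun _ => zero_le) (fun k => by rw [eLpNorm_sub_comm]; exact hv k)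
    simpa using ENNReal.tendsto_ofReal (tendsto_one_div_add_atTop_nhds_zero_nat (𝕜 := ℝ))
  have hm := tendstoInMeasure_of_tendsto_eLpNorm one_ne_zero
    (fun k => (v k).continuous.aestronglyMeasurable) hg hlim
  obtain ⟨ns, -, hns⟩ := hm.exists_seq_tendsto_ae
  -- Clamping to [-R, R] restores the bound and does not disturb the limit, since g itself takes
  -- values there.
  refine ⟨fun k x => max (-R) (min (v (ns k) x) R), fun k => ?_, fun k x => ?_, ?_⟩
  · fun_prop
  · rw [abs_le]
    exact ⟨le_max_left _ _, max_le (by linarith) (min_le_right _ _)⟩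
  · filter_upwards [hns] with x hx
    have h2 : max (-R) (min (g x) R) = g x := by
      have := abs_le.1 (hR x)
      rw [min_eq_left this.2, max_eq_right this.1]
    have := (tendsto_const_nhds (x := -R)).max (hx.min (tendsto_const_nhds (x := R)))
    rwa [h2] at this

end Approximation

instance isProbabilityMeasure_volume_circle :
    IsProbabilityMeasure (volume : Measure UnitAddCircle) := ⟨by simp⟩

instance isFiniteMeasure_timeMeasure (T : ℝ) : IsFiniteMeasure (timeMeasure T) := by
  unfold timeMeasure; infer_instance

instance isFiniteMeasure_spaceTime (T : ℝ) : IsFiniteMeasure (spaceTime T) := by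
  unfold spaceTime; infer_instance

/-! ### Mixed norms in time and space. -/

section Mixed

variable {T : ℝ} {q p : ℝ≥0∞}

/-- The norm of `L^q(0,T; L^p(𝕋³))` for functions with values in `[0, ∞]`. -/
def mixedENorm (T : ℝ) (q p : ℝ≥0∞) (F : ℝ × T3 → ℝ≥0∞) : ℝ≥0∞ :=
  eLpNorm (fun t : ℝ => eLpNorm (fun x : T3 => F (t, x)) p volume) q (timeMeasure T)

lemma mixedNorm_eq_mixedENorm (f : ℝ × T3 → ℝ) :
    mixedNorm T q p f = mixedENorm T q p (fun z => ‖f z‖ₑ) := by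
  simp only [mixedNorm, mixedENorm, eLpNorm_enorm]

lemma mixedENorm_mono_ae {F G : ℝ × T3 → ℝ≥0∞} (h : ∀ᵐ z ∂spaceTime T, F z ≤ G z) :
    mixedENorm T q p F ≤ mixedENorm T q p G := by
  refine eLpNorm_mono_enorm_ae ?_
  filter_upwards [Measure.ae_ae_of_ae_prod (μ := timeMeasure T) (ν := (volume : Measure T3)) h]
    with t ht
  simp only [enorm_eq_self]
  exact eLpNorm_mono_enorm_ae (by simpa using ht)

lemma mixedNorm_congr_ae {f g : ℝ × T3 → ℝ} (h : f =ᵐ[spaceTime T] g) :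
    mixedNorm T q p f = mixedNorm T q p g := by
  simp only [mixedNorm_eq_mixedENorm]
  exact le_antisymm (mixedENorm_mono_ae (h.mono fun z hz => by rw [hz]))
    (mixedENorm_mono_ae (h.mono fun z hz => by rw [hz]))

lemma mixedENorm_tsum_le (hq : 1 ≤ q) (hp : 1 ≤ p) {F : ℕ → ℝ × T3 → ℝ≥0∞}
    (hF : ∀ n, Measurable (F n)) :
    mixedENorm T q p (fun z => ∑' n, F n z) ≤ ∑' n, mixedENorm T q p (F n) := by
  refine le_trans (eLpNorm_mono_enorm fun t => ?_)
    (eLpNorm_tsum_le (fun n => (measurable_eLpNorm_slice (ν := volume) (hF n) p).aemeasurable) hq)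
  simp only [enorm_eq_self]
  exact eLpNorm_tsum_le (fun n => ((hF n).comp measurable_prodMk_left).aemeasurable) hp

/-- Hölder's inequality for mixed norms. -/
lemma lintegral_mul_le_mixedENorm {q' p' : ℝ≥0∞} [q.HolderConjugate q'] [p.HolderConjugate p']
    {F G : ℝ × T3 → ℝ≥0∞} (hF : AEMeasurable F (spaceTime T)) (hG : AEMeasurable G (spaceTime T)) :
    ∫⁻ z, F z * G z ∂spaceTime T ≤ mixedENorm T q p F * mixedENorm T q' p' G := by
  unfold spaceTime at hF hG ⊢
  rw [lintegral_prod (fun z => F z * G z) (hF.mul hG)]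
  refine le_trans ?_ (lintegral_mul_le_eLpNorm_mul_eLpNorm
    (aemeasurable_eLpNorm_slice hF p) (aemeasurable_eLpNorm_slice hG p'))
  refine lintegral_mono_ae ?_
  filter_upwards [hF.aestronglyMeasurable.prodMk_left, hG.aestronglyMeasurable.prodMk_left]
    with t h1 h2
  exact lintegral_mul_le_eLpNorm_mul_eLpNorm h1.aemeasurable h2.aemeasurable

lemma lintegral_enorm_mul_le {q' p' : ℝ≥0∞} [q.HolderConjugate q'] [p.HolderConjugate p']
    {f g : ℝ × T3 → ℝ} (hf : AEStronglyMeasurable f (spaceTime T))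
    (hg : AEStronglyMeasurable g (spaceTime T)) :
    ∫⁻ z, ‖f z * g z‖ₑ ∂spaceTime T ≤ mixedNorm T q p f * mixedNorm T q' p' g := by
  simp only [enorm_mul, mixedNorm_eq_mixedENorm]
  exact lintegral_mul_le_mixedENorm hf.enorm hg.enorm

lemma integrable_mul_of_mixed {q' p' : ℝ≥0∞} [q.HolderConjugate q'] [p.HolderConjugate p']
    {f g : ℝ × T3 → ℝ} (hf : MemLqLp T q p f) (hg : MemLqLp T q' p' g) :
    Integrable (fun z => f z * g z) (spaceTime T) :=
  ⟨hf.1.mul hg.1, (lintegral_enorm_mul_le hf.1 hg.1).trans_lt (ENNReal.mul_lt_top hf.2 hg.2)⟩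

/-- The torus has mass one, so raising the space exponent costs no constant. The time exponent is
fixed because [0, T] has mass T. -/
lemma mixedNorm_mono_exponent {q p q₁ p₁ : ℝ≥0∞} (hq : q = q₁) (hp : p ≤ p₁) {f : ℝ × T3 → ℝ}
    (hf : AEStronglyMeasurable f (spaceTime T)) :
    mixedNorm T q p f ≤ mixedNorm T q₁ p₁ f := by
  subst hq
  refine eLpNorm_mono_enorm_ae ?_
  filter_upwards [AEStronglyMeasurable.prodMk_left (μ := timeMeasure T)
    (ν := (volume : Measure T3)) hf] with t ht
  simpa using eLpNorm_le_eLpNorm_of_exponent_le hp ht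

lemma mixedNorm_le_of_bound {f : ℝ × T3 → ℝ} {R : ℝ} (hR : ∀ z, |f z| ≤ R) :
    mixedNorm T q p f ≤ ENNReal.ofReal R * (timeMeasure T Set.univ) ^ q.toReal⁻¹ := by
  have h : ∀ t, eLpNorm (fun x => f (t, x)) p (volume : Measure T3) ≤ ENNReal.ofReal R := fun t => by
    have := eLpNorm_le_of_ae_bound (p := p) (μ := (volume : Measure T3)) (f := fun x => f (t, x))
      (Eventually.of_forall fun x => hR (t, x))
    simpa using this
  have := eLpNorm_le_of_ae_enorm_bound (p := q) (μ := timeMeasure T)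
    (f := fun t => eLpNorm (fun x => f (t, x)) p (volume : Measure T3)) (C := ENNReal.ofReal R)
    (Eventually.of_forall fun t => by simpa using h t)
  simpa [mixedNorm] using this

end Mixed

/-! ### Duality of mixed norms with continuous functions. -/

section Duality

variable {T : ℝ}

/-- Approximation of a bounded function by continuous functions, with control of the norms of the
slices. -/
lemma exists_continuous_slice_approx {R : ℝ≥0∞} (hR : 1 ≤ R) {g : ℝ × T3 → ℝ} (hg : Measurable g)
    {C : ℝ} (hC : ∀ z, |g z| ≤ C) :
    ∃ (u : ℕ → ℝ × T3 → ℝ) (n : ℕ → ℝ → ℝ), (∀ k, Continuous (u k)) ∧ (∀ k, Continuous (n k)) ∧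
      (∀ k z, |u k z| ≤ C) ∧ (∀ k t, 0 ≤ n k t) ∧ (∀ k t, |n k t| ≤ C) ∧
      (∀ k t, eLpNorm (fun x => u k (t, x)) R volume ≤ ENNReal.ofReal (n k t)) ∧
      (∀ᵐ z ∂spaceTime T, Tendsto (fun k => u k z) atTop (𝓝 (g z))) ∧
      ∀ᵐ t ∂timeMeasure T,
        Tendsto (fun k => n k t) atTop (𝓝 (eLpNorm (fun x => g (t, x)) R volume).toReal) := by
  have hC0 : 0 ≤ C := (abs_nonneg _).trans (hC (0, 0))
  have hle : ∀ {v : ℝ × T3 → ℝ}, (∀ z, |v z| ≤ C) → ∀ t,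
      eLpNorm (fun x => v (t, x)) R (volume : Measure T3) ≤ ENNReal.ofReal C := fun hv t => by
    simpa using eLpNorm_le_of_ae_bound (p := R) (μ := (volume : Measure T3))
      (Eventually.of_forall fun x => hv (t, x))
  have hleR : ∀ {v : ℝ × T3 → ℝ}, (∀ z, |v z| ≤ C) → ∀ t,
      |(eLpNorm (fun x => v (t, x)) R (volume : Measure T3)).toReal| ≤ C := fun hv t => by
    rw [abs_of_nonneg ENNReal.toReal_nonneg]
    exact ENNReal.toReal_le_of_le_ofReal hC0 (hle hv t)
  obtain ⟨v, hv, hvC, hvlim⟩ := exists_continuous_tendsto_ae (μ := spaceTime T)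
    hg.aestronglyMeasurable hC
  have hR0 : R ≠ 0 := (zero_lt_one.trans_le hR).ne'
  rcases eq_or_ne R ⊤ with rfl | hRt
  · have hnm : Measurable fun t => (eLpNorm (fun x => g (t, x)) ⊤ (volume : Measure T3)).toReal := by
      have := measurable_eLpNorm_slice (ν := (volume : Measure T3)) hg.enorm ⊤
      simp only [eLpNorm_enorm] at this
      exact this.ennreal_toReal
    obtain ⟨n, hn, hnC, hnlim⟩ := exists_continuous_tendsto_ae (μ := timeMeasure T)
      hnm.aestronglyMeasurable (hleR hC)
    -- Slice sup norms of the v_k need not converge to those of g. Hence the slice norm of g is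
    -- approximated separately by continuous n_k(t), and v_k is clipped at height |n_k(t)|.
    refine ⟨fun k z => max (-|n k z.1|) (min (v k z) |n k z.1|), fun k t => |n k t|,
      fun k => by fun_prop, fun k => by fun_prop, fun k z => ?_, fun k t => abs_nonneg _,
      fun k t => by rw [abs_abs]; exact hnC k t, fun k t => ?_, ?_, ?_⟩
    · have h1 := hnC k z.1
      rw [abs_le]
      exact ⟨le_max_of_le_left (by linarith), max_le (by linarith [abs_nonneg (n k z.1)])
        ((min_le_right _ _).trans h1)⟩
    · rw [eLpNorm_exponent_top]
      refine eLpNormEssSup_le_of_ae_bound (Eventually.of_forall fun x => ?_)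
      rw [Real.norm_eq_abs, abs_le]
      exact ⟨le_max_left _ _, max_le (by linarith [abs_nonneg (n k t)]) (min_le_right _ _)⟩
    · have h1 : ∀ᵐ z ∂spaceTime T,
          |g z| ≤ (eLpNorm (fun x => g (z.1, x)) ⊤ (volume : Measure T3)).toReal := by
        have hms : MeasurableSet {z : ℝ × T3 |
            |g z| ≤ (eLpNorm (fun x => g (z.1, x)) ⊤ (volume : Measure T3)).toReal} :=
          measurableSet_le (by fun_prop) (hnm.comp measurable_fst)
        refine (Measure.ae_prod_iff_ae_ae hms).2 ?_
        refine Eventually.of_forall fun t => ?_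
        have h2 := ae_le_eLpNormEssSup (f := fun x => g (t, x)) (μ := (volume : Measure T3))
        filter_upwards [h2] with x hx
        rw [← eLpNorm_exponent_top] at hx
        have := ENNReal.toReal_mono (ne_top_of_le_ne_top ENNReal.ofReal_ne_top (hle hC t)) hx
        simpa using this
      have h2 : ∀ᵐ z ∂spaceTime T, Tendsto (fun k => n k z.1) atTop
          (𝓝 (eLpNorm (fun x => g (z.1, x)) ⊤ (volume : Measure T3)).toReal) :=
        Measure.quasiMeasurePreserving_fst.ae hnlim
      filter_upwards [hvlim, h1, h2] with z hz h1 h2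
      have h3 := (h2.abs.neg).max (hz.min h2.abs)
      rw [abs_of_nonneg (ENNReal.toReal_nonneg)] at h3
      have := abs_le.1 h1
      rwa [min_eq_left this.2, max_eq_right this.1] at h3
    · filter_upwards [hnlim] with t ht
      simpa using ht.abs
  -- For finite R no clipping is needed: the slice norms of v_k are continuous in t and converge by
  -- dominated convergence.
  · refine ⟨v, fun k t => (eLpNorm (fun x => v k (t, x)) R (volume : Measure T3)).toReal, hv,
      fun k => ?_, hvC, fun k t => ENNReal.toReal_nonneg, fun k t => hleR (hvC k) t,
      fun k t => ?_, hvlim, ?_⟩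
    · have h1 : ∀ t, (eLpNorm (fun x => v k (t, x)) R (volume : Measure T3)).toReal
          = (∫ x in Set.univ, |v k (t, x)| ^ R.toReal) ^ R.toReal⁻¹ := by
        intro t
        have hm : MemLp (fun x => v k (t, x)) R (volume : Measure T3) :=
          MemLp.of_bound (by fun_prop) C (Eventually.of_forall fun x => hvC k (t, x))
        rw [hm.eLpNorm_eq_integral_rpow_norm hR0 hRt, ENNReal.toReal_ofReal (by positivity)]
        simp
      simp_rw [h1]
      refine Continuous.rpow_const ?_ fun _ => Or.inr (by positivity)
      refine continuous_parametric_integral_of_continuous ?_ isCompact_univ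
      refine Continuous.rpow_const (by fun_prop) fun _ => Or.inr (by positivity)
    · rw [ENNReal.ofReal_toReal (ne_top_of_le_ne_top ENNReal.ofReal_ne_top (hle (hvC k) t))]
    · filter_upwards [Measure.ae_ae_of_ae_prod hvlim] with t ht
      refine (ENNReal.tendsto_toReal
        (ne_top_of_le_ne_top ENNReal.ofReal_ne_top (hle hC t))).comp ?_
      exact tendsto_eLpNorm_of_bounded hR0 hRt
        (fun k => by have := hv k; fun_prop) (fun k x => hvC k (t, x)) ht

/-- A bounded function in the unit ball of `L^Q(L^R)` can be replaced, in a pairing with an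
integrable function, by continuous functions in the unit ball. -/
lemma exists_continuous_unitBall_tendsto {Q R : ℝ≥0∞} (hQ : 1 ≤ Q) (hR : 1 ≤ R)
    {f g : ℝ × T3 → ℝ} (hf : Integrable f (spaceTime T)) (hg : Measurable g)
    {C : ℝ} (hC : ∀ z, |g z| ≤ C) (hg1 : mixedNorm T Q R g ≤ 1) :
    ∃ h : ℕ → ℝ × T3 → ℝ, (∀ k, Continuous (h k)) ∧ (∀ k, mixedNorm T Q R (h k) ≤ 1) ∧
      Tendsto (fun k => ∫ z, f z * h k z ∂spaceTime T) atTop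
        (𝓝 (∫ z, f z * g z ∂spaceTime T)) := by
  obtain ⟨u, n, hu, hn, huC, hn0, hnC, hun, hulim, hnlim⟩ :=
    exists_continuous_slice_approx (T := T) hR hg hC
  have hgfin : ∀ t, eLpNorm (fun x => g (t, x)) R (volume : Measure T3) ≠ ⊤ := fun t => by
    refine ne_top_of_le_ne_top (ENNReal.ofReal_ne_top (r := C)) ?_
    simpa using eLpNorm_le_of_ae_bound (p := R) (μ := (volume : Measure T3))
      (Eventually.of_forall fun x => hC (t, x))
  -- The approximants may leave the unit ball slightly. A continuous factor c_k(t) ≤ 1 that tends to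
  -- 1 brings them back without changing the limit.
  suffices hc : ∃ c : ℕ → ℝ → ℝ, (∀ k, Continuous (c k)) ∧ (∀ k t, 0 ≤ c k t) ∧
      (∀ k t, c k t ≤ 1) ∧ (∀ᵐ t ∂timeMeasure T, Tendsto (fun k => c k t) atTop (𝓝 1)) ∧
      ∀ k, eLpNorm (fun t => c k t * n k t) Q (timeMeasure T) ≤ 1 by
    obtain ⟨c, hcc, hc0, hc1, hclim, hcn⟩ := hc
    have hlim : ∀ᵐ z ∂spaceTime T, Tendsto (fun k => c k z.1 * u k z) atTop (𝓝 (g z)) := by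
      have h2 : ∀ᵐ z ∂spaceTime T, Tendsto (fun k => c k z.1) atTop (𝓝 1) :=
        Measure.quasiMeasurePreserving_fst.ae hclim
      filter_upwards [hulim, h2] with z h1 h2
      simpa using h2.mul h1
    refine ⟨fun k z => c k z.1 * u k z, fun k => by have := hcc k; have := hu k; fun_prop,
      fun k => ?_, ?_⟩
    · refine le_trans (eLpNorm_mono_enorm fun t => ?_) (hcn k)
      rw [enorm_eq_self, enorm_mul]
      have h1 : eLpNorm (fun x => c k t * u k (t, x)) R (volume : Measure T3)
          = ‖c k t‖ₑ * eLpNorm (fun x => u k (t, x)) R volume :=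
        eLpNorm_const_smul (c k t) (fun x => u k (t, x)) R volume
      rw [h1]
      gcongr
      rw [Real.enorm_eq_ofReal (hn0 k t)]
      exact hun k t
    · refine tendsto_integral_of_dominated_convergence (fun z => |f z| * C) (fun k => ?_)
        (hf.abs.mul_const C) (fun k => Eventually.of_forall fun z => ?_) ?_
      · refine hf.aestronglyMeasurable.mul (Continuous.aestronglyMeasurable ?_)
        have := hcc k; have := hu k; fun_prop
      · rw [norm_mul, norm_mul, Real.norm_eq_abs, Real.norm_eq_abs, Real.norm_eq_abs]
        gcongr
        calc |c k z.1| * |u k z| ≤ 1 * C := by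
              gcongr
              · rw [abs_of_nonneg (hc0 _ _)]; exact hc1 _ _
              · exact huC k z
          _ = C := one_mul C
      · filter_upwards [hlim] with z hz
        exact hz.const_mul (f z)
  rcases eq_or_ne Q ⊤ with rfl | hQt
  -- For Q = ∞ the constraint is pointwise in time, and so is the normalisation.
  · refine ⟨fun k t => (max 1 (n k t))⁻¹, fun k => ?_, fun k t => by positivity, fun k t => ?_, ?_,
      fun k => ?_⟩
    · exact Continuous.inv₀ (by have := hn k; fun_prop) fun t => by positivity
    · exact inv_le_one_of_one_le₀ (le_max_left _ _)
    · have h1 : ∀ᵐ t ∂timeMeasure T, eLpNorm (fun x => g (t, x)) R (volume : Measure T3) ≤ 1 := by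
        have := ENNReal.ae_le_essSup (μ := timeMeasure T)
          (fun t => eLpNorm (fun x => g (t, x)) R (volume : Measure T3))
        filter_upwards [this] with t ht
        exact ht.trans hg1
      filter_upwards [hnlim, h1] with t ht h1
      have h2 := (tendsto_const_nhds (x := (1 : ℝ))).max ht
      rw [max_eq_left (ENNReal.toReal_le_of_le_ofReal zero_le_one (by simpa using h1))] at h2
      simpa using h2.inv₀ one_ne_zero
    · rw [eLpNorm_exponent_top]
      refine (eLpNormEssSup_le_of_ae_bound (C := 1) (Eventually.of_forall fun t => ?_)).trans
        (by simp)
      rw [Real.norm_eq_abs, abs_of_nonneg (mul_nonneg (by positivity) (hn0 k t)),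
        inv_mul_le_iff₀ (by positivity), mul_one]
      exact le_max_right _ _
  · have hlim := tendsto_eLpNorm_of_bounded (Q := Q) (zero_lt_one.trans_le hQ).ne' hQt
      (fun k => (hn k).aestronglyMeasurable) hnC hnlim
    have heq : eLpNorm (fun t => (eLpNorm (fun x => g (t, x)) R (volume : Measure T3)).toReal) Q
        (timeMeasure T) = mixedNorm T Q R g := by
      refine eLpNorm_congr_enorm_ae (Eventually.of_forall fun t => ?_)
      rw [Real.enorm_eq_ofReal ENNReal.toReal_nonneg, ENNReal.ofReal_toReal (hgfin t),
        enorm_eq_self]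
    rw [heq] at hlim
    have hfin : ∀ k, eLpNorm (n k) Q (timeMeasure T) ≠ ⊤ := fun k =>
      (MemLp.of_bound (hn k).aestronglyMeasurable C
        (Eventually.of_forall (hnC k))).eLpNorm_ne_top
    have hlim' := (ENNReal.tendsto_toReal (ne_top_of_le_ne_top ENNReal.one_ne_top hg1)).comp hlim
    -- For finite Q the norms converge to a number at most 1, so a factor constant in time suffices.
    refine ⟨fun k _ => (max 1 (eLpNorm (n k) Q (timeMeasure T)).toReal)⁻¹,
      fun k => continuous_const, fun k t => by positivity,
      fun k t => inv_le_one_of_one_le₀ (le_max_left _ _), Eventually.of_forall fun t => ?_,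
      fun k => ?_⟩
    · have h2 := (tendsto_const_nhds (x := (1 : ℝ))).max hlim'
      rw [max_eq_left (ENNReal.toReal_le_of_le_ofReal zero_le_one (by simpa using hg1))] at h2
      simpa using h2.inv₀ one_ne_zero
    · have h1 := eLpNorm_const_smul ((max 1 (eLpNorm (n k) Q (timeMeasure T)).toReal)⁻¹) (n k) Q
        (timeMeasure T)
      refine (show _ = _ from h1).le.trans ?_
      rw [Real.enorm_eq_ofReal (by positivity)]
      nth_rw 2 [← ENNReal.ofReal_toReal (hfin k)]
      rw [← ENNReal.ofReal_mul (by positivity), ← ENNReal.ofReal_one]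
      refine ENNReal.ofReal_le_ofReal ?_
      rw [inv_mul_le_iff₀ (by positivity), mul_one]
      exact le_max_right _ _

/-- The mixed norm is the supremum of the pairings with continuous functions in the unit ball of
the dual exponents. -/
lemma exists_continuous_integral_gt {Q Q' R R' : ℝ≥0∞} [hQQ : Q.HolderConjugate Q']
    [hRR : R.HolderConjugate R'] (hR : R ≠ ⊤) {f : ℝ × T3 → ℝ} (hf : MemLqLp T Q R f)
    {M : ℝ} (hM0 : 0 ≤ M) (hM : ENNReal.ofReal M < mixedNorm T Q R f) :
    ∃ h : ℝ × T3 → ℝ, Continuous h ∧ mixedNorm T Q' R' h ≤ 1 ∧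
      M < ∫ z, f z * h z ∂spaceTime T := by
  wlog hfm : Measurable f generalizing f
  · have hae := hf.1.ae_eq_mk
    have hm := mixedNorm_congr_ae (q := Q) (p := R) hae
    obtain ⟨h, h1, h2, h3⟩ := this (f := hf.1.mk f)
      ⟨hf.1.stronglyMeasurable_mk.aestronglyMeasurable, hm ▸ hf.2⟩ (hm ▸ hM)
      hf.1.stronglyMeasurable_mk.measurable
    refine ⟨h, h1, h2, h3.trans_eq (integral_congr_ae ?_)⟩
    filter_upwards [hae] with z hz
    rw [hz]
  have hfi : Integrable f (spaceTime T) := by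
    have h1 : MemLqLp T Q' R' (fun _ => (1 : ℝ)) :=
      ⟨aestronglyMeasurable_const, (mixedNorm_le_of_bound (R := 1) (by simp)).trans_lt
        (ENNReal.mul_lt_top (by simp) (ENNReal.rpow_lt_top_of_nonneg (by simp)
          (measure_ne_top _ _)))⟩
    simpa using integrable_mul_of_mixed hf h1
  set F : ℝ → ℝ≥0∞ := fun t => eLpNorm (fun x => f (t, x)) R (volume : Measure T3) with hF
  have hFm : Measurable F := by
    have := measurable_eLpNorm_slice (ν := (volume : Measure T3)) hfm.enorm R
    simpa only [eLpNorm_enorm] using this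
  have hFq : eLpNorm F Q (timeMeasure T) ≠ ⊤ := hf.2.ne
  have hFfin : ∀ᵐ t ∂timeMeasure T, F t ≠ ⊤ := by
    have h1 : eLpNorm F 1 (timeMeasure T) ≠ ⊤ := by
      refine ne_top_of_le_ne_top ?_ (eLpNorm_le_eLpNorm_mul_rpow_measure_univ
        (ENNReal.HolderConjugate.one_le Q Q') hFm.aestronglyMeasurable)
      refine ENNReal.mul_ne_top hFq (ENNReal.rpow_ne_top_of_nonneg ?_ (measure_ne_top _ _))
      have : Q.toReal⁻¹ ≤ 1 := by
        rcases eq_or_ne Q ⊤ with rfl | hQ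
        · simp
        · refine inv_le_one_of_one_le₀ ?_
          simpa using ENNReal.toReal_mono hQ (ENNReal.HolderConjugate.one_le Q Q')
      simpa using this
    rw [eLpNorm_one_eq_lintegral_enorm] at h1
    filter_upwards [ae_lt_top hFm h1] with t ht using ht.ne
  obtain ⟨γ, hγm, hγ1, hγM⟩ := exists_lintegral_mul_gt (q := Q) (q' := Q') hFm hFq hM
  -- A norming function for the mixed norm: γ norms the slice norms in time, and in each slice it
  -- multiplies the extremal power of |f|. That power is available only for finite R.
  set g : ℝ × T3 → ℝ≥0∞ := fun z =>
    γ z.1 * (‖f z‖ₑ ^ (R.toReal - 1) * F z.1 ^ (1 - R.toReal)) with hg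
  have hgm : Measurable g := by fun_prop
  have hext : ∀ t, _ := fun t => extremal_rpow (μ := (volume : Measure T3)) (r := R) (r' := R') hR
    (F := fun x => ‖f (t, x)‖ₑ) (by fun_prop)
  simp only [eLpNorm_enorm] at hext
  have hg1 : mixedENorm T Q' R' g ≤ 1 := by
    refine le_trans (eLpNorm_mono_enorm fun t => ?_) hγ1
    simp only [enorm_eq_self, hg]
    refine (eLpNorm_le_mul_eLpNorm_of_ae_le_mul'' (c := γ t)
      (g := fun x => ‖f (t, x)‖ₑ ^ (R.toReal - 1) * F t ^ (1 - R.toReal)) R'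
      (Measurable.aestronglyMeasurable (by fun_prop)) (by simp)).trans ?_
    exact (mul_le_mul_right (hext t).1 _).trans (by simp)
  have hgM : ENNReal.ofReal M < ∫⁻ z, ‖f z‖ₑ * g z ∂spaceTime T := by
    refine hγM.trans_le ?_
    unfold spaceTime
    rw [lintegral_prod _ (by fun_prop)]
    refine lintegral_mono_ae ?_
    filter_upwards [hFfin] with t ht
    rw [show F t = _ from ((hext t).2 ht).symm, mul_comm, ← lintegral_const_mul _ (by fun_prop)]
    refine lintegral_mono fun x => le_of_eq ?_
    simp only [hg, hF]
    ring
  -- Monotone convergence makes the norming function bounded, as approximation by continuous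
  -- functions requires. The sign of f is put back afterwards in `G`.
  have hsup : ∫⁻ z, ‖f z‖ₑ * g z ∂spaceTime T
      = ⨆ k : ℕ, ∫⁻ z, ‖f z‖ₑ * min (g z) k ∂spaceTime T := by
    rw [← lintegral_iSup (fun k => by fun_prop)]
    · refine lintegral_congr fun z => ?_
      rw [← ENNReal.mul_iSup]
      congr 1
      rw [← inf_iSup_eq, ENNReal.iSup_natCast, inf_top_eq]
    · intro i j hij z
      dsimp only
      gcongr
  rw [hsup, lt_iSup_iff] at hgM
  obtain ⟨k, hk⟩ := hgM
  set G : ℝ × T3 → ℝ := fun z => SignType.sign (f z) * (min (g z) k).toReal with hG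
  have hmin : ∀ z, min (g z) k ≠ ⊤ := fun z =>
    ne_top_of_le_ne_top (ENNReal.natCast_ne_top k) (min_le_right _ _)
  have hGm : Measurable G := by
    refine Measurable.mul ?_ (by fun_prop)
    have : Measurable fun x : ℝ => ((SignType.sign x : SignType) : ℝ) := by
      have h : (fun x : ℝ => ((SignType.sign x : SignType) : ℝ))
          = fun x => if 0 < x then 1 else if x < 0 then -1 else 0 := by
        ext x
        rcases lt_trichotomy x 0 with h | h | h
        · simp [h, not_lt.2 h.le]
        · simp [h]
        · simp [h]
      rw [h]
      exact Measurable.ite measurableSet_Ioi measurable_const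
        (Measurable.ite measurableSet_Iio measurable_const measurable_const)
    exact this.comp hfm
  have hsign : ∀ z, |((SignType.sign (f z) : SignType) : ℝ)| ≤ 1 := fun z => by
    rcases lt_trichotomy (f z) 0 with h | h | h <;> simp [h]
  have hGC : ∀ z, |G z| ≤ k := fun z => by
    rw [hG, abs_mul, abs_of_nonneg (ENNReal.toReal_nonneg (a := min (g z) k))]
    have h1 : (min (g z) k).toReal ≤ k := by
      simpa using ENNReal.toReal_mono (ENNReal.natCast_ne_top k) (min_le_right (g z) (k : ℝ≥0∞))
    calc _ ≤ 1 * (k : ℝ) := mul_le_mul (hsign z) h1 ENNReal.toReal_nonneg zero_le_one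
      _ = k := one_mul _
  have hG1 : mixedNorm T Q' R' G ≤ 1 := by
    rw [mixedNorm_eq_mixedENorm]
    refine (mixedENorm_mono_ae (Eventually.of_forall fun z => ?_)).trans hg1
    rw [hG, enorm_mul, Real.enorm_eq_ofReal_abs, Real.enorm_eq_ofReal ENNReal.toReal_nonneg,
      ENNReal.ofReal_toReal (hmin z)]
    calc _ ≤ 1 * g z := mul_le_mul' (by simpa using hsign z) (min_le_left _ _)
      _ = g z := one_mul _
  have hfG : M < ∫ z, f z * G z ∂spaceTime T := by
    have h1 : ∀ z, f z * G z = |f z| * (min (g z) k).toReal := fun z => by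
      rw [hG, ← mul_assoc, mul_comm (f z), sign_mul_self]
    simp_rw [h1]
    rw [integral_eq_lintegral_of_nonneg_ae (Eventually.of_forall fun z => by positivity)
      (by fun_prop)]
    have h2 : ∀ z, ENNReal.ofReal (|f z| * (min (g z) k).toReal) = ‖f z‖ₑ * min (g z) k :=
      fun z => by
        rw [ENNReal.ofReal_mul (abs_nonneg _), ENNReal.ofReal_toReal (hmin z),
          Real.enorm_eq_ofReal_abs]
    simp_rw [h2]
    refine (ENNReal.ofReal_lt_iff_lt_toReal hM0 ?_).1 hk
    refine ne_top_of_le_ne_top (b := ∫⁻ z, ‖f z‖ₑ * k ∂spaceTime T) ?_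
      (lintegral_mono fun z => by gcongr; exact min_le_right _ _)
    rw [lintegral_mul_const _ (by fun_prop)]
    exact ENNReal.mul_ne_top hfi.2.ne (ENNReal.natCast_ne_top k)
  obtain ⟨h, h1, h2, h3⟩ := exists_continuous_unitBall_tendsto
    (ENNReal.HolderConjugate.one_le Q' Q) (ENNReal.HolderConjugate.one_le R' R) hfi hGm hGC hG1
  obtain ⟨j, hj⟩ := (h3.eventually (lt_mem_nhds hfG)).exists
  exact ⟨h j, h1 j, h2 j, hj⟩

end Duality

/-! ### Weak-* boundedness implies norm boundedness. -/

section UniformBoundedness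

variable {T : ℝ} {q p : ℝ≥0∞}

/-- Valid at every point, with no summability assumption: if the series diverges, `tsum` takes a
default value but the right-hand side is infinite. -/
lemma enorm_tsum_sub_sum_le (u : ℕ → ℝ) (N : ℕ) :
    ‖∑' j, u j - ∑ j ∈ Finset.range N, u j‖ₑ ≤ ∑' j, ‖u (j + N)‖ₑ := by
  by_cases h : ∑' j, ‖u (j + N)‖ₑ = ⊤
  · rw [h]; exact le_top
  · have h1 : Summable fun j => ‖u (j + N)‖ := tsum_enorm_ne_top_iff_summable_norm.1 h
    have h2 : Summable u := (summable_nat_add_iff N).1 h1.of_norm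
    rw [← h2.sum_add_tsum_nat_add N, add_sub_cancel_left]
    exact enorm_tsum_le_tsum_enorm

lemma mixedNorm_const_mul (c : ℝ) {h : ℝ × T3 → ℝ} (hh : AEStronglyMeasurable h (spaceTime T)) :
    mixedNorm T q p (fun z => c * h z) ≤ ‖c‖ₑ * mixedNorm T q p h := by
  have h1 : ∀ t, eLpNorm (fun x => c * h (t, x)) p (volume : Measure T3)
      = ‖c‖ₑ * eLpNorm (fun x => h (t, x)) p volume := fun t =>
    eLpNorm_const_smul c (fun x => h (t, x)) p volume
  unfold mixedNorm
  simp_rw [h1]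
  refine eLpNorm_le_mul_eLpNorm_of_ae_le_mul'' q ?_ (by simp)
  have := aemeasurable_eLpNorm_slice (μ := timeMeasure T) (ν := (volume : Measure T3)) hh.enorm p
  simp only [eLpNorm_enorm] at this
  exact this.aestronglyMeasurable

/-- An absolutely convergent series of continuous functions belongs to the predual. -/
lemma memPredual_tsum {Q R : ℝ≥0∞} {q p : ℝ≥0∞} (hQ : Q.conjExponent = q) (hR : R.conjExponent = p)
    (hq : 1 ≤ q) (hp : 1 ≤ p) {u : ℕ → ℝ × T3 → ℝ} (hu : ∀ j, Continuous (u j))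
    (hsum : ∑' j, mixedNorm T q p (u j) ≠ ⊤) :
    MemPredual T Q R (fun z => ∑' j, u j z) := by
  subst hQ hR
  have hbound : ∀ N : ℕ, mixedNorm T Q.conjExponent R.conjExponent
      (fun z => ∑' j, u j z - ∑ j ∈ Finset.range N, u j z)
      ≤ ∑' j, mixedNorm T Q.conjExponent R.conjExponent (u (j + N)) := fun N => by
    simp only [mixedNorm_eq_mixedENorm]
    refine (mixedENorm_mono_ae (Eventually.of_forall fun z => enorm_tsum_sub_sum_le _ N)).trans ?_
    exact mixedENorm_tsum_le hq hp fun j => (hu (j + N)).measurable.enorm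
  refine ⟨⟨AEMeasurable.aestronglyMeasurable
    (AEMeasurable.tsum fun j => (hu j).measurable.aemeasurable), ?_⟩, fun δ hδ => ?_⟩
  · have := hbound 0
    simp only [Finset.range_zero, Finset.sum_empty, sub_zero, add_zero] at this
    exact this.trans_lt hsum.lt_top
  · have ht := ENNReal.tendsto_sum_nat_add
      (fun j => mixedNorm T Q.conjExponent R.conjExponent (u j)) hsum
    obtain ⟨N, hN⟩ := (ht.eventually (gt_mem_nhds hδ)).exists
    refine ⟨fun z => ∑ j ∈ Finset.range N, u j z, ?_, (hbound N).trans hN.le⟩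
    exact continuous_finsetSum _ fun j _ => hu j

lemma memPredual_of_continuous {Q R : ℝ≥0∞} {h : ℝ × T3 → ℝ} (hh : Continuous h)
    (hb : mixedNorm T Q.conjExponent R.conjExponent h < ⊤) : MemPredual T Q R h :=
  ⟨⟨hh.aestronglyMeasurable, hb⟩, fun δ _ => ⟨h, hh, by simp [mixedNorm]⟩⟩

/-- A sequence that is bounded on each element of the predual is bounded in `L^Q(L^R)`. -/
theorem exists_mixedNorm_le {Q R : ℝ≥0∞} (hQ : 1 ≤ Q) (hR : 1 ≤ R) (hRt : R ≠ ⊤)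
    {f : ℕ → ℝ × T3 → ℝ} (hf : ∀ n, MemLqLp T Q R (f n))
    (hbdd : ∀ g, MemPredual T Q R g → ∃ C : ℝ, ∀ n, |∫ z, f n z * g z ∂spaceTime T| ≤ C) :
    ∃ C : ℝ≥0, ∀ n, mixedNorm T Q R (f n) ≤ C := by
  have := ENNReal.HolderConjugate.conjExponent hQ
  have := ENNReal.HolderConjugate.conjExponent hR
  set Q' := Q.conjExponent with hQ'
  set R' := R.conjExponent with hR'
  have hQ1 : 1 ≤ Q' := ENNReal.HolderConjugate.one_le Q' Q
  have hR1 : 1 ≤ R' := ENNReal.HolderConjugate.one_le R' R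
  -- Duality yields pairings above any level strictly below the norm; half the norm is used, and the
  -- zero norm is treated apart.
  have hex : ∀ n, ∃ h : ℝ × T3 → ℝ, Continuous h ∧ mixedNorm T Q' R' h ≤ 1 ∧
      (mixedNorm T Q R (f n)).toReal ≤ 2 * ∫ z, f n z * h z ∂spaceTime T := by
    intro n
    by_cases h0 : mixedNorm T Q R (f n) = 0
    · exact ⟨0, continuous_const, by simp [mixedNorm], by simp [h0]⟩
    · have hpos := ENNReal.toReal_pos h0 (hf n).2.ne
      obtain ⟨h, h1, h2, h3⟩ := exists_continuous_integral_gt (Q' := Q') (R' := R') hRt (hf n)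
        (M := (mixedNorm T Q R (f n)).toReal / 2) (by positivity) (by
          rw [ENNReal.ofReal_lt_iff_lt_toReal (by positivity) (hf n).2.ne]
          linarith)
      exact ⟨h, h1, h2, by linarith⟩
  choose h hc h1 h2 using hex
  have hpair : ∀ n j, ∫ z, ‖f n z * h j z‖ ∂spaceTime T ≤ (mixedNorm T Q R (f n)).toReal := by
    intro n j
    rw [integral_norm_eq_lintegral_enorm (f := fun z => f n z * h j z) ((hf n).1.mul (hc j).aestronglyMeasurable)]
    refine ENNReal.toReal_mono (hf n).2.ne ?_
    refine (lintegral_enorm_mul_le (q := Q) (p := R) (q' := Q') (p' := R') (hf n).1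
      (hc j).aestronglyMeasurable).trans ?_
    exact (mul_le_mul_right (h1 j) _).trans (by simp)
  have hint : ∀ n j, Integrable (fun z => f n z * h j z) (spaceTime T) := fun n j =>
    integrable_mul_of_mixed (q := Q) (p := R) (q' := Q') (p' := R') (hf n)
      ⟨(hc j).aestronglyMeasurable, (h1 j).trans_lt ENNReal.one_lt_top⟩
  have hpair' : ∀ n j, |∫ z, f n z * h j z ∂spaceTime T| ≤ (mixedNorm T Q R (f n)).toReal :=
    fun n j => (norm_integral_le_integral_norm _).trans (hpair n j)
  have hsummable : ∀ c : lp (fun _ : ℕ => ℝ) 1, Summable fun j => |c j| := fun c => by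
    simpa using (lp.memℓp c).summable (by simp)
  have hnorm : ∀ c : lp (fun _ : ℕ => ℝ) 1, ‖c‖ = ∑' j, |c j| := fun c => by
    simpa using lp.norm_eq_tsum_rpow (p := 1) (by simp) c
  have hsum : ∀ n (c : lp (fun _ : ℕ => ℝ) 1),
      Summable fun j => c j * ∫ z, f n z * h j z ∂spaceTime T := fun n c => by
    refine Summable.of_norm_bounded ((hsummable c).mul_right (mixedNorm T Q R (f n)).toReal)
      fun j => ?_
    rw [norm_mul, Real.norm_eq_abs, Real.norm_eq_abs]
    exact mul_le_mul_of_nonneg_left (hpair' n j) (abs_nonneg _)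
  -- Banach–Steinhaus needs a complete space. The Banach space ℓ^1 takes the place of the predual,
  -- through c ↦ ∑ c_j h_j, a series that converges absolutely in the mixed norm and so stays in the
  -- predual.
  let Λ₀ : ∀ n : ℕ, lp (fun _ : ℕ => ℝ) 1 →ₗ[ℝ] ℝ := fun n =>
    { toFun := fun c => ∑' j, c j * ∫ z, f n z * h j z ∂spaceTime T
      map_add' := fun c d => by
        rw [← (hsum n c).tsum_add (hsum n d)]
        exact tsum_congr fun j => by simp [add_mul]
      map_smul' := fun a c => by
        simp only [lp.coeFn_smul, Pi.smul_apply, smul_eq_mul, RingHom.id_apply, mul_assoc]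
        exact tsum_mul_left }
  let Λ : ∀ n : ℕ, lp (fun _ : ℕ => ℝ) 1 →L[ℝ] ℝ := fun n =>
    (Λ₀ n).mkContinuous (mixedNorm T Q R (f n)).toReal fun c => by
      rw [hnorm, mul_comm, ← tsum_mul_right]
      refine (norm_tsum_le_tsum_norm (hsum n c).norm).trans
        ((hsum n c).norm.tsum_le_tsum (fun j => ?_) ((hsummable c).mul_right _))
      rw [norm_mul, Real.norm_eq_abs, Real.norm_eq_abs]
      exact mul_le_mul_of_nonneg_left (hpair' n j) (abs_nonneg _)
  have hΛ : ∀ n c, Λ n c = ∑' j, c j * ∫ z, f n z * h j z ∂spaceTime T := fun n c => rfl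
  have hΛint : ∀ n (c : lp (fun _ : ℕ => ℝ) 1),
      Λ n c = ∫ z, f n z * (∑' j, c j * h j z) ∂spaceTime T := fun n c => by
    have hs : Summable fun j => ∫ z, ‖c j * (f n z * h j z)‖ ∂spaceTime T := by
      refine Summable.of_nonneg_of_le (fun j => integral_nonneg fun z => norm_nonneg _) (fun j => ?_)
        ((hsummable c).mul_right (mixedNorm T Q R (f n)).toReal)
      simp_rw [norm_mul (c j)]
      rw [integral_const_mul]
      exact mul_le_mul_of_nonneg_left (hpair n j) (abs_nonneg _)
    have := (hasSum_integral_of_summable_integral_norm (fun j => (hint n j).const_mul (c j))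
      hs).tsum_eq
    simp_rw [integral_const_mul] at this
    rw [hΛ, this]
    refine integral_congr_ae (Eventually.of_forall fun z => ?_)
    dsimp only
    rw [← tsum_mul_left]
    exact tsum_congr fun j => by ring
  obtain ⟨C, hC⟩ := banach_steinhaus (g := Λ) fun c => by
    obtain ⟨C, hC⟩ := hbdd (fun z => ∑' j, c j * h j z) (by
      refine memPredual_tsum (q := Q') (p := R') rfl rfl hQ1 hR1
        (fun j => by have := hc j; fun_prop) ?_
      refine ne_top_of_le_ne_top (b := ∑' j, ‖c j‖ₑ) ?_ (ENNReal.tsum_le_tsum fun j => ?_)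
      · exact tsum_enorm_ne_top_iff_summable_norm.2 (hsummable c)
      · refine (mixedNorm_const_mul (c j) (hc j).aestronglyMeasurable).trans ?_
        exact (mul_le_mul_right (h1 j) _).trans (by simp))
    exact ⟨C, fun n => by rw [hΛint, Real.norm_eq_abs]; exact hC n⟩
  refine ⟨(2 * C).toNNReal, fun n => ?_⟩
  -- The n-th unit vector of ℓ^1 recovers the nearly norming pairing of f_n with h_n.
  have h3 : Λ n (lp.single 1 n (1 : ℝ)) = ∫ z, f n z * h n z ∂spaceTime T := by
    rw [hΛ, tsum_eq_single n]
    · simp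
    · intro j hj
      simp [hj]
  have h4 : Λ n (lp.single 1 n (1 : ℝ)) ≤ C := by
    refine (le_abs_self _).trans (((Λ n).le_opNorm _).trans ?_)
    rw [lp.norm_single (by simp)]
    simpa using hC n
  rw [← ENNReal.ofReal_toReal (hf n).2.ne]
  exact ENNReal.ofReal_le_ofReal ((h2 n).trans (by rw [h3] at h4; linarith))

end UniformBoundedness

/-! ### The kernels on the circle and their primitives. -/

section CircleKernel

/-- `cos (2πx)` on the circle. -/
def circleCos (x : UnitAddCircle) : ℝ := (fourier 1 x : ℂ).re

/-- `sin (2πx)` on the circle. -/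
def circleSin (x : UnitAddCircle) : ℝ := (fourier 1 x : ℂ).im

lemma fourier_one_coe (y : ℝ) :
    (fourier 1 (y : UnitAddCircle) : ℂ) = Complex.exp ((2 * Real.pi * y : ℝ) * Complex.I) := by
  rw [fourier_coe_apply]
  congr 1
  push_cast
  simp
  ring

lemma circleCos_coe (y : ℝ) : circleCos y = Real.cos (2 * Real.pi * y) := by
  rw [circleCos, fourier_one_coe, Complex.exp_ofReal_mul_I_re]

lemma circleSin_coe (y : ℝ) : circleSin y = Real.sin (2 * Real.pi * y) := by
  rw [circleSin, fourier_one_coe, Complex.exp_ofReal_mul_I_im]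

@[fun_prop]
lemma continuous_circleCos : Continuous circleCos :=
  Complex.continuous_re.comp (fourier 1).continuous

@[fun_prop]
lemma continuous_circleSin : Continuous circleSin :=
  Complex.continuous_im.comp (fourier 1).continuous

lemma circleCos_neg (x : UnitAddCircle) : circleCos (-x) = circleCos x := by
  induction x using QuotientAddGroup.induction_on with | _ y => ?_
  have := circleCos_coe (-y)
  rw [AddCircle.coe_neg] at this
  rw [this, circleCos_coe, mul_neg, Real.cos_neg]

/-- `cos² (πx)` on the circle. -/
def circleCosSq (x : UnitAddCircle) : ℝ := (1 + circleCos x) / 2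

@[fun_prop]
lemma continuous_circleCosSq : Continuous circleCosSq := by unfold circleCosSq; fun_prop

/-- The double angle formula. It turns every estimate below into one on powers of c = cos²(πx),
whose integrals are explicit. -/
lemma circleSin_sq (x : UnitAddCircle) :
    circleSin x ^ 2 = 4 * (1 - circleCosSq x) * circleCosSq x := by
  induction x using QuotientAddGroup.induction_on with | _ y => ?_
  rw [circleCosSq, circleCos_coe, circleSin_coe, Real.sin_sq]
  ring

lemma circleCosSq_mem (x : UnitAddCircle) : 0 ≤ circleCosSq x ∧ circleCosSq x ≤ 1 := by
  induction x using QuotientAddGroup.induction_on with | _ y => ?_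
  rw [circleCosSq, circleCos_coe]
  constructor <;> linarith [Real.neg_one_le_cos (2 * Real.pi * y), Real.cos_le_one (2 * Real.pi * y)]

lemma circleCosSq_zero : circleCosSq 0 = 1 := by
  have := circleCos_coe 0
  simp only [AddCircle.coe_zero, mul_zero, Real.cos_zero] at this
  rw [circleCosSq, this]; norm_num

lemma circleCosSq_lt_one {x : UnitAddCircle} (hx : x ≠ 0) : circleCosSq x < 1 := by
  refine lt_of_le_of_ne (circleCosSq_mem x).2 fun h => hx ?_
  have hs : circleSin x = 0 := by
    have := circleSin_sq x
    rw [h] at this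
    simpa using this
  have hc : circleCos x = 1 := by rw [circleCosSq] at h; linarith
  have h1 : (fourier 1 x : ℂ) = 1 := Complex.ext hc hs
  rw [fourier_one] at h1
  refine AddCircle.injective_toCircle one_ne_zero (Circle.ext ?_)
  rw [h1, AddCircle.toCircle_zero, Circle.coe_one]

/-- The normalising constant `4^n / (2n choose n)`. -/
def kernelConst : ℕ → ℝ
  | 0 => 1
  | n + 1 => kernelConst n * ((2 * n + 2) / (2 * n + 1))

lemma kernelConst_pos (n : ℕ) : 0 < kernelConst n := by
  induction n with
  | zero => simp [kernelConst]
  | succ n ih => rw [kernelConst]; positivity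

lemma kernelConst_succ (n : ℕ) :
    kernelConst (n + 1) * (2 * n + 1) = kernelConst n * (2 * n + 2) := by
  rw [kernelConst]; field_simp

lemma kernelConst_le_succ (n : ℕ) : kernelConst n ≤ kernelConst (n + 1) := by
  have := kernelConst_succ n
  nlinarith [kernelConst_pos n, kernelConst_pos (n + 1), (Nat.cast_nonneg n : (0 : ℝ) ≤ n)]

/-- The growth is that of √n. The induction closes because (4n+5)(2n+1)² exceeds (4n+1)(2n+2)² by
exactly 1. -/
lemma kernelConst_sq_le (n : ℕ) : kernelConst n ^ 2 ≤ 4 * n + 1 := by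
  induction n with
  | zero => simp [kernelConst]
  | succ n ih =>
    rw [kernelConst, mul_pow]
    have hn : (0 : ℝ) ≤ n := Nat.cast_nonneg n
    calc _ ≤ (4 * n + 1) * ((2 * n + 2) / (2 * n + 1) : ℝ) ^ 2 := by gcongr
      _ ≤ _ := by
        rw [div_pow, mul_div_assoc', div_le_iff₀ (by positivity)]
        push_cast
        nlinarith

/-- The approximate identity `cₙ cos²ⁿ(πx)` on the circle. -/
def circleKernel (n : ℕ) (x : UnitAddCircle) : ℝ := kernelConst n * circleCosSq x ^ n

/-- A primitive of `circleKernel n - circleKernel (n + 1)`. -/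
def circlePrim (n : ℕ) (x : UnitAddCircle) : ℝ :=
  -(kernelConst n / (2 * Real.pi * (2 * n + 1))) * (circleSin x * circleCosSq x ^ n)

@[fun_prop]
lemma continuous_circleKernel (n : ℕ) : Continuous (circleKernel n) := by
  unfold circleKernel; fun_prop

@[fun_prop]
lemma continuous_circlePrim (n : ℕ) : Continuous (circlePrim n) := by
  unfold circlePrim; fun_prop

lemma circleKernel_nonneg (n : ℕ) (x : UnitAddCircle) : 0 ≤ circleKernel n x :=
  mul_nonneg (kernelConst_pos n).le (pow_nonneg (circleCosSq_mem x).1 n)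

lemma circleKernel_le (n : ℕ) (x : UnitAddCircle) : circleKernel n x ≤ kernelConst n :=
  mul_le_of_le_one_right (kernelConst_pos n).le
    (pow_le_one₀ (circleCosSq_mem x).1 (circleCosSq_mem x).2)

lemma circleKernel_neg (n : ℕ) (x : UnitAddCircle) : circleKernel n (-x) = circleKernel n x := by
  simp only [circleKernel, circleCosSq, circleCos_neg]

lemma contDiff_circleKernel_coe (n : ℕ) : ContDiff ℝ ∞ fun y : ℝ => circleKernel n y := by
  simp only [circleKernel, circleCosSq, circleCos_coe]
  fun_prop

lemma contDiff_circlePrim_coe (n : ℕ) : ContDiff ℝ ∞ fun y : ℝ => circlePrim n y := by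
  simp only [circlePrim, circleCosSq, circleCos_coe, circleSin_coe]
  fun_prop

/-- With c = cos²(πy), the derivative of sin(2πy) cⁿ is 2π cⁿ ((2n+2)c - (2n+1)). The recursion for
`kernelConst` is the one that makes this a difference of consecutive kernels. -/
lemma hasDerivAt_circlePrim_coe (n : ℕ) (y : ℝ) :
    HasDerivAt (fun y : ℝ => circlePrim n y) (circleKernel n y - circleKernel (n + 1) y) y := by
  simp only [circlePrim, circleKernel, circleCosSq, circleCos_coe, circleSin_coe]
  have hlin : HasDerivAt (fun y : ℝ => 2 * Real.pi * y) (2 * Real.pi) y := by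
    simpa using (hasDerivAt_id y).const_mul (2 * Real.pi)
  have hs := hlin.sin
  have hc := ((hlin.cos.const_add 1).div_const 2).fun_pow n
  refine ((hs.mul hc).const_mul (-(kernelConst n / (2 * Real.pi * (2 * n + 1))))).congr_deriv ?_
  have hk : kernelConst (n + 1) = kernelConst n * (2 * n + 2) / (2 * n + 1) := by
    rw [eq_div_iff (by positivity), kernelConst_succ]
  rw [hk]
  have hsq := Real.sin_sq_add_cos_sq (2 * Real.pi * y)
  set s := Real.sin (2 * Real.pi * y)
  set c := Real.cos (2 * Real.pi * y)
  have hpi := Real.pi_pos.ne'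
  rcases n with _ | n
  · field_simp
    simp
    ring
  · simp only [Nat.add_sub_cancel]
    push_cast
    field_simp
    ring_nf
    have hs2 : s ^ 2 = 1 - c ^ 2 := by linarith
    rw [hs2]
    ring

/-- Consecutive kernels differ by the derivative of a periodic function, so all have the integral of
the first, which is the constant 1. -/
lemma integral_circleKernel (n : ℕ) : ∫ x, circleKernel n x = 1 := by
  induction n with
  | zero => simp [circleKernel, kernelConst]
  | succ n ih =>
    have hi : ∀ n, Integrable (circleKernel n) (volume : Measure UnitAddCircle) := fun n =>
      (continuous_circleKernel n).integrable_of_hasCompactSupport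
        (HasCompactSupport.of_compactSpace _)
    have h0 : ∫ x, (circleKernel n x - circleKernel (n + 1) x) = 0 := by
      rw [← UnitAddCircle.intervalIntegral_preimage 0,
        intervalIntegral.integral_eq_sub_of_hasDerivAt
          (f := fun y : ℝ => circlePrim n y) (fun y _ => hasDerivAt_circlePrim_coe n y)]
      · have : ((0 + 1 : ℝ) : UnitAddCircle) = ((0 : ℝ) : UnitAddCircle) := by
          simp
        rw [this, sub_self]
      · refine Continuous.intervalIntegrable ?_ _ _
        exact ((contDiff_circleKernel_coe n).continuous.sub
          (contDiff_circleKernel_coe (n + 1)).continuous)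
    rw [integral_sub (hi n) (hi (n + 1)), ih] at h0
    linarith

lemma integral_circleCosSq_pow (n : ℕ) : ∫ x, circleCosSq x ^ n = (kernelConst n)⁻¹ := by
  have := integral_circleKernel n
  simp only [circleKernel] at this
  rw [integral_const_mul] at this
  exact eq_inv_of_mul_eq_one_right this

lemma abs_circlePrim (n : ℕ) (x : UnitAddCircle) :
    |circlePrim n x| = kernelConst n / (2 * Real.pi * (2 * n + 1)) *
      (|circleSin x| * circleCosSq x ^ n) := by
  have := kernelConst_pos n
  rw [circlePrim, abs_mul, abs_neg, abs_of_nonneg (by positivity), abs_mul,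
    abs_of_nonneg (pow_nonneg (circleCosSq_mem x).1 n)]

lemma kernelConst_le (n : ℕ) : kernelConst n ≤ 2 * √(n + 1) := by
  refine le_of_sq_le_sq ?_ (by positivity)
  rw [mul_pow, Real.sq_sqrt (by positivity)]
  linarith [kernelConst_sq_le n]

/-- Each of the m+1 terms of the geometric sum 1 + c + ... + c^m is at least c^m, and (1 - c) times
the sum is at most 1. -/
lemma one_sub_mul_pow_le {c : ℝ} (h0 : 0 ≤ c) (h1 : c ≤ 1) (m : ℕ) :
    (1 - c) * c ^ m ≤ 1 / (m + 1) := by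
  rw [le_div_iff₀ (by positivity)]
  have h := mul_neg_geom_sum c (m + 1)
  have h2 : ((m : ℝ) + 1) * c ^ m ≤ ∑ i ∈ Finset.range (m + 1), c ^ i := by
    have := Finset.card_nsmul_le_sum (Finset.range (m + 1)) (fun i => c ^ i) (c ^ m)
      (fun i hi => pow_le_pow_of_le_one h0 h1 (Nat.lt_succ_iff.1 (Finset.mem_range.1 hi)))
    simpa using this
  have h3 : 0 ≤ c ^ (m + 1) := by positivity
  nlinarith [mul_le_mul_of_nonneg_left h2 (sub_nonneg.2 h1)]

/-- After squaring, sin² contributes 4(1 - c)c, and (1 - c)c^{2n+1} is of order 1/n. With a squared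
prefactor of order 1/n this gives the rate 1/n for the primitive. -/
lemma abs_circlePrim_le (n : ℕ) (x : UnitAddCircle) : |circlePrim n x| ≤ 1 / (n + 1) := by
  have hpi := Real.pi_gt_three
  have hk := kernelConst_pos n
  have hm : (0 : ℝ) < n + 1 := by positivity
  refine le_of_sq_le_sq ?_ (by positivity)
  rw [abs_circlePrim, mul_pow, mul_pow, sq_abs, circleSin_sq, div_pow]
  have h1 := one_sub_mul_pow_le (circleCosSq_mem x).1 (circleCosSq_mem x).2 (2 * n + 1)
  have h2 : 4 * (1 - circleCosSq x) * circleCosSq x * (circleCosSq x ^ n) ^ 2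
      = 4 * ((1 - circleCosSq x) * circleCosSq x ^ (2 * n + 1)) := by ring
  rw [h2]
  push_cast at h1
  have h3 : kernelConst n ^ 2 / (2 * Real.pi * (2 * n + 1)) ^ 2 ≤ 1 / (9 * (n + 1)) := by
    rw [div_le_div_iff₀ (by positivity) (by positivity)]
    have h4 := kernelConst_sq_le n
    have h5 : (36 : ℝ) * (2 * n + 1) ^ 2 ≤ (2 * Real.pi * (2 * n + 1)) ^ 2 := by
      have : (6 : ℝ) * (2 * n + 1) ≤ 2 * Real.pi * (2 * n + 1) := by gcongr; linarith
      calc _ = ((6 : ℝ) * (2 * n + 1)) ^ 2 := by ring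
        _ ≤ _ := by gcongr
    have h6 : (0 : ℝ) ≤ n := Nat.cast_nonneg n
    nlinarith [mul_le_mul_of_nonneg_right h4 (show (0 : ℝ) ≤ 9 * (n + 1) by positivity)]
  calc _ ≤ 1 / (9 * ((n : ℝ) + 1)) * (4 * (1 / (2 * n + 1 + 1))) := by
        gcongr
        have := (circleCosSq_mem x)
        exact mul_nonneg (by norm_num) (mul_nonneg (by linarith) (pow_nonneg this.1 _))
    _ ≤ _ := by
      rw [show (2 * (n : ℝ) + 1 + 1) = 2 * (n + 1) by ring]
      field_simp
      norm_num

/-- The kernel lives at distance n^{-1/2} from 0, where sin has size n^{-1/2}; the prefactor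
1/(2n+1) supplies the remaining power of n. -/
lemma integral_abs_circlePrim_le (n : ℕ) :
    ∫ x, |circlePrim n x| ≤ 1 / ((n + 1) * √(n + 1)) := by
  have hpi := Real.pi_gt_three
  have hk := kernelConst_pos n
  have hk1 := kernelConst_pos (n + 1)
  have hm : (0 : ℝ) < n + 1 := by positivity
  have hsm : 0 < √((n : ℝ) + 1) := by positivity
  have hi : ∀ f : UnitAddCircle → ℝ, Continuous f → Integrable f volume := fun f hf =>
    hf.integrable_of_hasCompactSupport (HasCompactSupport.of_compactSpace _)
  set r := √((n : ℝ) + 1) with hr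
  have hr2 : r ^ 2 = n + 1 := Real.sq_sqrt hm.le
  -- The inequality |s| ≤ r s²/2 + 1/(2r), with r = √(n+1) balancing the two terms, replaces |sin|
  -- by sin², hence by powers of c.
  have h1 : ∀ x, |circleSin x| * circleCosSq x ^ n
      ≤ 2 * r * (circleCosSq x ^ (n + 1) - circleCosSq x ^ (n + 2))
        + 1 / (2 * r) * circleCosSq x ^ n := by
    intro x
    have h2 : |circleSin x| ≤ r / 2 * circleSin x ^ 2 + 1 / (2 * r) := by
      have : 0 ≤ (r * |circleSin x| - 1) ^ 2 / (2 * r) := by positivity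
      have h3 : (r * |circleSin x| - 1) ^ 2 / (2 * r)
          = r / 2 * circleSin x ^ 2 + 1 / (2 * r) - |circleSin x| := by
        rw [← sq_abs (circleSin x)]; field_simp; ring
      linarith
    have h0 := pow_nonneg (circleCosSq_mem x).1 n
    calc _ ≤ (r / 2 * circleSin x ^ 2 + 1 / (2 * r)) * circleCosSq x ^ n := by gcongr
      _ = _ := by rw [circleSin_sq]; ring
  have h2 : ∫ x, |circleSin x| * circleCosSq x ^ n
      ≤ 2 * r * ((kernelConst (n + 1))⁻¹ - (kernelConst (n + 2))⁻¹)
        + 1 / (2 * r) * (kernelConst n)⁻¹ := by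
    refine (integral_mono (hi _ (by fun_prop)) (hi _ (by fun_prop)) h1).trans_eq ?_
    rw [integral_add (hi _ (by fun_prop)) (hi _ (by fun_prop)), integral_const_mul,
      integral_const_mul, integral_sub (hi _ (by fun_prop)) (hi _ (by fun_prop)),
      integral_circleCosSq_pow, integral_circleCosSq_pow, integral_circleCosSq_pow]
  have h3 : (kernelConst (n + 1))⁻¹ - (kernelConst (n + 2))⁻¹
      ≤ (kernelConst n)⁻¹ * (1 / (2 * (n + 1))) := by
    have h4 : (kernelConst (n + 2))⁻¹ = (kernelConst (n + 1))⁻¹ * ((2 * n + 3) / (2 * n + 4)) := by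
      have := kernelConst_succ (n + 1)
      have hk2 := kernelConst_pos (n + 2)
      push_cast at this
      field_simp
      linarith
    have h5 : (kernelConst (n + 1))⁻¹ ≤ (kernelConst n)⁻¹ :=
      inv_anti₀ hk (kernelConst_le_succ n)
    rw [h4]
    calc _ = (kernelConst (n + 1))⁻¹ * (1 / (2 * n + 4)) := by field_simp; ring
      _ ≤ _ := by gcongr; linarith
  simp_rw [abs_circlePrim]
  rw [integral_const_mul]
  calc _ ≤ kernelConst n / (2 * Real.pi * (2 * n + 1)) *
        (2 * r * ((kernelConst n)⁻¹ * (1 / (2 * (n + 1)))) + 1 / (2 * r) * (kernelConst n)⁻¹) := by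
        gcongr
        exact h2.trans (by gcongr)
    _ = 1 / (2 * Real.pi * (2 * n + 1)) * (3 / (2 * r)) := by
        rw [← hr2]; field_simp; ring
    _ ≤ 1 / (2 * (n + 1)) * (2 / r) := by
        gcongr ?_ * ?_
        · apply one_div_le_one_div_of_le (by positivity)
          have : (0 : ℝ) ≤ n := Nat.cast_nonneg n
          nlinarith
        · rw [div_le_div_iff₀ (by positivity) hsm]; linarith
    _ = _ := by field_simp

end CircleKernel

/-! ### The kernels on the torus, their divergence form and Young's inequality. -/

section TorusKernel

instance isNegInvariant_volume_T3 : (volume : Measure T3).IsNegInvariant :=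
  Measure.IsAddHaarMeasure.isNegInvariant_of_regular _

lemma integrable_of_continuous_T3 {E : Type*} [NormedAddCommGroup E] {f : T3 → E}
    (hf : Continuous f) : Integrable f (volume : Measure T3) :=
  hf.integrable_of_hasCompactSupport (HasCompactSupport.of_compactSpace _)

/-- The approximate identity on the torus. -/
def torusKernel (n : ℕ) (x : T3) : ℝ := ∏ j, circleKernel n (x j)

/-- The factors of `gradKernel`. -/
def gradFactor (n : ℕ) (i j : Fin 3) : UnitAddCircle → ℝ :=
  if j < i then circleKernel (n + 1) else if j = i then circlePrim n else circleKernel n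

/-- A vector field on the torus with divergence `torusKernel n - torusKernel (n + 1)`. -/
def gradKernel (n : ℕ) (i : Fin 3) (x : T3) : ℝ := ∏ j, gradFactor n i j (x j)

/-- The partial derivative of `gradKernel n i` in the direction `i`. -/
def gradKernelDeriv (n : ℕ) (i : Fin 3) (x : T3) : ℝ :=
  ∏ j, (if j < i then circleKernel (n + 1) (x j) else if j = i then
    circleKernel n (x j) - circleKernel (n + 1) (x j) else circleKernel n (x j))

@[fun_prop]
lemma continuous_torusKernel (n : ℕ) : Continuous (torusKernel n) := by
  unfold torusKernel; fun_prop

@[fun_prop]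
lemma continuous_gradFactor (n : ℕ) (i j : Fin 3) : Continuous (gradFactor n i j) := by
  unfold gradFactor
  split_ifs <;> fun_prop

@[fun_prop]
lemma continuous_gradKernel (n : ℕ) (i : Fin 3) : Continuous (gradKernel n i) := by
  unfold gradKernel; fun_prop

lemma torusKernel_nonneg (n : ℕ) (x : T3) : 0 ≤ torusKernel n x :=
  Finset.prod_nonneg fun j _ => circleKernel_nonneg n (x j)

lemma torusKernel_neg (n : ℕ) (x : T3) : torusKernel n (-x) = torusKernel n x :=
  Finset.prod_congr rfl fun j _ => circleKernel_neg n (x j)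

lemma integral_torusKernel (n : ℕ) : ∫ x, torusKernel n x = 1 := by
  have := integral_fintype_prod_eq_prod (𝕜 := ℝ) (fun (_ : Fin 3) => circleKernel n)
    (μ := fun _ => (volume : Measure UnitAddCircle))
  rw [← volume_pi] at this
  simp only [integral_circleKernel, Finset.prod_const_one] at this
  exact this

/-- A telescoping product: the factors change from index n to n + 1 one coordinate at a time. -/
lemma sum_gradKernelDeriv (n : ℕ) (x : T3) :
    ∑ i, gradKernelDeriv n i x = torusKernel n x - torusKernel (n + 1) x := by
  simp [gradKernelDeriv, torusKernel, Fin.sum_univ_three, Fin.prod_univ_three]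
  ring

/-- In dimension three the primitive, at most 1/(n+1), meets two kernel factors, each at most
2√(n+2) ≤ 3√(n+1). The powers of n cancel and leave 3 · 3. -/
lemma abs_gradKernel_le (n : ℕ) (i : Fin 3) (x : T3) : |gradKernel n i x| ≤ 9 := by
  have hk : ∀ m, m ≤ n + 1 → ∀ y, |circleKernel m y| ≤ 3 * √(n + 1) := by
    intro m hm y
    rw [abs_of_nonneg (circleKernel_nonneg m y)]
    refine (circleKernel_le m y).trans ((monotone_nat_of_le_succ kernelConst_le_succ hm).trans ?_)
    refine (kernelConst_le (n + 1)).trans ?_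
    refine le_of_sq_le_sq ?_ (by positivity)
    rw [mul_pow, mul_pow, Real.sq_sqrt (by positivity), Real.sq_sqrt (by positivity)]
    push_cast
    linarith [(Nat.cast_nonneg n : (0 : ℝ) ≤ n)]
  have h9 : (1 / ((n : ℝ) + 1)) * (3 * √(n + 1)) * (3 * √(n + 1)) = 9 := by
    have : √((n : ℝ) + 1) * √(n + 1) = n + 1 := Real.mul_self_sqrt (by positivity)
    field_simp
    nlinarith
  rw [gradKernel, Finset.abs_prod, Fin.prod_univ_three, ← h9]
  have hp := fun y => abs_circlePrim_le n y
  have h0 := hk n (by omega)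
  have h1 := hk (n + 1) le_rfl
  fin_cases i
  · simp only [gradFactor]
    simp
    have := hp (x 0)
    simp only [one_div] at this
    gcongr <;> simp only [h0]
  · simp only [gradFactor]
    simp
    have := hp (x 1)
    simp only [one_div] at this
    rw [mul_comm |circleKernel (n + 1) (x 0)|]
    gcongr <;> simp only [h0, h1]
  · simp only [gradFactor]
    simp
    have := hp (x 2)
    simp only [one_div] at this
    rw [mul_comm, ← mul_assoc]
    gcongr <;> simp only [h1]

/-- The integral factorises by Fubini, and the kernel factors have mass one. -/
lemma integral_abs_gradKernel_le (n : ℕ) (i : Fin 3) :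
    ∫ x, |gradKernel n i x| ≤ 1 / ((n + 1) * √(n + 1)) := by
  have h := integral_fintype_prod_eq_prod (𝕜 := ℝ) (fun j y => |gradFactor n i j y|)
    (μ := fun _ => (volume : Measure UnitAddCircle))
  rw [← volume_pi] at h
  simp only [gradKernel, Finset.abs_prod]
  rw [h]
  have hk : ∀ n, ∫ x, |circleKernel n x| = 1 := fun n => by
    simp_rw [abs_of_nonneg (circleKernel_nonneg n _)]
    exact integral_circleKernel n
  have hp := integral_abs_circlePrim_le n
  fin_cases i <;> simpa [Fin.prod_univ_three, gradFactor, hk] using hp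

lemma contDiff_gradFactor_coe (n : ℕ) (i j : Fin 3) :
    ContDiff ℝ ∞ fun y : ℝ => gradFactor n i j y := by
  unfold gradFactor
  split_ifs
  · exact contDiff_circleKernel_coe _
  · exact contDiff_circlePrim_coe _
  · exact contDiff_circleKernel_coe _

lemma isSmoothOnTorus_gradKernel_sub (n : ℕ) (i : Fin 3) (x : T3) :
    IsSmoothOnTorus fun y => gradKernel n i (x - y) := by
  have hx : ∀ j, ∃ r : ℝ, (r : UnitAddCircle) = x j := fun j =>
    QuotientAddGroup.mk_surjective (x j)
  choose r hr using hx
  unfold IsSmoothOnTorus gradKernel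
  simp only [Pi.sub_apply, ← hr, ← AddCircle.coe_sub]
  refine contDiff_prod fun j _ => ?_
  exact (contDiff_gradFactor_coe n i j).comp (contDiff_const.sub (contDiff_apply ℝ ℝ j))

lemma hasDerivAt_circlePrim_sub (n : ℕ) (z : UnitAddCircle) :
    HasDerivAt (fun h : ℝ => circlePrim n (z - h))
      (-(circleKernel n z - circleKernel (n + 1) z)) 0 := by
  obtain ⟨r, rfl⟩ := QuotientAddGroup.mk_surjective z
  have h1 : HasDerivAt (fun h : ℝ => r - h) (-1) 0 := by
    simpa using (hasDerivAt_id (0 : ℝ)).const_sub r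
  have h2 := hasDerivAt_circlePrim_coe n (r - 0)
  have h3 := h2.comp (0 : ℝ) h1
  simp only [sub_zero, mul_neg, mul_one] at h3
  refine h3.congr_of_eventuallyEq (Eventually.of_forall fun h => ?_)
  simp only [Function.comp_apply, AddCircle.coe_sub]

lemma torusPartial_gradKernel_sub (n : ℕ) (i : Fin 3) (x y : T3) :
    torusPartial i (fun y => gradKernel n i (x - y)) y = -gradKernelDeriv n i (x - y) := by
  unfold torusPartial
  refine HasDerivAt.deriv ?_
  have h := hasDerivAt_circlePrim_sub n ((x - y) i)
  obtain rfl | rfl | rfl : i = 0 ∨ i = 1 ∨ i = 2 := by fin_cases i <;> simp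
  · have h2 := (h.mul_const (circleKernel n ((x - y) 1))).mul_const (circleKernel n ((x - y) 2))
    refine (h2.congr_of_eventuallyEq (Eventually.of_forall fun t => ?_)).congr_deriv ?_
    · simp [gradKernel, gradFactor, Fin.prod_univ_three, sub_sub]
    · simp [gradKernelDeriv, Fin.prod_univ_three]
      ring
  · have h2 := (h.const_mul (circleKernel (n + 1) ((x - y) 0))).mul_const
      (circleKernel n ((x - y) 2))
    refine (h2.congr_of_eventuallyEq (Eventually.of_forall fun t => ?_)).congr_deriv ?_
    · simp [gradKernel, gradFactor, Fin.prod_univ_three, sub_sub]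
    · simp [gradKernelDeriv, Fin.prod_univ_three]
      ring
  · have h2 := h.const_mul (circleKernel (n + 1) ((x - y) 0) * circleKernel (n + 1) ((x - y) 1))
    refine (h2.congr_of_eventuallyEq (Eventually.of_forall fun t => ?_)).congr_deriv ?_
    · simp [gradKernel, gradFactor, Fin.prod_univ_three, sub_sub]
    · simp [gradKernelDeriv, Fin.prod_univ_three]
      ring

/-- Convolution on the torus. -/
def torusConv (u G : T3 → ℝ) (x : T3) : ℝ := ∫ y, u y * G (x - y)

lemma integrable_mul_continuous {u G : T3 → ℝ} (hu : Integrable u volume) (hG : Continuous G) :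
    Integrable (fun y => u y * G y) (volume : Measure T3) := by
  obtain ⟨C, hC⟩ := (isCompact_range hG).isBounded.exists_norm_le
  exact hu.mul_bdd hG.aestronglyMeasurable (c := C)
    (Eventually.of_forall fun y => hC _ (Set.mem_range_self y))

lemma aestronglyMeasurable_torusConv {u G : T3 → ℝ} (hu : AEStronglyMeasurable u volume)
    (hG : Continuous G) : AEStronglyMeasurable (torusConv u G) volume := by
  have : AEStronglyMeasurable (fun z : T3 × T3 => u z.2 * G (z.1 - z.2))
      ((volume : Measure T3).prod volume) := by
    refine AEStronglyMeasurable.mul hu.comp_snd (Continuous.aestronglyMeasurable ?_)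
    fun_prop
  exact this.integral_prod_right'

/-- The weak derivatives are tested with y ↦ G(x - y) for G the components of the field. The sign
from differentiating in y cancels the sign from integrating by parts. -/
lemma torusConv_sub_succ {u : T3 → ℝ} {v : Fin 3 → T3 → ℝ} (hu : Integrable u volume)
    (hw : ∀ i, HasWeakPartial i u (v i)) (n : ℕ) (x : T3) :
    torusConv u (torusKernel n) x - torusConv u (torusKernel (n + 1)) x
      = ∑ i, torusConv (v i) (gradKernel n i) x := by
  have h1 : ∀ i, torusConv (v i) (gradKernel n i) x = ∫ y, u y * gradKernelDeriv n i (x - y) := by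
    intro i
    have := hw i _ (isSmoothOnTorus_gradKernel_sub n i x)
    simp only [torusPartial_gradKernel_sub, mul_neg, integral_neg, neg_inj] at this
    exact this.symm
  have hD : ∀ i, Continuous (gradKernelDeriv n i) := fun i => by
    unfold gradKernelDeriv
    refine continuous_finsetProd _ fun j _ => ?_
    split_ifs <;> fun_prop
  simp_rw [h1]
  rw [← integral_finsetSum _ fun i _ => integrable_mul_continuous hu
    (G := fun y => gradKernelDeriv n i (x - y)) (by have := hD i; fun_prop)]
  simp_rw [← Finset.mul_sum, sum_gradKernelDeriv, mul_sub]
  rw [integral_sub]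
  · rfl
  · exact integrable_mul_continuous hu (G := fun y => torusKernel n (x - y)) (by fun_prop)
  · exact integrable_mul_continuous hu (G := fun y => torusKernel (n + 1) (x - y)) (by fun_prop)

/-- A version of Young's inequality with the kernel measured in `L^1` and `L^∞`. -/
lemma eLpNorm_torusConv_le {p s : ℝ} (hp : 1 ≤ p) (hps : p ≤ s) {v G : T3 → ℝ}
    (hv : AEStronglyMeasurable v volume) (hG : Continuous G) {A B : ℝ≥0∞}
    (hA : ∫⁻ x, ‖G x‖ₑ ≤ A) (hB : ∀ x, ‖G x‖ₑ ≤ B) :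
    eLpNorm (torusConv v G) (ENNReal.ofReal s) volume
      ≤ A ^ (1 - 1 / p + 1 / s) * B ^ (1 / p - 1 / s) * eLpNorm v (ENNReal.ofReal p) volume := by
  have hp0 : 0 < p := by linarith
  have hs0 : 0 < s := by linarith
  have hpp : 0 ≤ 1 - 1 / p := by rw [sub_nonneg, div_le_one hp0]; exact hp
  have hpe : ENNReal.ofReal p ≠ 0 := by simpa using hp0
  have hse : ENNReal.ofReal s ≠ 0 := by simpa using hs0
  set N := eLpNorm v (ENNReal.ofReal p) volume with hN
  have hNp : ∫⁻ y, ‖v y‖ₑ ^ p = N ^ p := by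
    rw [hN, eLpNorm_eq_lintegral_rpow_enorm_toReal hpe ENNReal.ofReal_ne_top,
      ENNReal.toReal_ofReal hp0.le, ← ENNReal.rpow_mul]
    simp [hp0.ne']
  -- H = |v|^p * |G| is bounded both in L^1, through A, and in L^∞, through B; the claim
  -- interpolates between the two.
  set H : T3 → ℝ≥0∞ := fun x => ∫⁻ y, ‖v y‖ₑ ^ p * ‖G (x - y)‖ₑ with hH
  have hGm : Measurable fun z : T3 × T3 => ‖G (z.1 - z.2)‖ₑ :=
    (Continuous.measurable (by fun_prop))
  have hHA : ∫⁻ x, H x ≤ N ^ p * A := by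
    simp only [hH]
    rw [lintegral_lintegral_swap ((hv.comp_snd.enorm.pow_const p).mul hGm.aemeasurable)]
    calc _ = ∫⁻ y, ‖v y‖ₑ ^ p * ∫⁻ x, ‖G x‖ₑ := by
          refine lintegral_congr fun y => ?_
          rw [lintegral_const_mul _ (Continuous.measurable (by fun_prop))]
          congr 1
          exact lintegral_sub_right_eq_self (fun x => ‖G x‖ₑ) y
      _ ≤ ∫⁻ y, ‖v y‖ₑ ^ p * A := lintegral_mono fun y => by gcongr
      _ = _ := by rw [lintegral_mul_const'' _ (hv.enorm.pow_const p), hNp]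
  have hHB : ∀ x, H x ≤ N ^ p * B := fun x => by
    rw [← hNp, ← lintegral_mul_const'' _ (hv.enorm.pow_const p)]
    exact lintegral_mono fun y => by gcongr; exact hB _
  -- Hölder's inequality with respect to the measure |G(x - y)| dy, whose mass is at most A.
  have hJ : ∀ x, ‖torusConv v G x‖ₑ ≤ H x ^ (1 / p) * A ^ (1 - 1 / p) := by
    intro x
    set m : Measure T3 := volume.withDensity fun y => ‖G (x - y)‖ₑ with hm
    have hGx : Measurable fun y => ‖G (x - y)‖ₑ := Continuous.measurable (by fun_prop)
    have hvm : AEStronglyMeasurable v m := hv.mono_ac (withDensity_absolutelyContinuous _ _)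
    have h1 : ∀ f : T3 → ℝ≥0∞, AEMeasurable f volume →
        ∫⁻ y, f y ∂m = ∫⁻ y, f y * ‖G (x - y)‖ₑ := fun f hf => by
      rw [hm, lintegral_withDensity_eq_lintegral_mul₀ hGx.aemeasurable hf]
      exact lintegral_congr fun y => mul_comm _ _
    have hmA : m Set.univ ≤ A := by
      rw [hm, withDensity_apply _ MeasurableSet.univ, Measure.restrict_univ,
        lintegral_sub_left_eq_self (fun y => ‖G y‖ₑ) x]
      exact hA
    have h2 := eLpNorm_le_eLpNorm_mul_rpow_measure_univ (p := 1) (q := ENNReal.ofReal p)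
      (by simpa using ENNReal.ofReal_le_ofReal hp) hvm
    rw [eLpNorm_one_eq_lintegral_enorm, h1 _ hv.enorm,
      eLpNorm_eq_lintegral_rpow_enorm_toReal hpe ENNReal.ofReal_ne_top,
      ENNReal.toReal_ofReal hp0.le, h1 _ (hv.enorm.pow_const p)] at h2
    calc _ ≤ ∫⁻ y, ‖v y * G (x - y)‖ₑ := enorm_integral_le_lintegral_enorm _
      _ = ∫⁻ y, ‖v y‖ₑ * ‖G (x - y)‖ₑ := by simp_rw [enorm_mul]
      _ ≤ _ := h2
      _ ≤ _ := by
        simp only [ENNReal.toReal_one, div_one]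
        gcongr
  rw [eLpNorm_eq_lintegral_rpow_enorm_toReal hse ENNReal.ofReal_ne_top,
    ENNReal.toReal_ofReal hs0.le]
  have hsp : 0 ≤ s / p - 1 := by rw [sub_nonneg, le_div_iff₀ hp0]; linarith
  -- Of the power s/p of H, one factor is kept for integration and the other s/p - 1 are bounded
  -- uniformly.
  have hJs : ∀ x, ‖torusConv v G x‖ₑ ^ s
      ≤ H x * ((N ^ p * B) ^ (s / p - 1) * A ^ (s * (1 - 1 / p))) := by
    intro x
    calc _ ≤ (H x ^ (1 / p) * A ^ (1 - 1 / p)) ^ s := ENNReal.rpow_le_rpow (hJ x) hs0.le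
      _ = H x ^ (1 + (s / p - 1)) * A ^ (s * (1 - 1 / p)) := by
          rw [ENNReal.mul_rpow_of_nonneg _ _ hs0.le, ← ENNReal.rpow_mul, ← ENNReal.rpow_mul]
          congr 2 <;> ring
      _ = H x * (H x ^ (s / p - 1) * A ^ (s * (1 - 1 / p))) := by
          rw [ENNReal.rpow_add_of_nonneg _ _ zero_le_one hsp, ENNReal.rpow_one, mul_assoc]
      _ ≤ _ := by gcongr; exact hHB x
  have hHm : AEMeasurable H volume :=
    ((hv.comp_snd.enorm.pow_const p).mul hGm.aemeasurable).lintegral_prod_right'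
  calc _ ≤ (∫⁻ x, H x * ((N ^ p * B) ^ (s / p - 1) * A ^ (s * (1 - 1 / p)))) ^ (1 / s) :=
        ENNReal.rpow_le_rpow (lintegral_mono hJs) (by positivity)
    _ = ((∫⁻ x, H x) * ((N ^ p * B) ^ (s / p - 1) * A ^ (s * (1 - 1 / p)))) ^ (1 / s) := by
        rw [lintegral_mul_const'' _ hHm]
    _ ≤ (N ^ p * A * ((N ^ p * B) ^ (s / p - 1) * A ^ (s * (1 - 1 / p)))) ^ (1 / s) := by
        gcongr
    _ = _ := by
        rw [ENNReal.mul_rpow_of_nonneg _ _ hsp]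
        have e1 : N ^ p * A * ((N ^ p) ^ (s / p - 1) * B ^ (s / p - 1) * A ^ (s * (1 - 1 / p)))
            = (A ^ (1 : ℝ) * A ^ (s * (1 - 1 / p))) * B ^ (s / p - 1)
              * (N ^ p * (N ^ p) ^ (s / p - 1)) := by
          rw [ENNReal.rpow_one]; ring
        have e2 : N ^ p * (N ^ p) ^ (s / p - 1) = N ^ s := by
          rw [← ENNReal.rpow_mul, ← ENNReal.rpow_add_of_nonneg _ _ hp0.le (by positivity)]
          congr 1; field_simp; ring
        rw [e1, e2, ← ENNReal.rpow_add_of_nonneg _ _ zero_le_one (by positivity),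
          ENNReal.mul_rpow_of_nonneg _ _ (by positivity),
          ENNReal.mul_rpow_of_nonneg _ _ (by positivity), ← ENNReal.rpow_mul, ← ENNReal.rpow_mul,
          ← ENNReal.rpow_mul]
        have e3 : s * (1 / s) = 1 := by field_simp
        rw [e3, ENNReal.rpow_one]
        congr 3 <;> field_simp
        ring

end TorusKernel

/-! ### Convergence of the smoothings. -/

section ApproximateIdentity

lemma torusConv_torusKernel_eq (h : T3 → ℝ) (n : ℕ) (x : T3) :
    torusConv h (torusKernel n) x = ∫ y, torusKernel n y * h (y + x) := by
  rw [torusConv, ← integral_add_right_eq_self _ x]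
  refine integral_congr_ae (Eventually.of_forall fun y => ?_)
  dsimp only
  rw [show x - (y + x) = -y by abel, torusKernel_neg, mul_comm]

/-- The kernel is the normalised n-th power of one continuous function with a unique maximum at 0,
so the general peak-function theorem applies. -/
lemma tendsto_torusConv_of_continuous {h : T3 → ℝ} (hh : Continuous h) (x : T3) :
    Tendsto (fun n => torusConv h (torusKernel n) x) atTop (𝓝 (h x)) := by
  simp_rw [torusConv_torusKernel_eq]
  set c : T3 → ℝ := fun y => ∏ j, circleCosSq (y j) with hc
  have hK : ∀ n y, torusKernel n y = kernelConst n ^ 3 * c y ^ n := fun n y => by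
    simp [torusKernel, circleKernel, hc, Finset.prod_mul_distrib, Finset.prod_pow]
  have hint : ∀ n, ∫ y in Set.univ, c y ^ n = (kernelConst n ^ 3)⁻¹ := fun n => by
    have := integral_torusKernel n
    simp_rw [hK] at this
    rw [integral_const_mul] at this
    rw [Measure.restrict_univ]
    exact eq_inv_of_mul_eq_one_right this
  have hmain := tendsto_setIntegral_pow_smul_of_unique_maximum_of_isCompact_of_integrableOn
    (μ := (volume : Measure T3)) (g := fun y => h (y + x)) (x₀ := 0) (c := c)
    isCompact_univ (by fun_prop) (fun y _ hy => ?_)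
    (fun y _ => Finset.prod_nonneg fun j _ => (circleCosSq_mem (y j)).1)
    (by simp [hc, circleCosSq_zero]) (by simp)
    (integrable_of_continuous_T3 (by fun_prop)).integrableOn
    (Continuous.continuousWithinAt (by fun_prop))
  · simp_rw [hint, inv_inv, smul_eq_mul, Measure.restrict_univ, zero_add] at hmain
    simp_rw [hK, mul_assoc, integral_const_mul]
    exact hmain
  · obtain ⟨i, hi⟩ := Function.ne_iff.1 hy
    have h0 : c 0 = 1 := by simp [hc, circleCosSq_zero]
    rw [h0, hc]
    dsimp only
    rw [← Finset.mul_prod_erase _ _ (Finset.mem_univ i)]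
    refine mul_lt_one_of_nonneg_of_lt_one_left (circleCosSq_mem _).1 (circleCosSq_lt_one hi) ?_
    exact Finset.prod_le_one (fun j _ => (circleCosSq_mem _).1) fun j _ => (circleCosSq_mem _).2

lemma lintegral_enorm_torusKernel (n : ℕ) : ∫⁻ x, ‖torusKernel n x‖ₑ = 1 := by
  have h := ofReal_integral_eq_lintegral_ofReal
    (integrable_of_continuous_T3 (continuous_torusKernel n))
    (Eventually.of_forall (torusKernel_nonneg n))
  rw [integral_torusKernel, ENNReal.ofReal_one] at h
  rw [h]
  exact lintegral_congr fun x => Real.enorm_eq_ofReal (torusKernel_nonneg n x)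

lemma exists_enorm_le_of_continuous {G : T3 → ℝ} (hG : Continuous G) :
    ∃ B : ℝ≥0, ∀ x, ‖G x‖ₑ ≤ B := by
  obtain ⟨C, hC⟩ := (isCompact_range hG).isBounded.exists_norm_le
  refine ⟨C.toNNReal, fun x => ?_⟩
  rw [← ofReal_norm]
  exact ENNReal.ofReal_le_ofReal (hC _ (Set.mem_range_self x))

lemma eLpNorm_one_torusConv_le {u : T3 → ℝ} (hu : AEStronglyMeasurable u volume) (n : ℕ) :
    eLpNorm (torusConv u (torusKernel n)) 1 volume ≤ eLpNorm u 1 volume := by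
  obtain ⟨B, hB⟩ := exists_enorm_le_of_continuous (continuous_torusKernel n)
  simpa using eLpNorm_torusConv_le (p := 1) (s := 1) le_rfl le_rfl hu (continuous_torusKernel n)
    (lintegral_enorm_torusKernel n).le hB

/-- Smoothing is a contraction of L^1, so it is enough to approximate u by a continuous function,
for which convergence is pointwise and bounded. -/
lemma tendsto_eLpNorm_one_torusConv_sub {u : T3 → ℝ} (hu : Integrable u volume) :
    Tendsto (fun n => eLpNorm (torusConv u (torusKernel n) - u) 1 volume) atTop (𝓝 0) := by
  rw [ENNReal.tendsto_nhds_zero]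
  intro ε hε
  have hε3 : ε / 3 ≠ 0 := by
    simpa [ENNReal.div_eq_zero_iff] using hε.ne'
  obtain ⟨h, hh, -⟩ := (memLp_one_iff_integrable.2 hu).exists_boundedContinuous_eLpNorm_sub_le
    ENNReal.one_ne_top hε3
  have hhc : Continuous (h : T3 → ℝ) := h.continuous
  have hlim : Tendsto (fun n => eLpNorm (torusConv h (torusKernel n) - ⇑h) 1 volume) atTop (𝓝 0) := by
    have h0 : eLpNorm (fun _ : T3 => (0 : ℝ)) 1 volume = 0 := by simp
    rw [← h0]
    refine tendsto_eLpNorm_of_bounded (R := ‖h‖ + ‖h‖) one_ne_zero ENNReal.one_ne_top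
      (fun n => ?_) (fun n x => ?_) (Eventually.of_forall fun x => ?_)
    · exact (aestronglyMeasurable_torusConv hhc.aestronglyMeasurable
        (continuous_torusKernel n)).sub hhc.aestronglyMeasurable
    · refine (abs_sub _ _).trans (add_le_add ?_ (h.norm_coe_le_norm x))
      rw [torusConv_torusKernel_eq, ← Real.norm_eq_abs]
      refine (norm_integral_le_of_norm_le (g := fun y => torusKernel n y * ‖h‖)
        ((integrable_of_continuous_T3 (by fun_prop)).mul_const _)
        (Eventually.of_forall fun y => ?_)).trans_eq ?_
      · rw [norm_mul, Real.norm_of_nonneg (torusKernel_nonneg n y)]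
        exact mul_le_mul_of_nonneg_left (h.norm_coe_le_norm _) (torusKernel_nonneg n y)
      · rw [integral_mul_const, integral_torusKernel, one_mul]
    · simpa using (tendsto_torusConv_of_continuous hhc x).sub_const (h x)
  filter_upwards [(ENNReal.tendsto_nhds_zero.1 hlim) (ε / 3) (pos_iff_ne_zero.2 hε3)] with n hn
  have hd : Integrable (u - ⇑h) (volume : Measure T3) := hu.sub (integrable_of_continuous_T3 hhc)
  have hdec : torusConv u (torusKernel n) - u
      = torusConv (u - ⇑h) (torusKernel n) + ((torusConv h (torusKernel n) - ⇑h) + (⇑h - u)) := by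
    ext x
    simp only [Pi.sub_apply, Pi.add_apply, torusConv, sub_mul]
    rw [integral_sub]
    · ring
    · exact integrable_mul_continuous hu (G := fun y => torusKernel n (x - y)) (by fun_prop)
    · exact integrable_of_continuous_T3 (by fun_prop)
  have hm := continuous_torusKernel n
  have hhm := hhc.aestronglyMeasurable (μ := (volume : Measure T3))
  have hcm := aestronglyMeasurable_torusConv hhm hm
  rw [hdec]
  calc _ ≤ eLpNorm (torusConv (u - ⇑h) (torusKernel n)) 1 volume
        + (eLpNorm (torusConv h (torusKernel n) - ⇑h) 1 volume + eLpNorm (⇑h - u) 1 volume) :=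
        (eLpNorm_add_le (aestronglyMeasurable_torusConv hd.1 hm)
          ((hcm.sub hhm).add (hhm.sub hu.1)) le_rfl).trans
          (add_le_add_right (eLpNorm_add_le (hcm.sub hhm) (hhm.sub hu.1) le_rfl) _)
    _ ≤ ε / 3 + (ε / 3 + ε / 3) := by
        gcongr
        · exact (eLpNorm_one_torusConv_le hd.1 n).trans hh
        · rw [eLpNorm_sub_comm]; exact hh
    _ = ε := by rw [← add_assoc]; exact ENNReal.add_thirds ε

end ApproximateIdentity

/-! ### Quantitative Sobolev and Rellich estimates. -/

section Sobolev

/-- The rate in `eLpNorm_torusConv_sub_le`. -/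
def sobolevRate (p s : ℝ) (n : ℕ) : ℝ≥0∞ :=
  ENNReal.ofReal (1 / ((n + 1) * √(n + 1))) ^ (1 - 1 / p + 1 / s) * 9 ^ (1 / p - 1 / s)

/-- The terms decay like n^{-3r/2} with r = 1 - 1/p + 1/s, and r > 2/3 is the subcriticality of s.
-/
lemma tsum_sobolevRate_ne_top {p s : ℝ} (hp : 1 ≤ p) (hps : p ≤ s) (h : 1 / p - 1 / 3 < 1 / s) :
    ∑' n, sobolevRate p s n ≠ ⊤ := by
  have hp0 : 0 < p := by linarith
  have hs0 : 0 < s := by linarith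
  unfold sobolevRate
  rw [ENNReal.tsum_mul_right]
  refine ENNReal.mul_ne_top ?_ (ENNReal.rpow_ne_top_of_nonneg ?_ (by simp))
  · set r := 1 - 1 / p + 1 / s with hr
    have hr1 : 2 / 3 < r := by rw [hr]; linarith
    have h1 : ∀ n : ℕ, ENNReal.ofReal (1 / (((n : ℝ) + 1) * √(n + 1))) ^ r
        = ENNReal.ofReal (1 / ((n + 1 : ℕ) : ℝ) ^ (3 / 2 * r)) := by
      intro n
      rw [ENNReal.ofReal_rpow_of_pos (by positivity)]
      congr 1
      have hn : (0 : ℝ) ≤ n + 1 := by positivity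
      have h2 : ((n : ℝ) + 1) * √(n + 1) = (n + 1) ^ (3 / 2 : ℝ) := by
        rw [Real.sqrt_eq_rpow]
        nth_rw 1 [← Real.rpow_one ((n : ℝ) + 1)]
        rw [← Real.rpow_add (by positivity)]
        norm_num
      rw [h2, Real.div_rpow zero_le_one (by positivity), Real.one_rpow, ← Real.rpow_mul hn]
      push_cast
      rfl
    simp_rw [h1]
    have hs := (Real.summable_one_div_nat_rpow (p := 3 / 2 * r)).2 (by linarith)
    rw [← ENNReal.ofReal_tsum_of_nonneg (fun n => by positivity) ((summable_nat_add_iff 1).2 hs)]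
    exact ENNReal.ofReal_ne_top
  · rw [sub_nonneg]
    exact one_div_le_one_div_of_le hp0 hps

/-- A quantitative form of the Rellich–Kondrachov theorem on the torus. -/
theorem eLpNorm_torusConv_sub_le {p s : ℝ} (hp : 1 ≤ p) (hps : p ≤ s)
    {u : T3 → ℝ} {v : Fin 3 → T3 → ℝ} (hu : Integrable u volume)
    (hv : ∀ i, AEStronglyMeasurable (v i) volume) (hw : ∀ i, HasWeakPartial i u (v i)) (N : ℕ) :
    eLpNorm (fun x => u x - torusConv u (torusKernel N) x) (ENNReal.ofReal s) volume
      ≤ (∑' n, sobolevRate p s (n + N)) * ∑ i, eLpNorm (v i) (ENNReal.ofReal p) volume := by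
  have hs1 : 1 ≤ ENNReal.ofReal s := by
    simpa using ENNReal.ofReal_le_ofReal (hp.trans hps)
  have hstep : ∀ n, eLpNorm (∑ i, torusConv (v i) (gradKernel n i)) (ENNReal.ofReal s) volume
      ≤ sobolevRate p s n * ∑ i, eLpNorm (v i) (ENNReal.ofReal p) volume := by
    intro n
    rw [Finset.mul_sum]
    refine (eLpNorm_sum_le (fun i _ => aestronglyMeasurable_torusConv (hv i)
      (continuous_gradKernel n i)) hs1).trans (Finset.sum_le_sum fun i _ => ?_)
    refine eLpNorm_torusConv_le hp hps (hv i) (continuous_gradKernel n i) ?_ fun x => ?_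
    · have h := ofReal_integral_eq_lintegral_ofReal
        (integrable_of_continuous_T3 (continuous_gradKernel n i).abs)
        (Eventually.of_forall fun x => abs_nonneg _)
      simp_rw [Real.enorm_eq_ofReal_abs]
      rw [← h]
      exact ENNReal.ofReal_le_ofReal (integral_abs_gradKernel_le n i)
    · rw [Real.enorm_eq_ofReal_abs]
      refine (ENNReal.ofReal_le_ofReal (abs_gradKernel_le n i x)).trans ?_
      norm_num
  have hm : ∀ n, AEStronglyMeasurable (torusConv u (torusKernel n)) volume := fun n =>
    aestronglyMeasurable_torusConv hu.1 (continuous_torusKernel n)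
  have htel : ∀ M, eLpNorm (torusConv u (torusKernel N) - torusConv u (torusKernel (M + N)))
      (ENNReal.ofReal s) volume
      ≤ (∑ n ∈ Finset.range M, sobolevRate p s (n + N)) *
        ∑ i, eLpNorm (v i) (ENNReal.ofReal p) volume := by
    intro M
    have h1 : torusConv u (torusKernel N) - torusConv u (torusKernel (M + N))
        = ∑ n ∈ Finset.range M, ∑ i, torusConv (v i) (gradKernel (n + N) i) := by
      ext x
      simp only [Pi.sub_apply, Finset.sum_apply, ← torusConv_sub_succ hu hw]
      have := Finset.sum_range_sub' (fun n => torusConv u (torusKernel (n + N)) x) M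
      simp only [zero_add] at this
      rw [← this]
      exact Finset.sum_congr rfl fun n _ => by rw [add_right_comm]
    rw [h1, Finset.sum_mul]
    refine (eLpNorm_sum_le (fun n _ => ?_) hs1).trans (Finset.sum_le_sum fun n _ => hstep _)
    exact Finset.aestronglyMeasurable_sum _ fun i _ =>
      aestronglyMeasurable_torusConv (hv i) (continuous_gradKernel _ i)
  have hlim : Tendsto (fun M => eLpNorm (torusConv u (torusKernel (M + N)) - u) 1 volume)
      atTop (𝓝 0) :=
    (tendsto_eLpNorm_one_torusConv_sub hu).comp (tendsto_add_atTop_nat N)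
  -- Only L^1 convergence of the smoothings is known. Along an almost everywhere convergent
  -- subsequence, Fatou's lemma passes the telescoped bound to the limit in L^s.
  obtain ⟨ns, -, hns⟩ := (tendstoInMeasure_of_tendsto_eLpNorm one_ne_zero
    (fun M => hm (M + N)) hu.1 hlim).exists_seq_tendsto_ae
  have hswap : eLpNorm (fun x => u x - torusConv u (torusKernel N) x) (ENNReal.ofReal s) volume
      = eLpNorm (torusConv u (torusKernel N) - u) (ENNReal.ofReal s) volume :=
    eLpNorm_sub_comm u _ _ _
  rw [hswap]
  refine (Lp.eLpNorm_lim_le_liminf_eLpNorm (f := fun k =>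
    torusConv u (torusKernel N) - torusConv u (torusKernel (ns k + N)))
    (fun k => (hm N).sub (hm _)) _ ?_).trans ?_
  · filter_upwards [hns] with x hx
    exact hx.const_sub _
  · refine liminf_le_of_le (by isBoundedDefault) fun b hb => ?_
    obtain ⟨k, hk⟩ := hb.exists
    refine hk.trans ((htel (ns k)).trans ?_)
    gcongr
    exact ENNReal.sum_le_tsum _

end Sobolev

/-! ### The kernels are finite sums of products. -/

section Separable

/-- Kernels that are finite sums of products of continuous functions of one variable. -/
def IsSeparable (k : T3 → T3 → ℝ) : Prop :=
  ∃ (m : ℕ) (φ ψ : Fin m → T3 → ℝ), (∀ j, Continuous (φ j)) ∧ (∀ j, Continuous (ψ j)) ∧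
    ∀ x y, k x y = ∑ j, φ j x * ψ j y

lemma isSeparable_of_fintype {ι : Type} [Fintype ι] {k : T3 → T3 → ℝ} (φ ψ : ι → T3 → ℝ)
    (hφ : ∀ j, Continuous (φ j)) (hψ : ∀ j, Continuous (ψ j))
    (hk : ∀ x y, k x y = ∑ j, φ j x * ψ j y) : IsSeparable k := by
  let e := Fintype.equivFin ι
  refine ⟨Fintype.card ι, fun j => φ (e.symm j), fun j => ψ (e.symm j), fun j => hφ _,
    fun j => hψ _, fun x y => ?_⟩
  rw [hk]
  exact (Equiv.sum_comp e.symm fun j => φ j x * ψ j y).symm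

lemma IsSeparable.mul {k l : T3 → T3 → ℝ} (hk : IsSeparable k) (hl : IsSeparable l) :
    IsSeparable fun x y => k x y * l x y := by
  obtain ⟨m, φ, ψ, hφ, hψ, hk⟩ := hk
  obtain ⟨m', φ', ψ', hφ', hψ', hl⟩ := hl
  refine isSeparable_of_fintype (ι := Fin m × Fin m') (fun j x => φ j.1 x * φ' j.2 x)
    (fun j y => ψ j.1 y * ψ' j.2 y) (fun j => (hφ _).mul (hφ' _)) (fun j => (hψ _).mul (hψ' _))
    fun x y => ?_
  rw [hk, hl, Finset.sum_mul_sum, Fintype.sum_prod_type]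
  refine Finset.sum_congr rfl fun i _ => Finset.sum_congr rfl fun j _ => ?_
  ring

lemma isSeparable_const (c : ℝ) : IsSeparable fun _ _ => c :=
  isSeparable_of_fintype (ι := Unit) (fun _ _ => c) (fun _ _ => 1) (fun _ => continuous_const)
    (fun _ => continuous_const) (by simp)

lemma IsSeparable.pow {k : T3 → T3 → ℝ} (hk : IsSeparable k) (n : ℕ) :
    IsSeparable fun x y => k x y ^ n := by
  induction n with
  | zero => simpa using isSeparable_const 1
  | succ n ih => simpa only [pow_succ] using ih.mul hk

lemma circleCos_sub (x y : UnitAddCircle) :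
    circleCos (x - y) = circleCos x * circleCos y + circleSin x * circleSin y := by
  induction x using QuotientAddGroup.induction_on with | _ a => ?_
  induction y using QuotientAddGroup.induction_on with | _ b => ?_
  have := circleCos_coe (a - b)
  rw [AddCircle.coe_sub] at this
  rw [this, circleCos_coe, circleCos_coe, circleSin_coe, circleSin_coe, mul_sub, Real.cos_sub]

lemma isSeparable_circleCosSq (j : Fin 3) :
    IsSeparable fun x y => circleCosSq (x j - y j) := by
  refine isSeparable_of_fintype (ι := Fin 3)
    ![fun _ => 1 / 2, fun x => circleCos (x j) / 2, fun x => circleSin (x j) / 2]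
    ![fun _ => 1, fun x => circleCos (x j), fun x => circleSin (x j)] (fun i => ?_) (fun i => ?_)
    fun x y => ?_
  · fin_cases i <;> simp <;> fun_prop
  · fin_cases i <;> simp <;> fun_prop
  · rw [circleCosSq, circleCos_sub]
    simp [Fin.sum_univ_three]
    ring

/-- The addition formula separates cos 2π(x - y), and products of separable kernels are separable.
-/
lemma isSeparable_torusKernel (n : ℕ) : IsSeparable fun x y => torusKernel n (x - y) := by
  have h : ∀ j : Fin 3, IsSeparable fun x y => circleKernel n (x j - y j) := fun j =>
    (isSeparable_const (kernelConst n)).mul ((isSeparable_circleCosSq j).pow n)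
  have := ((h 0).mul (h 1)).mul (h 2)
  simpa only [torusKernel, Fin.prod_univ_three, Pi.sub_apply] using this

end Separable

/-! ### Distributional derivatives on an interval. -/

section TimeDerivative

variable {T : ℝ}

instance nullSingletonClass_timeMeasure : NullSingletonClass (timeMeasure T) := by
  unfold timeMeasure; infer_instance

/-- `w` is the distributional derivative of `β` on `(0, T)`. -/
def HasTimeDeriv (T : ℝ) (β w : ℝ → ℂ) : Prop :=
  ∀ ψ : ℝ → ℝ, ContDiff ℝ ∞ ψ → HasCompactSupport ψ → tsupport ψ ⊆ Set.Ioo 0 T →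
    ∫ t, ((deriv ψ t : ℝ) : ℂ) * β t ∂timeMeasure T = - ∫ t, (ψ t : ℂ) * w t ∂timeMeasure T

lemma exists_smooth_bump {a b : ℝ} (hab : a < b) :
    ∃ ρ : ℝ → ℝ, ContDiff ℝ ∞ ρ ∧ HasCompactSupport ρ ∧ tsupport ρ ⊆ Set.Ioo a b ∧
      (∀ t, 0 ≤ ρ t) ∧ ∫ t, ρ t = 1 := by
  let f : ContDiffBump ((a + b) / 2 : ℝ) := ⟨(b - a) / 8, (b - a) / 4, by linarith, by linarith⟩
  refine ⟨f.normed volume, f.contDiff_normed, f.hasCompactSupport_normed, ?_, f.nonneg_normed,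
    f.integral_normed⟩
  rw [f.tsupport_normed_eq, Real.closedBall_eq_Icc]
  intro t ht
  have h1 : f.rOut = (b - a) / 4 := rfl
  rw [h1] at ht
  exact ⟨by linarith [ht.1], by linarith [ht.2]⟩

lemma integral_timeMeasure_eq {E : Type*} [NormedAddCommGroup E] [NormedSpace ℝ E] {f : ℝ → E}
    (hf : ∀ t, t ∉ Set.Ioo 0 T → f t = 0) : ∫ t, f t ∂timeMeasure T = ∫ t, f t := by
  unfold timeMeasure
  exact setIntegral_eq_integral_of_forall_compl_eq_zero fun t ht =>
    hf t fun h => ht (Set.Ioo_subset_Icc_self h)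

lemma integrable_ofReal_mul {f : ℝ → ℂ} (hf : Integrable f (timeMeasure T)) {ψ : ℝ → ℝ}
    (hψ : Continuous ψ) : Integrable (fun t => (ψ t : ℂ) * f t) (timeMeasure T) := by
  obtain ⟨C, hC⟩ := (isCompact_Icc (a := 0) (b := T)).exists_bound_of_continuousOn hψ.continuousOn
  refine hf.bdd_mul (c := C) (Continuous.aestronglyMeasurable (by fun_prop)) ?_
  unfold timeMeasure
  filter_upwards [ae_restrict_mem measurableSet_Icc] with t ht
  simpa using hC t ht

/-- Functions that agree against test functions agree almost everywhere. -/
lemma ae_eq_zero_of_test {f : ℝ → ℂ} (hf : Integrable f (timeMeasure T))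
    (h : ∀ φ : ℝ → ℝ, ContDiff ℝ ∞ φ → HasCompactSupport φ → tsupport φ ⊆ Set.Ioo 0 T →
      ∫ t, (φ t : ℂ) * f t ∂timeMeasure T = 0) : ∀ᵐ t ∂timeMeasure T, f t = 0 := by
  have hloc : LocallyIntegrableOn f (Set.Ioo 0 T) volume :=
    IntegrableOn.locallyIntegrableOn (IntegrableOn.mono_set hf Set.Ioo_subset_Icc_self)
  have := isOpen_Ioo.ae_eq_zero_of_integral_contDiff_smul_eq_zero hloc fun φ h1 h2 h3 => by
    have h4 := h φ h1 h2 h3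
    rw [integral_timeMeasure_eq fun t ht => by
      rw [image_eq_zero_of_notMem_tsupport fun h => ht (h3 h)]; simp] at h4
    simpa using h4
  unfold timeMeasure
  rw [← Measure.restrict_congr_set Ioo_ae_eq_Icc]
  exact (ae_restrict_iff' measurableSet_Ioo).2 this

/-- By Fubini, w(τ) is multiplied by ∫_τ^T ψ' = -ψ(τ), since ψ vanishes at T. -/
lemma hasTimeDeriv_primitive {w : ℝ → ℂ} (hw : Integrable w (timeMeasure T)) :
    HasTimeDeriv T (fun t => ∫ τ in (0 : ℝ)..t, w τ ∂timeMeasure T) w := by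
  intro ψ h1 h2 h3
  have hψ' : Continuous (deriv ψ) := h1.continuous_deriv (by simp)
  have hW : ∀ᵐ t ∂timeMeasure T, ((deriv ψ t : ℝ) : ℂ) * ∫ τ in (0 : ℝ)..t, w τ ∂timeMeasure T
      = ∫ τ, ((deriv ψ t : ℝ) : ℂ) * (Set.Ioc 0 t).indicator w τ ∂timeMeasure T := by
    have : ∀ᵐ t ∂timeMeasure T, t ∈ Set.Icc 0 T := ae_restrict_mem measurableSet_Icc
    filter_upwards [this] with t ht
    rw [intervalIntegral.integral_of_le ht.1, integral_const_mul,
      integral_indicator measurableSet_Ioc]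
  rw [integral_congr_ae hW, integral_integral_swap]
  · rw [← integral_neg]
    refine integral_congr_ae ?_
    have hIoc : ∀ᵐ τ ∂timeMeasure T, τ ∈ Set.Ioc 0 T := by
      unfold timeMeasure
      rw [← Measure.restrict_congr_set Ioc_ae_eq_Icc]
      exact ae_restrict_mem measurableSet_Ioc
    filter_upwards [hIoc] with τ hτ
    have h4 : ∀ t, ((deriv ψ t : ℝ) : ℂ) * (Set.Ioc 0 t).indicator w τ
        = (Set.Ici τ).indicator (fun t => ((deriv ψ t : ℝ) : ℂ)) t * w τ := fun t => by
      by_cases ht : τ ≤ t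
      · simp [Set.indicator, ht, hτ.1]
      · simp [Set.indicator, ht]
    simp_rw [h4]
    rw [integral_mul_const, integral_indicator measurableSet_Ici]
    have h5 : (timeMeasure T).restrict (Set.Ici τ) = volume.restrict (Set.Icc τ T) := by
      unfold timeMeasure
      rw [Measure.restrict_restrict measurableSet_Ici]
      congr 1
      ext t
      simp only [Set.mem_inter_iff, Set.mem_Ici, Set.mem_Icc]
      exact ⟨fun h => ⟨h.1, h.2.2⟩, fun h => ⟨h.1, hτ.1.le.trans h.1, h.2⟩⟩
    have h6 : ψ T = 0 := image_eq_zero_of_notMem_tsupport fun h => (h3 h).2.false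
    rw [h5, integral_complex_ofReal, integral_Icc_eq_integral_Ioc,
      ← intervalIntegral.integral_of_le hτ.2,
      intervalIntegral.integral_deriv_eq_sub (fun t _ => (h1.differentiable (by simp)) t)
        (hψ'.intervalIntegrable _ _), h6]
    simp
  · obtain ⟨C, hC⟩ := (isCompact_Icc (a := 0) (b := T)).exists_bound_of_continuousOn
      hψ'.continuousOn
    have hd : Integrable (fun t => ((deriv ψ t : ℝ) : ℂ)) (timeMeasure T) := by
      simpa using integrable_ofReal_mul (T := T) (integrable_const (1 : ℂ)) hψ'
    have hprod := hd.mul_prod hw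
    have hset : MeasurableSet {z : ℝ × ℝ | 0 < z.2 ∧ z.2 ≤ z.1} :=
      (measurableSet_lt measurable_const measurable_snd).inter
        (measurableSet_le measurable_snd measurable_fst)
    refine (hprod.indicator hset).congr (Eventually.of_forall fun z => ?_)
    by_cases hz : 0 < z.2 ∧ z.2 ≤ z.1
    · simp [Function.uncurry, Set.indicator, hz]
    · simp [Function.uncurry, Set.indicator, hz]

lemma HasTimeDeriv.sub {β w β' w' : ℝ → ℂ} (h : HasTimeDeriv T β w) (h' : HasTimeDeriv T β' w')
    (hβ : Integrable β (timeMeasure T)) (hβ' : Integrable β' (timeMeasure T))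
    (hw : Integrable w (timeMeasure T)) (hw' : Integrable w' (timeMeasure T)) :
    HasTimeDeriv T (fun t => β t - β' t) (fun t => w t - w' t) := by
  intro ψ h1 h2 h3
  have hψ' : Continuous (deriv ψ) := h1.continuous_deriv (by simp)
  simp_rw [mul_sub]
  rw [integral_sub (integrable_ofReal_mul hβ hψ') (integrable_ofReal_mul hβ' hψ'),
    integral_sub (integrable_ofReal_mul hw h1.continuous) (integrable_ofReal_mul hw' h1.continuous),
    h ψ h1 h2 h3, h' ψ h1 h2 h3]
  ring

/-- The lemma of du Bois-Reymond. -/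
lemma ae_eq_const_of_hasTimeDeriv_zero (hT : 0 < T) {γ : ℝ → ℂ} (hγ : Integrable γ (timeMeasure T))
    (h : HasTimeDeriv T γ 0) : ∃ c : ℂ, ∀ᵐ t ∂timeMeasure T, γ t = c := by
  obtain ⟨φ₀, h01, h02, h03, -, h05⟩ := exists_smooth_bump hT
  set c := ∫ t, (φ₀ t : ℂ) * γ t ∂timeMeasure T with hc
  refine ⟨c, ?_⟩
  suffices hz : ∀ᵐ t ∂timeMeasure T, γ t - c = 0 by
    filter_upwards [hz] with t ht using sub_eq_zero.1 ht
  refine ae_eq_zero_of_test (hγ.sub (integrable_const c)) fun φ h1 h2 h3 => ?_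
  set I := ∫ t, φ t with hI
  set χ : ℝ → ℝ := fun t => φ t - I * φ₀ t with hχ
  have hχs : ContDiff ℝ ∞ χ := h1.sub (contDiff_const.mul h01)
  set ψ : ℝ → ℝ := fun t => ∫ τ in (0 : ℝ)..t, χ τ with hψ
  have hψd : ∀ t, HasDerivAt ψ (χ t) t := fun t =>
    intervalIntegral.integral_hasDerivAt_right (hχs.continuous.intervalIntegrable _ _)
      (hχs.continuous.stronglyMeasurableAtFilter _ _) hχs.continuous.continuousAt
  have hψ' : deriv ψ = χ := funext fun t => (hψd t).deriv
  have hψs : ContDiff ℝ ∞ ψ := by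
    rw [contDiff_infty_iff_deriv]
    exact ⟨fun t => (hψd t).differentiableAt, by rw [hψ']; exact hχs⟩
  obtain ⟨u, v, hu, hv, hK⟩ : ∃ u v, 0 < u ∧ v < T ∧ ∀ t, t ∉ Set.Icc u v → χ t = 0 := by
    have hKc : IsCompact (tsupport φ ∪ tsupport φ₀) := h2.isCompact.union h02.isCompact
    have hKs : tsupport φ ∪ tsupport φ₀ ⊆ Set.Ioo 0 T := Set.union_subset h3 h03
    have hKn : (tsupport φ ∪ tsupport φ₀).Nonempty := by
      by_contra hne
      rw [Set.not_nonempty_iff_eq_empty, Set.union_empty_iff] at hne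
      have : φ₀ = 0 := tsupport_eq_empty_iff.1 hne.2
      rw [this] at h05
      simp at h05
    obtain ⟨u, hu⟩ := hKc.exists_isLeast hKn
    obtain ⟨v, hv⟩ := hKc.exists_isGreatest hKn
    refine ⟨u, v, (hKs hu.1).1, (hKs hv.1).2, fun t ht => ?_⟩
    have ht' : t ∉ tsupport φ ∪ tsupport φ₀ := fun hm => ht ⟨hu.2 hm, hv.2 hm⟩
    rw [Set.mem_union, not_or] at ht'
    simp [hχ, image_eq_zero_of_notMem_tsupport ht'.1, image_eq_zero_of_notMem_tsupport ht'.2]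
  have hχint : ∫ t, χ t = 0 := by
    rw [hχ, integral_sub (h1.continuous.integrable_of_hasCompactSupport h2)
      ((h01.continuous.integrable_of_hasCompactSupport h02).const_mul I), integral_const_mul, h05]
    simp [hI]
  have hψ0 : ∀ t, t ∉ Set.Icc u v → ψ t = 0 := by
    intro t ht
    rw [Set.mem_Icc, not_and_or, not_le, not_le] at ht
    rcases ht with ht | ht
    · refine intervalIntegral.integral_zero_ae (Eventually.of_forall fun τ hτ => hK τ ?_)
      intro hm
      rcases Set.mem_uIoc.1 hτ with h | h
      · linarith [hm.1, h.2]
      · linarith [hm.1, h.2]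
    · rcases lt_or_ge t 0 with ht0 | ht0
      · refine intervalIntegral.integral_zero_ae (Eventually.of_forall fun τ hτ => hK τ ?_)
        intro hm
        rcases Set.mem_uIoc.1 hτ with h | h
        · linarith [hm.1, h.2]
        · linarith [hm.1, h.2]
      · rw [hψ]
        dsimp only
        rw [intervalIntegral.integral_of_le ht0, ← hχint]
        refine setIntegral_eq_integral_of_forall_compl_eq_zero fun τ hτ => hK τ fun hm => hτ ?_
        exact ⟨by linarith [hm.1], by linarith [hm.2]⟩
  have hψc : HasCompactSupport ψ := HasCompactSupport.intro isCompact_Icc hψ0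
  have hψt : tsupport ψ ⊆ Set.Ioo 0 T := by
    refine (closure_minimal (fun t ht => ?_) isClosed_Icc).trans
      (Set.Icc_subset_Ioo hu hv)
    by_contra hn
    exact ht (hψ0 t hn)
  have hfin := h ψ hψs hψc hψt
  rw [hψ'] at hfin
  simp only [Pi.zero_apply, mul_zero, integral_zero, neg_zero] at hfin
  have hφμ : ∫ t, (φ t : ℂ) ∂timeMeasure T = I := by
    rw [integral_timeMeasure_eq fun t ht => by
      rw [image_eq_zero_of_notMem_tsupport fun h => ht (h3 h)]; simp]
    rw [integral_complex_ofReal]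
  have e1 : ∫ t, (χ t : ℂ) * γ t ∂timeMeasure T
      = ∫ t, (φ t : ℂ) * γ t ∂timeMeasure T - I * c := by
    rw [hc, ← integral_const_mul, ← integral_sub (integrable_ofReal_mul hγ h1.continuous)
      ((integrable_ofReal_mul hγ h01.continuous).const_mul _)]
    refine integral_congr_ae (Eventually.of_forall fun t => ?_)
    simp only [hχ]
    push_cast
    ring
  have hφi : Integrable (fun t => (φ t : ℂ)) (timeMeasure T) := by
    simpa using integrable_ofReal_mul (T := T) (integrable_const (1 : ℂ)) h1.continuous
  simp_rw [mul_sub]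
  rw [integral_sub (integrable_ofReal_mul hγ h1.continuous) (hφi.mul_const c), integral_mul_const,
    hφμ, ← e1, hfin]

lemma exists_ae_eq_const_add_primitive (hT : 0 < T) {β w : ℝ → ℂ}
    (hβ : Integrable β (timeMeasure T)) (hw : Integrable w (timeMeasure T))
    (h : HasTimeDeriv T β w) :
    ∃ c : ℂ, ∀ᵐ t ∂timeMeasure T, β t = c + ∫ τ in (0 : ℝ)..t, w τ ∂timeMeasure T := by
  have hWc : Continuous fun t => ∫ τ in (0 : ℝ)..t, w τ ∂timeMeasure T :=
    intervalIntegral.continuous_primitive (fun a b => hw.intervalIntegrable) 0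
  have hWi : Integrable (fun t => ∫ τ in (0 : ℝ)..t, w τ ∂timeMeasure T) (timeMeasure T) :=
    hWc.continuousOn.integrableOn_compact isCompact_Icc
  have h0 := h.sub (hasTimeDeriv_primitive hw) hβ hWi hw hw
  obtain ⟨c, hc⟩ := ae_eq_const_of_hasTimeDeriv_zero hT (hβ.sub hWi)
    (by simp only [sub_self] at h0; exact h0)
  refine ⟨c, ?_⟩
  filter_upwards [hc] with t ht
  rw [← ht]
  simp

end TimeDerivative

/-! ### Compactness in time from bounds on the derivative. -/

section TimeCompactness

variable {T : ℝ}

/-- The mass of `w` at distance at most `δ` from `t`. -/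
def localMass (T δ : ℝ) (w : ℝ → ℂ) (t : ℝ) : ℝ≥0∞ :=
  ∫⁻ τ in Set.Icc (t - δ) (t + δ), ‖w τ‖ₑ ∂timeMeasure T

lemma timeMeasure_le_volume : timeMeasure T ≤ volume := Measure.restrict_le_self

lemma localMass_mono {δ δ' : ℝ} (h : δ ≤ δ') (w : ℝ → ℂ) (t : ℝ) :
    localMass T δ w t ≤ localMass T δ' w t :=
  lintegral_mono_set (Set.Icc_subset_Icc (by linarith) (by linarith))

lemma aemeasurable_localMass_integrand (δ : ℝ) {w : ℝ → ℂ}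
    (hw : AEStronglyMeasurable w (timeMeasure T)) :
    AEMeasurable (fun z : ℝ × ℝ => (Set.Icc (z.1 - δ) (z.1 + δ)).indicator (fun τ => ‖w τ‖ₑ) z.2)
      ((timeMeasure T).prod (timeMeasure T)) := by
  have hset : MeasurableSet {z : ℝ × ℝ | z.1 - δ ≤ z.2 ∧ z.2 ≤ z.1 + δ} :=
    (measurableSet_le (f := fun z : ℝ × ℝ => z.1 - δ) (g := fun z => z.2) (by fun_prop)
      (by fun_prop)).inter (measurableSet_le (f := fun z : ℝ × ℝ => z.2)
        (g := fun z => z.1 + δ) (by fun_prop) (by fun_prop))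
  exact (hw.comp_snd (μ := timeMeasure T)).enorm.indicator hset

lemma localMass_eq (δ : ℝ) (w : ℝ → ℂ) (t : ℝ) : localMass T δ w t
    = ∫⁻ τ, (Set.Icc (t - δ) (t + δ)).indicator (fun τ => ‖w τ‖ₑ) τ ∂timeMeasure T := by
  rw [localMass, lintegral_indicator measurableSet_Icc]

lemma aemeasurable_localMass (δ : ℝ) {w : ℝ → ℂ} (hw : AEStronglyMeasurable w (timeMeasure T)) :
    AEMeasurable (localMass T δ w) (timeMeasure T) := by
  rw [show localMass T δ w = _ from funext fun t => localMass_eq δ w t]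
  exact (aemeasurable_localMass_integrand δ hw).lintegral_prod_right'

/-- By Fubini, each τ is counted only for t in an interval of length 2δ. -/
lemma lintegral_localMass_le (δ : ℝ) {w : ℝ → ℂ} (hw : AEStronglyMeasurable w (timeMeasure T)) :
    ∫⁻ t, localMass T δ w t ∂timeMeasure T
      ≤ ENNReal.ofReal (2 * δ) * eLpNorm w 1 (timeMeasure T) := by
  simp_rw [localMass_eq]
  rw [lintegral_lintegral_swap (aemeasurable_localMass_integrand δ hw),
    eLpNorm_one_eq_lintegral_enorm, ← lintegral_const_mul'' _ hw.enorm]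
  refine lintegral_mono fun τ => ?_
  have h1 : ∀ t, (Set.Icc (t - δ) (t + δ)).indicator (fun τ => ‖w τ‖ₑ) τ
      = (Set.Icc (τ - δ) (τ + δ)).indicator (fun _ => ‖w τ‖ₑ) t := fun t => by
    simp only [Set.indicator, Set.mem_Icc]
    congr 1
    exact propext ⟨fun h => ⟨by linarith [h.2], by linarith [h.1]⟩,
      fun h => ⟨by linarith [h.2], by linarith [h.1]⟩⟩
  simp_rw [h1]
  rw [lintegral_indicator_const measurableSet_Icc, mul_comm]
  gcongr
  refine (timeMeasure_le_volume _).trans_eq ?_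
  rw [Real.volume_Icc]
  congr 1; ring

/-- No equi-integrability is needed, even for r = 1. The local mass has small L^1 norm by Fubini and
is at most the L^1 norm of w everywhere; interpolation gives the factor (2δ)^{1/r}. For r = ∞ the
bound 2δΛ is immediate. -/
lemma exists_eLpNorm_localMass_le {r : ℝ≥0∞} (hr : 1 ≤ r) (Λ : ℝ≥0) {η : ℝ≥0∞} (hη : 0 < η) :
    ∃ δ : ℝ, 0 < δ ∧ ∀ w : ℝ → ℂ, AEStronglyMeasurable w (timeMeasure T) →
      eLpNorm w r (timeMeasure T) ≤ Λ → eLpNorm (localMass T δ w) r (timeMeasure T) ≤ η := by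
  have hsmall : ∀ (x : ℝ), 0 < x → ∀ K : ℝ≥0∞, K ≠ ⊤ →
      ∃ δ : ℝ, 0 < δ ∧ ENNReal.ofReal (2 * δ) ^ x * K ≤ η := by
    intro x hx K hK
    have h1 : Tendsto (fun δ : ℝ => ENNReal.ofReal (2 * δ) ^ x * K) (𝓝 0) (𝓝 0) := by
      have h2 : Tendsto (fun δ : ℝ => ENNReal.ofReal (2 * δ)) (𝓝 0) (𝓝 0) := by
        have : Continuous fun δ : ℝ => ENNReal.ofReal (2 * δ) :=
          ENNReal.continuous_ofReal.comp (by fun_prop)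
        simpa using this.tendsto 0
      have h3 : Tendsto (fun δ : ℝ => ENNReal.ofReal (2 * δ) ^ x) (𝓝 0) (𝓝 0) := by
        have := ((ENNReal.continuous_rpow_const (y := x)).tendsto 0).comp h2
        rwa [ENNReal.zero_rpow_of_pos hx] at this
      simpa using ENNReal.Tendsto.mul_const h3 (Or.inr hK)
    have h2 := (h1.mono_left nhdsWithin_le_nhds : Tendsto _ (𝓝[>] (0 : ℝ)) _).eventually
      (gt_mem_nhds hη)
    obtain ⟨δ, hδ, hδ0⟩ := (h2.and self_mem_nhdsWithin).exists
    exact ⟨δ, hδ0, hδ.le⟩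
  have hr0 : r ≠ 0 := (zero_lt_one.trans_le hr).ne'
  rcases eq_or_ne r ⊤ with rfl | hrt
  · obtain ⟨δ, hδ, hle⟩ := hsmall 1 one_pos Λ ENNReal.coe_ne_top
    refine ⟨δ, hδ, fun w hw hwΛ => ?_⟩
    rw [eLpNorm_exponent_top]
    refine eLpNormEssSup_le_of_ae_enorm_bound (Eventually.of_forall fun t => ?_)
    rw [enorm_eq_self]
    refine le_trans ?_ hle
    have h1 : ∀ᵐ τ ∂(timeMeasure T).restrict (Set.Icc (t - δ) (t + δ)), ‖w τ‖ₑ ≤ Λ := by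
      refine ae_restrict_of_ae ?_
      filter_upwards [ae_le_eLpNormEssSup (f := w) (μ := timeMeasure T)] with τ hτ
      exact hτ.trans (by rwa [eLpNorm_exponent_top] at hwΛ)
    refine (lintegral_mono_ae h1).trans ?_
    rw [lintegral_const, Measure.restrict_apply MeasurableSet.univ, Set.univ_inter, mul_comm,
      ENNReal.rpow_one]
    gcongr
    refine (timeMeasure_le_volume _).trans_eq ?_
    rw [Real.volume_Icc]
    congr 1; ring
  · have hr1 : 1 ≤ r.toReal := by simpa using ENNReal.toReal_mono hrt hr
    have hrpos : 0 < r.toReal := by linarith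
    set K : ℝ≥0∞ := Λ * timeMeasure T Set.univ ^ (1 / (1 : ℝ≥0∞).toReal - 1 / r.toReal) with hK
    have hKt : K ≠ ⊤ := by
      refine ENNReal.mul_ne_top ENNReal.coe_ne_top
        (ENNReal.rpow_ne_top_of_nonneg ?_ (measure_ne_top _ _))
      simp only [ENNReal.toReal_one, div_one, sub_nonneg]
      rw [div_le_one hrpos]; exact hr1
    obtain ⟨δ, hδ, hle⟩ := hsmall (1 / r.toReal) (by positivity) K hKt
    refine ⟨δ, hδ, fun w hw hwΛ => le_trans ?_ hle⟩
    have hw1 : eLpNorm w 1 (timeMeasure T) ≤ K :=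
      (eLpNorm_le_eLpNorm_mul_rpow_measure_univ hr hw).trans (by rw [hK]; gcongr)
    have hVK : ∀ t, localMass T δ w t ≤ K := fun t => by
      refine le_trans (lintegral_mono' Measure.restrict_le_self le_rfl) ?_
      rwa [eLpNorm_one_eq_lintegral_enorm] at hw1
    rw [eLpNorm_eq_lintegral_rpow_enorm_toReal hr0 hrt]
    calc (∫⁻ t, ‖localMass T δ w t‖ₑ ^ r.toReal ∂timeMeasure T) ^ (1 / r.toReal)
        ≤ (∫⁻ t, localMass T δ w t * K ^ (r.toReal - 1) ∂timeMeasure T) ^ (1 / r.toReal) := by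
          gcongr with t
          rw [enorm_eq_self]
          calc _ = localMass T δ w t ^ (1 + (r.toReal - 1)) := by congr 1; ring
            _ = localMass T δ w t * localMass T δ w t ^ (r.toReal - 1) := by
              rw [ENNReal.rpow_add_of_nonneg _ _ zero_le_one (by linarith), ENNReal.rpow_one]
            _ ≤ _ := by
              gcongr
              exact hVK t
      _ = ((∫⁻ t, localMass T δ w t ∂timeMeasure T) * K ^ (r.toReal - 1)) ^ (1 / r.toReal) := by
          rw [lintegral_mul_const'' _ (aemeasurable_localMass δ hw)]
      _ ≤ (ENNReal.ofReal (2 * δ) * K * K ^ (r.toReal - 1)) ^ (1 / r.toReal) := by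
          gcongr
          exact (lintegral_localMass_le δ hw).trans (by gcongr)
      _ = ENNReal.ofReal (2 * δ) ^ (1 / r.toReal) * K := by
          rw [mul_assoc, ENNReal.mul_rpow_of_nonneg _ _ (by positivity)]
          congr 1
          nth_rw 1 [← ENNReal.rpow_one K]
          rw [← ENNReal.rpow_add_of_nonneg _ _ zero_le_one (by linarith), ← ENNReal.rpow_mul]
          rw [show (1 + (r.toReal - 1)) * (1 / r.toReal) = 1 by field_simp; ring, ENNReal.rpow_one]

/-- Pointwise control of a function by a local average and the local mass of its derivative. -/
lemma ae_enorm_le_average_add_localMass (hT : 0 < T) {β w : ℝ → ℂ}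
    (hβ : Integrable β (timeMeasure T)) (hw : Integrable w (timeMeasure T))
    (h : HasTimeDeriv T β w) {a b : ℝ} (ha : 0 ≤ a) (hb : b ≤ T) {ρ : ℝ → ℝ} (hρ : Continuous ρ)
    (hρs : tsupport ρ ⊆ Set.Ioo a b) (hρ0 : ∀ t, 0 ≤ ρ t) (hρ1 : ∫ t, ρ t = 1) :
    ∀ᵐ t ∂timeMeasure T, t ∈ Set.Icc a b →
      ‖β t‖ₑ ≤ ‖∫ τ, (ρ τ : ℂ) * β τ ∂timeMeasure T‖ₑ + localMass T (b - a) w t := by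
  obtain ⟨c, hc⟩ := exists_ae_eq_const_add_primitive hT hβ hw h
  set W : ℝ → ℂ := fun t => ∫ τ in (0 : ℝ)..t, w τ ∂timeMeasure T with hW
  have hWc : Continuous W := intervalIntegral.continuous_primitive
    (fun a b => hw.intervalIntegrable) 0
  have hWi : Integrable W (timeMeasure T) := hWc.continuousOn.integrableOn_compact isCompact_Icc
  have hρz : ∀ t, t ∉ Set.Ioo a b → ρ t = 0 := fun t ht =>
    image_eq_zero_of_notMem_tsupport fun h => ht (hρs h)
  have hρz' : ∀ t, t ∉ Set.Ioo 0 T → ρ t = 0 := fun t ht =>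
    hρz t fun h => ht ⟨ha.trans_lt h.1, h.2.trans_le hb⟩
  have hρμ : ∫ τ, (ρ τ : ℂ) ∂timeMeasure T = 1 := by
    rw [integral_timeMeasure_eq fun t ht => by rw [hρz' t ht]; simp, integral_complex_ofReal, hρ1]
    simp
  have hρμ' : ∫ τ, ρ τ ∂timeMeasure T = 1 := by
    rw [integral_timeMeasure_eq hρz', hρ1]
  have hρi : Integrable (fun t => (ρ t : ℂ)) (timeMeasure T) := by
    simpa using integrable_ofReal_mul (T := T) (integrable_const (1 : ℂ)) hρ
  have hρir : Integrable ρ (timeMeasure T) := hρ.continuousOn.integrableOn_compact isCompact_Icc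
  filter_upwards [hc] with t ht htm
  have hV : localMass T (b - a) w t ≠ ⊤ :=
    ne_top_of_le_ne_top hw.2.ne (lintegral_mono' Measure.restrict_le_self le_rfl)
  have hdiff : ∀ τ ∈ Set.Ioo a b, ‖W t - W τ‖ ≤ (localMass T (b - a) w t).toReal := by
    intro τ hτ
    rw [hW]
    dsimp only
    rw [intervalIntegral.integral_interval_sub_left hw.intervalIntegrable hw.intervalIntegrable]
    refine intervalIntegral.norm_integral_le_integral_norm_uIoc.trans ?_
    rw [integral_norm_eq_lintegral_enorm hw.1.restrict]
    refine ENNReal.toReal_mono hV (lintegral_mono_set ?_)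
    intro x hx
    rcases Set.mem_uIoc.1 hx with hx | hx
    · exact ⟨by linarith [hx.1, hτ.1, htm.2], by linarith [hx.2, hτ.1, hτ.2]⟩
    · exact ⟨by linarith [hx.1, hτ.1, hτ.2], by linarith [hx.2, hτ.2, htm.1]⟩
  -- As ρ has mass one, β(t) is its ρ-average plus the ρ-average of β(t) - β(τ), which is an
  -- increment of the primitive of w.
  have heq : β t = ∫ τ, (ρ τ : ℂ) * β τ ∂timeMeasure T
      + ∫ τ, (ρ τ : ℂ) * (W t - W τ) ∂timeMeasure T := by
    have e1 : ∫ τ, (ρ τ : ℂ) * β τ ∂timeMeasure T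
        = ∫ τ, (ρ τ : ℂ) * (c + W τ) ∂timeMeasure T :=
      integral_congr_ae (hc.mono fun τ hτ => by dsimp only; rw [hτ])
    have i1 : Integrable (fun τ => (ρ τ : ℂ) * (c + W τ)) (timeMeasure T) :=
      integrable_ofReal_mul ((integrable_const c).add hWi) hρ
    have i2 : Integrable (fun τ => (ρ τ : ℂ) * (W t - W τ)) (timeMeasure T) :=
      integrable_ofReal_mul ((integrable_const (W t)).sub hWi) hρ
    rw [e1, ← integral_add i1 i2]
    have e2 : ∀ τ, (ρ τ : ℂ) * (c + W τ) + (ρ τ : ℂ) * (W t - W τ) = (ρ τ : ℂ) * β t := fun τ => by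
      rw [ht]; ring
    simp_rw [e2]
    rw [integral_mul_const, hρμ, one_mul]
  have hle : ‖∫ τ, (ρ τ : ℂ) * (W t - W τ) ∂timeMeasure T‖ ≤ (localMass T (b - a) w t).toReal := by
    refine (norm_integral_le_of_norm_le
      (hρir.mul_const (localMass T (b - a) w t).toReal)
      (Eventually.of_forall fun τ => ?_)).trans_eq (by rw [integral_mul_const, hρμ', one_mul])
    rw [norm_mul, Complex.norm_real, Real.norm_of_nonneg (hρ0 τ)]
    by_cases hτ : τ ∈ Set.Ioo a b
    · exact mul_le_mul_of_nonneg_left (hdiff τ hτ) (hρ0 τ)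
    · rw [hρz τ hτ]; simp
  nth_rw 1 [heq]
  refine (enorm_add_le _ _).trans (add_le_add le_rfl ?_)
  rw [← ofReal_norm, ← ENNReal.ofReal_toReal hV]
  exact ENNReal.ofReal_le_ofReal hle

/-- Finitely many averages control a function whose derivative is bounded in `L^r`. -/
lemma exists_averages_control (hT : 0 < T) {r : ℝ≥0∞} (hr : 1 ≤ r) (Λ : ℝ≥0) {η : ℝ≥0∞}
    (hη : 0 < η) :
    ∃ (M : ℕ) (ρ : Fin M → ℝ → ℝ) (ε : ℝ), 0 < ε ∧ (∀ j, Continuous (ρ j)) ∧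
      ∀ β w : ℝ → ℂ, Integrable β (timeMeasure T) → Integrable w (timeMeasure T) →
        eLpNorm w r (timeMeasure T) ≤ Λ → HasTimeDeriv T β w →
        (∀ j, ‖∫ τ, (ρ j τ : ℂ) * β τ ∂timeMeasure T‖ ≤ ε) →
        eLpNorm β r (timeMeasure T) ≤ η := by
  have hη2 : 0 < η / 2 := ENNReal.half_pos hη.ne'
  obtain ⟨δ, hδ, hδV⟩ := exists_eLpNorm_localMass_le (T := T) hr Λ hη2
  -- The interval is cut into M pieces of length T/M ≤ δ, each carrying one bump function.
  obtain ⟨M, hM⟩ := exists_nat_gt (T / δ)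
  have hM0 : (0 : ℝ) < M := (div_pos hT hδ).trans hM
  have hTM : T / M ≤ δ := by
    rw [div_le_iff₀ hM0]
    rw [div_lt_iff₀ hδ] at hM
    linarith
  have hex : ∀ j : Fin M, _ := fun j => exists_smooth_bump (a := j * (T / M))
    (b := (j + 1) * (T / M)) (by
      have : 0 < T / M := by positivity
      nlinarith)
  choose ρ h1 h2 h3 h4 h5 using hex
  obtain ⟨ε, hε, hεη⟩ : ∃ ε : ℝ, 0 < ε ∧
      ENNReal.ofReal ε * timeMeasure T Set.univ ^ r.toReal⁻¹ ≤ η / 2 := by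
    have hK : timeMeasure T Set.univ ^ r.toReal⁻¹ ≠ ⊤ :=
      ENNReal.rpow_ne_top_of_nonneg (by simp) (measure_ne_top _ _)
    have h1 : Tendsto (fun ε : ℝ => ENNReal.ofReal ε * timeMeasure T Set.univ ^ r.toReal⁻¹)
        (𝓝[>] 0) (𝓝 0) := by
      have h2 : Tendsto (fun ε : ℝ => ENNReal.ofReal ε) (𝓝[>] 0) (𝓝 0) := by
        have := (ENNReal.continuous_ofReal.tendsto 0).mono_left (nhdsWithin_le_nhds (s := Set.Ioi 0))
        rwa [ENNReal.ofReal_zero] at this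
      simpa using ENNReal.Tendsto.mul_const h2 (Or.inr hK)
    obtain ⟨ε, hε, hε0⟩ := ((h1.eventually (gt_mem_nhds hη2)).and self_mem_nhdsWithin).exists
    exact ⟨ε, hε0, hε.le⟩
  refine ⟨M, ρ, ε, hε, fun j => (h1 j).continuous, fun β w hβ hw hwΛ hd hav => ?_⟩
  have hpt : ∀ᵐ t ∂timeMeasure T, ‖β t‖ₑ ≤ ENNReal.ofReal ε + localMass T δ w t := by
    have hall : ∀ᵐ t ∂timeMeasure T, ∀ j : Fin M,
        t ∈ Set.Icc ((j : ℝ) * (T / M)) ((j + 1) * (T / M)) →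
        ‖β t‖ₑ ≤ ‖∫ τ, (ρ j τ : ℂ) * β τ ∂timeMeasure T‖ₑ
          + localMass T ((j + 1) * (T / M) - j * (T / M)) w t := by
      refine ae_all_iff.2 fun j => ?_
      refine ae_enorm_le_average_add_localMass hT hβ hw hd (by positivity) ?_ (h1 j).continuous
        (h3 j) (h4 j) (h5 j)
      have : (j : ℝ) + 1 ≤ M := by exact_mod_cast j.2
      calc ((j : ℝ) + 1) * (T / M) ≤ M * (T / M) := by gcongr
        _ = T := by field_simp
    -- Discarding the endpoint T keeps the index ⌊t M / T⌋ below M.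
    have hIco : ∀ᵐ t ∂timeMeasure T, t ∈ Set.Ico 0 T := by
      unfold timeMeasure
      rw [← Measure.restrict_congr_set Ico_ae_eq_Icc]
      exact ae_restrict_mem measurableSet_Ico
    filter_upwards [hall, hIco] with t hall ht
    have hd0 : 0 < T / M := by positivity
    have hj0 : 0 ≤ t / (T / M) := div_nonneg ht.1 hd0.le
    have hjM : ⌊t / (T / M)⌋₊ < M := by
      rw [Nat.floor_lt hj0, div_lt_iff₀ hd0]
      calc t < T := ht.2
        _ = M * (T / M) := by field_simp
    refine (hall ⟨_, hjM⟩ ⟨?_, ?_⟩).trans (add_le_add ?_ (localMass_mono ?_ w t))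
    · rw [← le_div_iff₀ hd0]; exact Nat.floor_le hj0
    · rw [← div_le_iff₀ hd0]; exact (Nat.lt_floor_add_one _).le
    · rw [← ofReal_norm]
      exact ENNReal.ofReal_le_ofReal (hav _)
    · linarith
  calc eLpNorm β r (timeMeasure T)
      ≤ eLpNorm ((fun _ => ENNReal.ofReal ε) + localMass T δ w) r (timeMeasure T) :=
        eLpNorm_mono_enorm_ae (hpt.mono fun t ht => by simpa using ht)
    _ ≤ eLpNorm (fun _ => ENNReal.ofReal ε) r (timeMeasure T)
        + eLpNorm (localMass T δ w) r (timeMeasure T) :=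
        eLpNorm_add_le aestronglyMeasurable_const
          (aemeasurable_localMass δ hw.1).aestronglyMeasurable hr
    _ ≤ η / 2 + η / 2 := by
        refine add_le_add (le_trans ?_ hεη) (hδV w hw.1 hwΛ)
        exact eLpNorm_le_of_ae_enorm_bound (Eventually.of_forall fun t => by simp)
    _ = η := ENNReal.add_halves η

/-- Weak convergence becomes strong in the presence of a bound on the time derivatives. -/
theorem tendsto_eLpNorm_of_hasTimeDeriv (hT : 0 < T) {r : ℝ≥0∞} (hr : 1 ≤ r)
    {β w : ℕ → ℝ → ℂ} {β₀ : ℝ → ℂ} {C : ℝ≥0} (hβ : ∀ n, Integrable (β n) (timeMeasure T))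
    (hβ₀ : Integrable β₀ (timeMeasure T)) (hw : ∀ n, AEStronglyMeasurable (w n) (timeMeasure T))
    (hwC : ∀ n, eLpNorm (w n) r (timeMeasure T) ≤ C) (hd : ∀ n, HasTimeDeriv T (β n) (w n))
    (hlim : ∀ α : ℝ → ℝ, Continuous α →
      Tendsto (fun n => ∫ t, (α t : ℂ) * β n t ∂timeMeasure T) atTop
        (𝓝 (∫ t, (α t : ℂ) * β₀ t ∂timeMeasure T))) :
    Tendsto (fun n => eLpNorm (β n - β₀) r (timeMeasure T)) atTop (𝓝 0) ∧
    ∀ δ : ℝ≥0∞, 0 < δ → ∃ c : ℝ → ℂ, Continuous c ∧ eLpNorm (β₀ - c) r (timeMeasure T) ≤ δ := by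
  have hwm : ∀ n, MemLp (w n) r (timeMeasure T) := fun n =>
    ⟨hw n, (hwC n).trans_lt ENNReal.coe_lt_top⟩
  have hwi : ∀ n, Integrable (w n) (timeMeasure T) := fun n => (hwm n).integrable hr
  -- The β n are only assumed integrable. Their continuous representatives place them in L^r and
  -- later serve as the continuous approximants of the limit.
  have hrep : ∀ n, ∃ c : ℝ → ℂ, Continuous c ∧ β n =ᵐ[timeMeasure T] c := fun n => by
    obtain ⟨c, hc⟩ := exists_ae_eq_const_add_primitive hT (hβ n) (hwi n) (hd n)
    exact ⟨_, continuous_const.add (intervalIntegral.continuous_primitive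
      (fun a b => (hwi n).intervalIntegrable) 0), hc⟩
  choose c hcc hcae using hrep
  have hβm : ∀ n, MemLp (β n) r (timeMeasure T) := fun n => by
    refine MemLp.ae_eq (hcae n).symm ?_
    obtain ⟨K, hK⟩ := (isCompact_Icc (a := 0) (b := T)).exists_bound_of_continuousOn
      (hcc n).continuousOn
    refine MemLp.of_bound (hcc n).aestronglyMeasurable K ?_
    exact (ae_restrict_mem measurableSet_Icc).mono hK
  -- The control by averages is applied to differences, whose derivatives are bounded by C + C and
  -- whose finitely many averages become small by weak convergence.
  have hcauchy : ∀ η : ℝ≥0∞, 0 < η → ∃ N, ∀ m ≥ N, ∀ n ≥ N,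
      eLpNorm (β m - β n) r (timeMeasure T) ≤ η := by
    intro η hη
    obtain ⟨M, ρ, ε, hε, hρ, hcontrol⟩ := exists_averages_control hT hr (C + C) hη
    have hN : ∀ j, ∃ N, ∀ n ≥ N, dist (∫ τ, (ρ j τ : ℂ) * β n τ ∂timeMeasure T)
        (∫ τ, (ρ j τ : ℂ) * β₀ τ ∂timeMeasure T) < ε / 2 := fun j =>
      (Metric.tendsto_atTop.1 (hlim (ρ j) (hρ j))) (ε / 2) (by positivity)
    choose N hN using hN
    refine ⟨Finset.univ.sup N, fun m hm n hn => ?_⟩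
    refine hcontrol _ (fun t => w m t - w n t) ((hβ m).sub (hβ n)) ((hwi m).sub (hwi n)) ?_
      ((hd m).sub (hd n) (hβ m) (hβ n) (hwi m) (hwi n)) fun j => ?_
    · refine (eLpNorm_sub_le (hw m) (hw n) hr).trans ?_
      push_cast
      exact add_le_add (hwC m) (hwC n)
    · have e1 : ∫ τ, (ρ j τ : ℂ) * (β m - β n) τ ∂timeMeasure T
          = ∫ τ, (ρ j τ : ℂ) * β m τ ∂timeMeasure T - ∫ τ, (ρ j τ : ℂ) * β n τ ∂timeMeasure T := by
        rw [← integral_sub (integrable_ofReal_mul (hβ m) (hρ j))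
          (integrable_ofReal_mul (hβ n) (hρ j))]
        simp only [Pi.sub_apply, mul_sub]
      rw [e1, ← dist_eq_norm]
      have hle : N j ≤ Finset.univ.sup N := Finset.le_sup (Finset.mem_univ j)
      refine (dist_triangle_right _ _ (∫ τ, (ρ j τ : ℂ) * β₀ τ ∂timeMeasure T)).trans ?_
      linarith [hN j m (hle.trans hm), hN j n (hle.trans hn)]
  have hfact : Fact (1 ≤ r) := ⟨hr⟩
  have hcs : CauchySeq fun n => (hβm n).toLp := by
    refine EMetric.cauchySeq_iff.2 fun η hη => ?_
    obtain ⟨η', hη', hηη'⟩ := exists_between hη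
    obtain ⟨N, hN⟩ := hcauchy η' hη'
    refine ⟨N, fun m hm n hn => ?_⟩
    rw [Lp.edist_toLp_toLp]
    exact (hN m hm n hn).trans_lt hηη'
  obtain ⟨f, hf⟩ := cauchySeq_tendsto_of_complete hcs
  have hf' : Tendsto (fun n => eLpNorm (β n - ⇑f) r (timeMeasure T)) atTop (𝓝 0) := by
    have := (Lp.tendsto_Lp_iff_tendsto_eLpNorm' _ _).1 hf
    refine this.congr fun n => eLpNorm_congr_ae ?_
    filter_upwards [(hβm n).coeFn_toLp] with t ht
    simp [ht]
  have hfi : Integrable f (timeMeasure T) := (Lp.memLp f).integrable hr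
  have hf1 : Tendsto (fun n => eLpNorm (β n - ⇑f) 1 (timeMeasure T)) atTop (𝓝 0) := by
    have hle : ∀ n, eLpNorm (β n - ⇑f) 1 (timeMeasure T) ≤ eLpNorm (β n - ⇑f) r (timeMeasure T) *
        timeMeasure T Set.univ ^ (1 / (1 : ℝ≥0∞).toReal - 1 / r.toReal) := fun n =>
      eLpNorm_le_eLpNorm_mul_rpow_measure_univ hr ((hβm n).1.sub (Lp.memLp f).1)
    refine tendsto_of_tendsto_of_tendsto_of_le_of_le tendsto_const_nhds ?_
      (fun _ => zero_le) hle
    have hK : timeMeasure T Set.univ ^ (1 / (1 : ℝ≥0∞).toReal - 1 / r.toReal) ≠ ⊤ := by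
      refine ENNReal.rpow_ne_top_of_nonneg ?_ (measure_ne_top _ _)
      rcases eq_or_ne r ⊤ with rfl | hrt
      · simp
      · have : 1 ≤ r.toReal := by simpa using ENNReal.toReal_mono hrt hr
        simp only [ENNReal.toReal_one, div_one, sub_nonneg]
        exact (div_le_one (by linarith)).2 this
    simpa using ENNReal.Tendsto.mul_const hf' (Or.inr hK)
  -- The strong limit from completeness equals β₀ because the two have the same integrals against
  -- test functions.
  have hident : ∀ᵐ t ∂timeMeasure T, f t - β₀ t = 0 := by
    refine ae_eq_zero_of_test (hfi.sub hβ₀) fun φ h1 _ _ => ?_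
    have hφ := h1.continuous
    have e1 : Tendsto (fun n => ∫ t, (φ t : ℂ) * β n t ∂timeMeasure T) atTop
        (𝓝 (∫ t, (φ t : ℂ) * f t ∂timeMeasure T)) := by
      refine tendsto_integral_of_L1' _ (integrable_ofReal_mul hfi hφ).1
        (Eventually.of_forall fun n => integrable_ofReal_mul (hβ n) hφ) ?_
      obtain ⟨K, hK⟩ := (isCompact_Icc (a := 0) (b := T)).exists_bound_of_continuousOn
        hφ.continuousOn
      refine tendsto_of_tendsto_of_tendsto_of_le_of_le (g := 0)
        (h := fun n => ENNReal.ofReal K * eLpNorm (β n - ⇑f) 1 (timeMeasure T))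
        tendsto_const_nhds ?_ (fun _ => zero_le) fun n => ?_
      · simpa using ENNReal.Tendsto.const_mul hf1 (Or.inr ENNReal.ofReal_ne_top)
      · refine eLpNorm_le_mul_eLpNorm_of_ae_le_mul'' 1 ((hβm n).1.sub (Lp.memLp f).1) ?_
        filter_upwards [ae_restrict_mem (μ := volume) (measurableSet_Icc (a := 0) (b := T))]
          with t ht
        simp only [Pi.sub_apply, ← mul_sub, enorm_mul]
        gcongr
        rw [← ofReal_norm, Complex.norm_real]
        exact ENNReal.ofReal_le_ofReal (hK t ht)
    have e2 := tendsto_nhds_unique e1 (hlim φ hφ)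
    simp_rw [mul_sub]
    rw [integral_sub (integrable_ofReal_mul hfi hφ) (integrable_ofReal_mul hβ₀ hφ), e2, sub_self]
  have hmain : Tendsto (fun n => eLpNorm (β n - β₀) r (timeMeasure T)) atTop (𝓝 0) := by
    refine hf'.congr fun n => eLpNorm_congr_ae ?_
    filter_upwards [hident] with t ht
    simp [sub_eq_zero.1 ht]
  -- The continuous representatives approximate the limit. For r = ∞ this is extra information,
  -- since continuous functions are not dense there.
  refine ⟨hmain, fun δ hδ => ?_⟩
  obtain ⟨n, hn⟩ := (hmain.eventually (gt_mem_nhds hδ)).exists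
  refine ⟨c n, hcc n, ?_⟩
  rw [eLpNorm_sub_comm]
  refine le_trans (le_of_eq (eLpNorm_congr_ae ?_)) hn.le
  filter_upwards [hcae n] with t ht
  simp [ht]

end TimeCompactness

/-! ### Strong convergence in time of spatial averages. -/

section SpatialAverages

variable {T : ℝ} {r : ℝ≥0∞}

lemma mixedNorm_lt_top_of_continuous {q p : ℝ≥0∞} (hT : 0 ≤ T) {g : ℝ × T3 → ℝ}
    (hg : Continuous g) : mixedNorm T q p g < ⊤ := by
  obtain ⟨K, hK⟩ := (isCompact_Icc.prod isCompact_univ :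
    IsCompact (Set.Icc (0 : ℝ) T ×ˢ (Set.univ : Set T3))).exists_bound_of_continuousOn
    hg.continuousOn
  -- A continuous g may be unbounded outside [0, T]; projecting time onto the interval makes it
  -- bounded without changing it almost everywhere.
  have hae : g =ᵐ[spaceTime T] fun z => g (Set.projIcc 0 T hT z.1, z.2) := by
    have h1 : ∀ᵐ z ∂spaceTime T, z.1 ∈ Set.Icc 0 T :=
      Measure.quasiMeasurePreserving_fst.ae (ae_restrict_mem measurableSet_Icc)
    filter_upwards [h1] with z hz
    rw [Set.projIcc_of_mem hT hz]
  rw [mixedNorm_congr_ae hae]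
  refine (mixedNorm_le_of_bound (R := K) fun z => ?_).trans_lt
    (ENNReal.mul_lt_top ENNReal.ofReal_lt_top
      (ENNReal.rpow_lt_top_of_nonneg (by simp) (measure_ne_top _ _)))
  exact hK _ ⟨(Set.projIcc 0 T hT z.1).2, Set.mem_univ _⟩

lemma integrable_of_mixedNorm {p : ℝ≥0∞} (hr : 1 ≤ r) (hp : 1 ≤ p) {b : ℝ × T3 → ℝ}
    (hb : MemLqLp T r p b) : Integrable b (spaceTime T) := by
  have := ENNReal.HolderConjugate.conjExponent hr
  have := ENNReal.HolderConjugate.conjExponent hp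
  have h1 : MemLqLp T r.conjExponent p.conjExponent (fun _ : ℝ × T3 => (1 : ℝ)) :=
    ⟨aestronglyMeasurable_const, (mixedNorm_le_of_bound (R := 1) (by simp)).trans_lt
      (ENNReal.mul_lt_top ENNReal.ofReal_lt_top
        (ENNReal.rpow_lt_top_of_nonneg (by simp) (measure_ne_top _ _)))⟩
  simpa using integrable_mul_of_mixed hb h1

/-- The spatial integral of `b` against `h`, as a function of time. -/
def spatialPairing (b : ℝ × T3 → ℝ) (h : C(T3, ℂ)) (t : ℝ) : ℂ := ∫ x, (b (t, x) : ℂ) * h x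

lemma integrable_mul_continuousMap {u : T3 → ℝ} (hu : Integrable u volume) (h : C(T3, ℂ)) :
    Integrable (fun x => (u x : ℂ) * h x) volume :=
  (hu.ofReal (𝕜 := ℂ)).mul_bdd (c := ‖h‖) h.continuous.aestronglyMeasurable
    (Eventually.of_forall h.norm_coe_le_norm)

lemma ae_integrable_slice {b : ℝ × T3 → ℝ} (hb : Integrable b (spaceTime T)) :
    ∀ᵐ t ∂timeMeasure T, Integrable (fun x => b (t, x)) volume :=
  hb.prod_right_ae

/-- Only almost everywhere: on a non-integrable slice the integrals take default values. -/
lemma spatialPairing_add {b : ℝ × T3 → ℝ} (hb : Integrable b (spaceTime T)) (h h' : C(T3, ℂ)) :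
    spatialPairing b (h + h') =ᵐ[timeMeasure T] spatialPairing b h + spatialPairing b h' := by
  filter_upwards [ae_integrable_slice hb] with t ht
  simp only [spatialPairing, ContinuousMap.add_apply, mul_add, Pi.add_apply]
  exact integral_add (integrable_mul_continuousMap ht h) (integrable_mul_continuousMap ht h')

lemma spatialPairing_smul (b : ℝ × T3 → ℝ) (c : ℂ) (h : C(T3, ℂ)) :
    spatialPairing b (c • h) = c • spatialPairing b h := by
  ext t
  simp only [spatialPairing, ContinuousMap.smul_apply, smul_eq_mul, Pi.smul_apply,
    ← integral_const_mul]
  congr 1; ext x; ring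

lemma aestronglyMeasurable_spatialPairing {b : ℝ × T3 → ℝ}
    (hb : AEStronglyMeasurable b (spaceTime T)) (h : C(T3, ℂ)) :
    AEStronglyMeasurable (spatialPairing b h) (timeMeasure T) := by
  have h1 : AEStronglyMeasurable (fun z : ℝ × T3 => (b z : ℂ) * h z.2)
      ((timeMeasure T).prod volume) :=
    (Complex.continuous_ofReal.comp_aestronglyMeasurable hb).mul
      (h.continuous.comp continuous_snd).aestronglyMeasurable
  exact h1.integral_prod_right'

lemma eLpNorm_spatialPairing_le {b : ℝ × T3 → ℝ} (hb : AEStronglyMeasurable b (spaceTime T))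
    (h : C(T3, ℂ)) :
    eLpNorm (spatialPairing b h) r (timeMeasure T) ≤ ‖h‖ₑ * mixedNorm T r 1 b := by
  have hm : AEMeasurable (fun t => eLpNorm (fun x => b (t, x)) 1 (volume : Measure T3))
      (timeMeasure T) := by
    simpa only [eLpNorm_enorm] using aemeasurable_eLpNorm_slice (ν := (volume : Measure T3))
      (F := fun z => ‖b z‖ₑ) hb.enorm 1
  refine eLpNorm_le_mul_eLpNorm_of_ae_le_mul'' r hm.aestronglyMeasurable (Eventually.of_forall fun t => ?_)
  rw [enorm_eq_self, eLpNorm_one_eq_lintegral_enorm]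
  refine (enorm_integral_le_lintegral_enorm _).trans ?_
  rw [← lintegral_const_mul' _ _ enorm_ne_top]
  refine lintegral_mono fun x => ?_
  rw [enorm_mul, mul_comm]
  gcongr
  · rw [← ofReal_norm, ← ofReal_norm]
    exact ENNReal.ofReal_le_ofReal (h.norm_coe_le_norm x)
  · rw [← ofReal_norm, ← ofReal_norm, Complex.norm_real]

/-- Strong convergence of the spatial pairings with `h`, with a limit that is approximable by
continuous functions of time. -/
def PairingConverges (T : ℝ) (r : ℝ≥0∞) (b : ℕ → ℝ × T3 → ℝ) (b₀ : ℝ × T3 → ℝ)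
    (h : C(T3, ℂ)) : Prop :=
  Tendsto (fun n => eLpNorm (spatialPairing (b n) h - spatialPairing b₀ h) r (timeMeasure T))
    atTop (𝓝 0) ∧
  ∀ δ : ℝ≥0∞, 0 < δ → ∃ c : ℝ → ℂ, Continuous c ∧
    eLpNorm (spatialPairing b₀ h - c) r (timeMeasure T) ≤ δ

variable {b : ℕ → ℝ × T3 → ℝ} {b₀ : ℝ × T3 → ℝ}

lemma PairingConverges.add (hr : 1 ≤ r) (hb : ∀ n, Integrable (b n) (spaceTime T))
    (hb₀ : Integrable b₀ (spaceTime T)) {h h' : C(T3, ℂ)} (H : PairingConverges T r b b₀ h)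
    (H' : PairingConverges T r b b₀ h') : PairingConverges T r b b₀ (h + h') := by
  have hm := fun n k => aestronglyMeasurable_spatialPairing (hb n).1 k
  have hm₀ := fun k => aestronglyMeasurable_spatialPairing hb₀.1 k
  refine ⟨?_, fun δ hδ => ?_⟩
  · refine tendsto_of_tendsto_of_tendsto_of_le_of_le tendsto_const_nhds
      (by simpa using H.1.add H'.1) (fun _ => zero_le) fun n => ?_
    refine le_trans (le_of_eq (eLpNorm_congr_ae ?_))
      (eLpNorm_add_le ((hm n h).sub (hm₀ h)) ((hm n h').sub (hm₀ h')) hr)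
    filter_upwards [spatialPairing_add (hb n) h h', spatialPairing_add hb₀ h h'] with t h1 h2
    simp only [Pi.sub_apply, h1, h2, Pi.add_apply]; ring
  · obtain ⟨c, hc, hcδ⟩ := H.2 (δ / 2) (ENNReal.half_pos hδ.ne')
    obtain ⟨c', hc', hcδ'⟩ := H'.2 (δ / 2) (ENNReal.half_pos hδ.ne')
    refine ⟨c + c', hc.add hc', ?_⟩
    rw [← ENNReal.add_halves δ]
    refine le_trans (le_trans (le_of_eq (eLpNorm_congr_ae ?_))
      (eLpNorm_add_le ((hm₀ h).sub hc.aestronglyMeasurable)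
        ((hm₀ h').sub hc'.aestronglyMeasurable) hr)) (add_le_add hcδ hcδ')
    filter_upwards [spatialPairing_add hb₀ h h'] with t h2
    simp only [Pi.sub_apply, h2, Pi.add_apply]; ring

lemma PairingConverges.smul {h : C(T3, ℂ)} (H : PairingConverges T r b b₀ h) (c : ℂ) :
    PairingConverges T r b b₀ (c • h) := by
  refine ⟨?_, fun δ hδ => ?_⟩
  · simp only [spatialPairing_smul, ← smul_sub, eLpNorm_const_smul]
    simpa using ENNReal.Tendsto.const_mul H.1 (Or.inr (enorm_ne_top (x := c)))
  · have h1 : 0 < δ / (‖c‖ₑ + 1) := ENNReal.div_pos hδ.ne' (by simp)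
    obtain ⟨d, hd, hdδ⟩ := H.2 _ h1
    refine ⟨c • d, hd.const_smul c, ?_⟩
    rw [spatialPairing_smul, ← smul_sub, eLpNorm_const_smul]
    calc _ ≤ (‖c‖ₑ + 1) * (δ / (‖c‖ₑ + 1)) := by gcongr; exact le_self_add
      _ ≤ δ := ENNReal.mul_div_le

/-- The bound in L^r(L^1) makes h ↦ `spatialPairing (b n) h` Lipschitz in the sup norm of h,
uniformly in n, so the good weights form a closed set. -/
lemma PairingConverges.of_closure (hr : 1 ≤ r) (hb : ∀ n, Integrable (b n) (spaceTime T))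
    (hb₀ : Integrable b₀ (spaceTime T)) {C : ℝ≥0} (hC : ∀ n, mixedNorm T r 1 (b n) ≤ C)
    (hC₀ : mixedNorm T r 1 b₀ ≤ C) {h : C(T3, ℂ)}
    (H : h ∈ closure {h | PairingConverges T r b b₀ h}) : PairingConverges T r b b₀ h := by
  have hm := fun n k => aestronglyMeasurable_spatialPairing (hb n).1 k
  have hm₀ := fun k => aestronglyMeasurable_spatialPairing hb₀.1 k
  have happrox : ∀ η : ℝ≥0∞, 0 < η → ∃ h', PairingConverges T r b b₀ h' ∧
      (∀ n, eLpNorm (spatialPairing (b n) (h - h')) r (timeMeasure T) ≤ η) ∧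
      eLpNorm (spatialPairing b₀ (h - h')) r (timeMeasure T) ≤ η := by
    intro η hη
    obtain ⟨h', hh', hd⟩ := EMetric.mem_closure_iff.1 H (η / (C + 1))
      (ENNReal.div_pos hη.ne' (by simp))
    rw [edist_eq_enorm_sub] at hd
    have hle : ‖h - h'‖ₑ * C ≤ η := by
      calc _ ≤ η / (C + 1) * (C + 1) := by gcongr; exact le_self_add
        _ ≤ η := by rw [mul_comm]; exact ENNReal.mul_div_le
    exact ⟨h', hh', fun n => (eLpNorm_spatialPairing_le (hb n).1 _).trans
      (le_trans (by gcongr; exact hC n) hle),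
      (eLpNorm_spatialPairing_le hb₀.1 _).trans (le_trans (by gcongr) hle)⟩
  have hsplit : ∀ (f : ℝ × T3 → ℝ), Integrable f (spaceTime T) → ∀ h' : C(T3, ℂ),
      spatialPairing f h =ᵐ[timeMeasure T] spatialPairing f (h - h') + spatialPairing f h' := by
    intro f hf h'
    have := spatialPairing_add hf (h - h') h'
    rwa [sub_add_cancel] at this
  refine ⟨?_, fun δ hδ => ?_⟩
  · refine ENNReal.tendsto_nhds_zero.2 fun ε hε => ?_
    have hε3 : 0 < ε / 3 := ENNReal.div_pos hε.ne' (by simp)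
    obtain ⟨h', hh', h1, h2⟩ := happrox _ hε3
    filter_upwards [hh'.1.eventually (gt_mem_nhds hε3)] with n hn
    rw [← ENNReal.add_thirds ε]
    have e : spatialPairing (b n) h - spatialPairing b₀ h =ᵐ[timeMeasure T]
        (spatialPairing (b n) (h - h') - spatialPairing b₀ (h - h'))
          + (spatialPairing (b n) h' - spatialPairing b₀ h') := by
      filter_upwards [hsplit _ (hb n) h', hsplit _ hb₀ h'] with t e1 e2
      simp only [Pi.sub_apply, e1, e2, Pi.add_apply]; ring
    rw [eLpNorm_congr_ae e]
    refine (eLpNorm_add_le ((hm _ _).sub (hm₀ _)) ((hm _ _).sub (hm₀ _)) hr).trans ?_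
    refine add_le_add ?_ hn.le
    exact (eLpNorm_sub_le (hm _ _) (hm₀ _) hr).trans (add_le_add (h1 n) h2)
  · have hδ2 := ENNReal.half_pos hδ.ne'
    obtain ⟨h', hh', -, h2⟩ := happrox _ hδ2
    obtain ⟨c, hc, hcδ⟩ := hh'.2 _ hδ2
    refine ⟨c, hc, ?_⟩
    rw [← ENNReal.add_halves δ]
    have e : spatialPairing b₀ h - c =ᵐ[timeMeasure T]
        spatialPairing b₀ (h - h') + (spatialPairing b₀ h' - c) := by
      filter_upwards [hsplit _ hb₀ h'] with t e2
      simp only [Pi.sub_apply, e2, Pi.add_apply]; ring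
    rw [eLpNorm_congr_ae e]
    exact (eLpNorm_add_le (hm₀ _) ((hm₀ _).sub hc.aestronglyMeasurable) hr).trans
      (add_le_add h2 hcδ)

/-- One term of the sum. The constant depends on k and on the order, which is harmless because one
frequency is treated at a time. -/
lemma enorm_le_mul_sobolevNorm (l : ℤ) (k : Fin 3 → ℤ) : ∃ K : ℝ≥0, ∀ c : (Fin 3 → ℤ) → ℂ,
    ‖c k‖ₑ ≤ K * sobolevNorm l c := by
  set M : ℝ := (1 + ∑ i, (k i : ℝ) ^ 2) ^ l with hM
  have hM0 : 0 < M := by positivity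
  refine ⟨Real.toNNReal (M⁻¹ ^ (1 / 2 : ℝ)), fun c => ?_⟩
  have h1 : ENNReal.ofReal M * ‖c k‖ₑ ^ 2 ≤
      ∑' k : Fin 3 → ℤ, ENNReal.ofReal ((1 + ∑ i, (k i : ℝ) ^ 2) ^ l) * ‖c k‖ₑ ^ 2 :=
    ENNReal.le_tsum (f := fun k : Fin 3 → ℤ =>
      ENNReal.ofReal ((1 + ∑ i, (k i : ℝ) ^ 2) ^ l) * ‖c k‖ₑ ^ 2) k
  have h2 := ENNReal.rpow_le_rpow h1 (by norm_num : (0 : ℝ) ≤ 1 / 2)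
  have e1 : ((Real.toNNReal (M⁻¹ ^ (1 / 2 : ℝ)) : ℝ≥0) : ℝ≥0∞)
      = ENNReal.ofReal M⁻¹ ^ (1 / 2 : ℝ) := by
    rw [ENNReal.ofReal_rpow_of_nonneg (by positivity) (by norm_num)]; rfl
  rw [e1]
  refine le_trans (le_of_eq ?_) (mul_le_mul_right h2 _)
  rw [← ENNReal.mul_rpow_of_nonneg _ _ (by norm_num), ← mul_assoc,
    ← ENNReal.ofReal_mul (by positivity), inv_mul_cancel₀ hM0.ne', ENNReal.ofReal_one, one_mul,
    ← ENNReal.rpow_natCast, ← ENNReal.rpow_mul]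
  norm_num

lemma aemeasurable_sobolevNorm (l : ℤ) {w : ℝ → (Fin 3 → ℤ) → ℂ}
    (hw : ∀ k, AEStronglyMeasurable (fun t => w t k) (timeMeasure T)) :
    AEMeasurable (fun t => sobolevNorm l (w t)) (timeMeasure T) :=
  (AEMeasurable.tsum fun k => ((hw k).enorm.pow_const 2).const_mul _).pow_const _

/-- Weak convergence is tested with real functions on space-time, hence the separation of real and
imaginary parts. -/
lemma integral_ofReal_mul_spatialPairing {b : ℝ × T3 → ℝ} (hb : Integrable b (spaceTime T))
    {α : ℝ → ℝ} (hα : Continuous α) (h : C(T3, ℂ)) :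
    ∫ t, (α t : ℂ) * spatialPairing b h t ∂timeMeasure T
      = ((∫ z, b z * (α z.1 * (h z.2).re) ∂spaceTime T : ℝ) : ℂ)
        + ((∫ z, b z * (α z.1 * (h z.2).im) ∂spaceTime T : ℝ) : ℂ) * Complex.I := by
  obtain ⟨K, hK⟩ := (isCompact_Icc (a := 0) (b := T)).exists_bound_of_continuousOn
    hα.continuousOn
  have hi : Integrable (fun z : ℝ × T3 => (b z : ℂ) * ((α z.1 : ℂ) * h z.2)) (spaceTime T) := by
    refine (hb.ofReal (𝕜 := ℂ)).mul_bdd (c := K * ‖h‖)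
      (by fun_prop : Continuous fun z : ℝ × T3 => (α z.1 : ℂ) * h z.2).aestronglyMeasurable ?_
    have h1 : ∀ᵐ z ∂spaceTime T, z.1 ∈ Set.Icc 0 T :=
      Measure.quasiMeasurePreserving_fst.ae (ae_restrict_mem measurableSet_Icc)
    filter_upwards [h1] with z hz
    rw [norm_mul, Complex.norm_real]
    have := hK _ hz
    gcongr
    · exact (norm_nonneg _).trans this
    · exact h.norm_coe_le_norm _
  have e1 : ∫ t, (α t : ℂ) * spatialPairing b h t ∂timeMeasure T
      = ∫ z, (b z : ℂ) * ((α z.1 : ℂ) * h z.2) ∂spaceTime T := by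
    rw [spaceTime, integral_prod _ hi]
    refine integral_congr_ae (Eventually.of_forall fun t => ?_)
    simp only [spatialPairing, ← integral_const_mul]
    congr 1; ext x; ring
  rw [e1, ← integral_re_add_im hi]
  simp

/-- The pairings with exponentials converge strongly under a bound on the time derivatives. -/
lemma pairingConverges_mFourier (hT : 0 < T) (hr : 1 ≤ r)
    (hb : ∀ n, Integrable (b n) (spaceTime T)) (hb₀ : Integrable b₀ (spaceTime T))
    (hlim : ∀ g : ℝ × T3 → ℝ, Continuous g →
      Tendsto (fun n => ∫ z, b n z * g z ∂spaceTime T) atTop (𝓝 (∫ z, b₀ z * g z ∂spaceTime T)))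
    {l : ℤ} {D : ℝ≥0} (hD : ∀ n, TimeDerivBound T r l (b n) D) (k : Fin 3 → ℤ) :
    PairingConverges T r b b₀ (UnitAddTorus.mFourier k) := by
  choose w hw hwD hd using hD
  -- Pairing with the exponential of frequency k gives the Fourier coefficient of index -k.
  obtain ⟨K, hK⟩ := enorm_le_mul_sobolevNorm l (-k)
  have hpi : ∀ f : ℝ × T3 → ℝ, Integrable f (spaceTime T) → ∀ h,
      Integrable (spatialPairing f h) (timeMeasure T) := fun f hf h => by
    refine memLp_one_iff_integrable.1 ⟨aestronglyMeasurable_spatialPairing hf.1 h,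
      (eLpNorm_spatialPairing_le hf.1 h).trans_lt (ENNReal.mul_lt_top enorm_lt_top ?_)⟩
    have h2 := hf.2
    unfold HasFiniteIntegral at h2
    rw [spaceTime, lintegral_prod _ hf.1.enorm] at h2
    simpa [mixedNorm, eLpNorm_one_eq_lintegral_enorm] using h2
  refine tendsto_eLpNorm_of_hasTimeDeriv hT hr (w := fun n t => w n t (-k)) (C := K * D)
    (fun n => hpi _ (hb n) _) (hpi _ hb₀ _) (fun n => hw n _) (fun n => ?_) (fun n => ?_) ?_
  · push_cast
    refine le_trans (eLpNorm_le_mul_eLpNorm_of_ae_le_mul'' (c := K) r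
      (aemeasurable_sobolevNorm l (hw n)).aestronglyMeasurable
      (Eventually.of_forall fun t => by simpa using hK (w n t))) ?_
    gcongr
    exact hwD n
  · intro ψ h1 h2 h3
    simpa [fourierCoeffT3, spatialPairing] using hd n ψ (-k) h1 h2 h3
  · intro α hα
    simp_rw [integral_ofReal_mul_spatialPairing (hb _) hα,
      integral_ofReal_mul_spatialPairing hb₀ hα]
    refine Tendsto.add ?_ (Tendsto.mul_const _ ?_)
    · exact (Complex.continuous_ofReal.tendsto _).comp (hlim _ (by fun_prop))
    · exact (Complex.continuous_ofReal.tendsto _).comp (hlim _ (by fun_prop))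

/-- The weights for which convergence holds form a closed set containing all trigonometric
polynomials. -/
lemma pairingConverges (hT : 0 < T) (hr : 1 ≤ r)
    (hb : ∀ n, Integrable (b n) (spaceTime T)) (hb₀ : Integrable b₀ (spaceTime T))
    (hlim : ∀ g : ℝ × T3 → ℝ, Continuous g →
      Tendsto (fun n => ∫ z, b n z * g z ∂spaceTime T) atTop (𝓝 (∫ z, b₀ z * g z ∂spaceTime T)))
    {C : ℝ≥0} (hC : ∀ n, mixedNorm T r 1 (b n) ≤ C) (hC₀ : mixedNorm T r 1 b₀ ≤ C)
    {l : ℤ} {D : ℝ≥0} (hD : ∀ n, TimeDerivBound T r l (b n) D) (h : C(T3, ℂ)) :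
    PairingConverges T r b b₀ h := by
  refine .of_closure hr hb hb₀ hC hC₀ ?_
  have h1 : h ∈ (Submodule.span ℂ (Set.range
      (UnitAddTorus.mFourier (d := Fin 3)))).topologicalClosure := by
    rw [UnitAddTorus.span_mFourier_closure_eq_top]; trivial
  refine closure_mono ?_ h1
  intro h' hh'
  induction hh' using Submodule.span_induction with
  | mem x hx =>
    obtain ⟨k, rfl⟩ := hx
    exact pairingConverges_mFourier hT hr hb hb₀ hlim hD k
  | zero =>
    rw [Set.mem_ofPred_eq, ← zero_smul ℂ (UnitAddTorus.mFourier (0 : Fin 3 → ℤ))]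
    exact (pairingConverges_mFourier hT hr hb hb₀ hlim hD 0).smul 0
  | add x y _ _ hx hy => exact PairingConverges.add hr hb hb₀ hx hy
  | smul c x _ hx => exact PairingConverges.smul hx c

/-- Spatial averages of `b n` converge strongly in time to those of `b₀`. -/
theorem tendsto_eLpNorm_spatialAverage (hT : 0 < T) (hr : 1 ≤ r)
    (hb : ∀ n, Integrable (b n) (spaceTime T)) (hb₀ : Integrable b₀ (spaceTime T))
    (hlim : ∀ g : ℝ × T3 → ℝ, Continuous g →
      Tendsto (fun n => ∫ z, b n z * g z ∂spaceTime T) atTop (𝓝 (∫ z, b₀ z * g z ∂spaceTime T)))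
    {C : ℝ≥0} (hC : ∀ n, mixedNorm T r 1 (b n) ≤ C) (hC₀ : mixedNorm T r 1 b₀ ≤ C)
    {l : ℤ} {D : ℝ≥0} (hD : ∀ n, TimeDerivBound T r l (b n) D) {h : T3 → ℝ} (hh : Continuous h) :
    Tendsto (fun n => eLpNorm (fun t => (∫ x, b n (t, x) * h x) - ∫ x, b₀ (t, x) * h x) r
      (timeMeasure T)) atTop (𝓝 0) ∧
    ∀ δ : ℝ≥0∞, 0 < δ → ∃ c : ℝ → ℝ, Continuous c ∧
      eLpNorm (fun t => (∫ x, b₀ (t, x) * h x) - c t) r (timeMeasure T) ≤ δ := by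
  set H : C(T3, ℂ) := ⟨fun x => (h x : ℂ), by fun_prop⟩ with hH
  have hre : ∀ (f : ℝ × T3 → ℝ) t, spatialPairing f H t = ((∫ x, f (t, x) * h x : ℝ) : ℂ) := by
    intro f t
    rw [← integral_complex_ofReal]
    simp [spatialPairing, hH]
  obtain ⟨h1, h2⟩ := pairingConverges hT hr hb hb₀ hlim hC hC₀ hD H
  refine ⟨?_, fun δ hδ => ?_⟩
  · refine tendsto_of_tendsto_of_tendsto_of_le_of_le tendsto_const_nhds h1 (fun _ => zero_le)
      fun n => eLpNorm_mono fun t => ?_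
    rw [Pi.sub_apply, hre, hre, ← Complex.ofReal_sub, Complex.norm_real]
  · obtain ⟨c, hc, hcδ⟩ := h2 δ hδ
    refine ⟨fun t => (c t).re, by fun_prop, le_trans (eLpNorm_mono fun t => ?_) hcδ⟩
    rw [Pi.sub_apply, hre]
    refine le_trans (le_of_eq ?_) (Complex.abs_re_le_norm _)
    simp

end SpatialAverages

/-- Interchange of limits: the convergent approximations may depend on ε, but must be uniform in n.
-/
lemma tendsto_of_approx {x : ℕ → ℝ} {x₀ : ℝ}
    (h : ∀ ε : ℝ≥0∞, 0 < ε → ∃ (y : ℕ → ℝ) (y₀ : ℝ), Tendsto y atTop (𝓝 y₀) ∧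
      (∀ n, ‖x n - y n‖ₑ ≤ ε) ∧ ‖x₀ - y₀‖ₑ ≤ ε) : Tendsto x atTop (𝓝 x₀) := by
  refine EMetric.tendsto_nhds.2 fun ε hε => ?_
  obtain ⟨ε', hε', hlt⟩ := exists_between hε
  have h3 : 0 < ε' / 3 := ENNReal.div_pos hε'.ne' (by simp)
  obtain ⟨y, y₀, hy, h1, h2⟩ := h _ h3
  filter_upwards [EMetric.tendsto_nhds.1 hy _ h3] with n hn
  refine lt_of_le_of_lt ?_ hlt
  rw [← ENNReal.add_thirds ε']
  refine (edist_triangle4 (x n) (y n) y₀ x₀).trans (add_le_add (add_le_add ?_ hn.le) ?_)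
  · rw [edist_eq_enorm_sub]; exact h1 n
  · rw [edist_comm, edist_eq_enorm_sub]; exact h2

lemma exists_pos_mul_le {ε : ℝ≥0∞} (hε : 0 < ε) {K : ℝ≥0∞} (hK : K ≠ ⊤) :
    ∃ δ : ℝ≥0∞, 0 < δ ∧ δ ≠ ⊤ ∧ K * δ ≤ ε := by
  rcases eq_or_ne ε ⊤ with rfl | hεt
  · exact ⟨1, one_pos, by simp, le_top⟩
  · refine ⟨ε / (K + 1), ENNReal.div_pos hε.ne' (by simp [hK]),
      (ENNReal.div_lt_top hεt (by simp)).ne, ?_⟩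
    calc K * (ε / (K + 1)) ≤ (K + 1) * (ε / (K + 1)) := by gcongr; exact le_self_add
      _ ≤ ε := ENNReal.mul_div_le

/-! ### Weak times strong convergence on the time interval. -/

section TimeProducts

variable {T : ℝ} {q q' : ℝ≥0∞}

lemma lintegral_enorm_mul_le_eLpNorm [q.HolderConjugate q'] {f g : ℝ → ℝ}
    (hf : AEStronglyMeasurable f (timeMeasure T)) (hg : AEStronglyMeasurable g (timeMeasure T)) :
    ∫⁻ t, ‖f t * g t‖ₑ ∂timeMeasure T
      ≤ eLpNorm f q (timeMeasure T) * eLpNorm g q' (timeMeasure T) := by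
  have := lintegral_mul_le_eLpNorm_mul_eLpNorm (q := q) (q' := q') hf.enorm hg.enorm
  simpa only [enorm_mul, eLpNorm_enorm] using this

lemma integrable_mul_of_memLp [q.HolderConjugate q'] {f g : ℝ → ℝ}
    (hf : MemLp f q (timeMeasure T)) (hg : MemLp g q' (timeMeasure T)) :
    Integrable (fun t => f t * g t) (timeMeasure T) :=
  ⟨hf.1.mul hg.1, (lintegral_enorm_mul_le_eLpNorm (q := q) (q' := q') hf.1 hg.1).trans_lt
    (ENNReal.mul_lt_top hf.2 hg.2)⟩

lemma enorm_integral_mul_le_eLpNorm [q.HolderConjugate q'] {f g : ℝ → ℝ}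
    (hf : AEStronglyMeasurable f (timeMeasure T)) (hg : AEStronglyMeasurable g (timeMeasure T)) :
    ‖∫ t, f t * g t ∂timeMeasure T‖ₑ
      ≤ eLpNorm f q (timeMeasure T) * eLpNorm g q' (timeMeasure T) :=
  (enorm_integral_le_lintegral_enorm _).trans (lintegral_enorm_mul_le_eLpNorm hf hg)

lemma memLp_of_continuous {c : ℝ → ℝ} (hc : Continuous c) (r : ℝ≥0∞) :
    MemLp c r (timeMeasure T) := by
  obtain ⟨K, hK⟩ := (isCompact_Icc (a := 0) (b := T)).exists_bound_of_continuousOn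
    hc.continuousOn
  exact MemLp.of_bound hc.aestronglyMeasurable K ((ae_restrict_mem measurableSet_Icc).mono hK)

/-- The product of a weakly and a strongly convergent sequence of functions of time. -/
lemma tendsto_integral_mul_of_weak_of_strong [q.HolderConjugate q'] {A B : ℕ → ℝ → ℝ}
    {A₀ B₀ : ℝ → ℝ} {C : ℝ≥0} (hA : ∀ n, AEStronglyMeasurable (A n) (timeMeasure T))
    (hAC : ∀ n, eLpNorm (A n) q (timeMeasure T) ≤ C)
    (hA₀ : AEStronglyMeasurable A₀ (timeMeasure T)) (hA₀C : eLpNorm A₀ q (timeMeasure T) ≤ C)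
    (hB : ∀ n, MemLp (B n) q' (timeMeasure T)) (hB₀ : MemLp B₀ q' (timeMeasure T))
    (hweak : ∀ c : ℝ → ℝ, Continuous c → Tendsto (fun n => ∫ t, A n t * c t ∂timeMeasure T) atTop
      (𝓝 (∫ t, A₀ t * c t ∂timeMeasure T)))
    (hstrong : Tendsto (fun n => eLpNorm (fun t => B n t - B₀ t) q' (timeMeasure T)) atTop (𝓝 0))
    (happrox : ∀ δ : ℝ≥0∞, 0 < δ → ∃ c : ℝ → ℝ, Continuous c ∧
      eLpNorm (fun t => B₀ t - c t) q' (timeMeasure T) ≤ δ) :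
    Tendsto (fun n => ∫ t, A n t * B n t ∂timeMeasure T) atTop
      (𝓝 (∫ t, A₀ t * B₀ t ∂timeMeasure T)) := by
  have hAm : ∀ n, MemLp (A n) q (timeMeasure T) := fun n =>
    ⟨hA n, (hAC n).trans_lt ENNReal.coe_lt_top⟩
  have hA₀m : MemLp A₀ q (timeMeasure T) := ⟨hA₀, hA₀C.trans_lt ENNReal.coe_lt_top⟩
  refine tendsto_of_approx fun ε hε => ?_
  obtain ⟨δ, hδ, -, hδε⟩ := exists_pos_mul_le hε (ENNReal.coe_ne_top (r := C))
  obtain ⟨c, hc, hcδ⟩ := happrox δ hδ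
  have hcm := memLp_of_continuous (T := T) hc q'
  -- Decompose A_n B_n = A_n c + A_n (B_n - B₀) + A_n (B₀ - c). The first term converges weakly, the
  -- second tends to 0, and the third is the uniform error. The continuous c is needed because B₀
  -- itself may not be an admissible test function.
  refine ⟨fun n => ∫ t, A n t * c t ∂timeMeasure T
    + ∫ t, A n t * (B n t - B₀ t) ∂timeMeasure T, ∫ t, A₀ t * c t ∂timeMeasure T, ?_,
    fun n => ?_, ?_⟩
  · have h0 : Tendsto (fun n => ∫ t, A n t * (B n t - B₀ t) ∂timeMeasure T) atTop (𝓝 0) := by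
      rw [tendsto_zero_iff_enorm_tendsto_zero]
      refine tendsto_of_tendsto_of_tendsto_of_le_of_le tendsto_const_nhds
        (h := fun n => C * eLpNorm (fun t => B n t - B₀ t) q' (timeMeasure T)) ?_
        (fun _ => zero_le) fun n => ?_
      · simpa using ENNReal.Tendsto.const_mul hstrong (Or.inr (ENNReal.coe_ne_top (r := C)))
      · refine (enorm_integral_mul_le_eLpNorm (q := q) (q' := q') (hA n)
          ((hB n).sub hB₀).1).trans ?_
        exact mul_le_mul' (hAC n) le_rfl
    simpa using (hweak c hc).add h0
  · have e : (∫ t, A n t * B n t ∂timeMeasure T) - (∫ t, A n t * c t ∂timeMeasure T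
        + ∫ t, A n t * (B n t - B₀ t) ∂timeMeasure T)
        = ∫ t, A n t * (B₀ t - c t) ∂timeMeasure T := by
      have i1 := integrable_mul_of_memLp (q := q) (q' := q') (hAm n) (hB n)
      have i2 := integrable_mul_of_memLp (q := q) (q' := q') (hAm n) hcm
      have i3 := integrable_mul_of_memLp (q := q) (q' := q') (hAm n) hB₀
      simp_rw [mul_sub]
      rw [integral_sub i1 i3, integral_sub i3 i2]
      ring
    rw [e]
    refine (enorm_integral_mul_le_eLpNorm (q := q) (q' := q') (hA n) (hB₀.sub hcm).1).trans
      (le_trans ?_ hδε)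
    exact mul_le_mul' (hAC n) hcδ
  · have e : (∫ t, A₀ t * B₀ t ∂timeMeasure T) - ∫ t, A₀ t * c t ∂timeMeasure T
        = ∫ t, A₀ t * (B₀ t - c t) ∂timeMeasure T := by
      have i2 := integrable_mul_of_memLp (q := q) (q' := q') hA₀m hcm
      have i3 := integrable_mul_of_memLp (q := q) (q' := q') hA₀m hB₀
      simp_rw [mul_sub]
      rw [integral_sub i3 i2]
    rw [e]
    refine (enorm_integral_mul_le_eLpNorm (q := q) (q' := q') hA₀ (hB₀.sub hcm).1).trans
      (le_trans ?_ hδε)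
    exact mul_le_mul' hA₀C hcδ

end TimeProducts

/-! ### Fubini identities for spatial averages. -/

section Averages

variable {T : ℝ} {r : ℝ≥0∞}

/-- The spatial average of `b` weighted by `h`, as a function of time. -/
def spatialAverage (b : ℝ × T3 → ℝ) (h : T3 → ℝ) (t : ℝ) : ℝ := ∫ x, b (t, x) * h x

lemma aestronglyMeasurable_spatialAverage {b : ℝ × T3 → ℝ}
    (hb : AEStronglyMeasurable b (spaceTime T)) {h : T3 → ℝ} (hh : Continuous h) :
    AEStronglyMeasurable (spatialAverage b h) (timeMeasure T) := by
  have h1 : AEStronglyMeasurable (fun z : ℝ × T3 => b z * h z.2) ((timeMeasure T).prod volume) :=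
    AEStronglyMeasurable.mul hb (hh.comp continuous_snd).aestronglyMeasurable
  exact h1.integral_prod_right'

lemma eLpNorm_spatialAverage_le {b : ℝ × T3 → ℝ} (hb : AEStronglyMeasurable b (spaceTime T))
    {h : T3 → ℝ} {K : ℝ≥0} (hK : ∀ x, ‖h x‖ₑ ≤ K) :
    eLpNorm (spatialAverage b h) r (timeMeasure T) ≤ K * mixedNorm T r 1 b := by
  have hm : AEMeasurable (fun t => eLpNorm (fun x => b (t, x)) 1 (volume : Measure T3))
      (timeMeasure T) := by
    simpa only [eLpNorm_enorm] using aemeasurable_eLpNorm_slice (ν := (volume : Measure T3))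
      (F := fun z => ‖b z‖ₑ) hb.enorm 1
  refine eLpNorm_le_mul_eLpNorm_of_ae_le_mul'' r hm.aestronglyMeasurable
    (Eventually.of_forall fun t => ?_)
  rw [enorm_eq_self, eLpNorm_one_eq_lintegral_enorm]
  refine (enorm_integral_le_lintegral_enorm _).trans ?_
  rw [← lintegral_const_mul' _ _ ENNReal.coe_ne_top]
  refine lintegral_mono fun x => ?_
  rw [enorm_mul, mul_comm]
  gcongr
  exact hK x

lemma exists_ae_enorm_le_of_continuous {g : ℝ × T3 → ℝ} (hg : Continuous g) :
    ∃ K : ℝ≥0, ∀ᵐ z ∂spaceTime T, ‖g z‖ₑ ≤ K := by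
  obtain ⟨K, hK⟩ := (isCompact_Icc.prod isCompact_univ :
    IsCompact (Set.Icc (0 : ℝ) T ×ˢ (Set.univ : Set T3))).exists_bound_of_continuousOn
    hg.continuousOn
  have h1 : ∀ᵐ z ∂spaceTime T, z.1 ∈ Set.Icc 0 T :=
    Measure.quasiMeasurePreserving_fst.ae (ae_restrict_mem measurableSet_Icc)
  refine ⟨K.toNNReal, h1.mono fun z hz => ?_⟩
  rw [← ofReal_norm]
  exact ENNReal.ofReal_le_ofReal (hK _ ⟨hz, Set.mem_univ _⟩)

lemma integrable_mul_of_continuous {f g : ℝ × T3 → ℝ} (hf : Integrable f (spaceTime T))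
    (hg : Continuous g) : Integrable (fun z => f z * g z) (spaceTime T) := by
  obtain ⟨K, hK⟩ := exists_ae_enorm_le_of_continuous (T := T) hg
  refine hf.mul_bdd (c := K) hg.aestronglyMeasurable (hK.mono fun z hz => ?_)
  simpa [← ofReal_norm, ENNReal.ofReal_le_iff_le_toReal] using hz

lemma integral_mul_spatialAverage {b : ℝ × T3 → ℝ} (hb : Integrable b (spaceTime T))
    {α : ℝ → ℝ} (hα : Continuous α) {h : T3 → ℝ} (hh : Continuous h) :
    ∫ t, α t * spatialAverage b h t ∂timeMeasure T
      = ∫ z, b z * (α z.1 * h z.2) ∂spaceTime T := by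
  have hi := integrable_mul_of_continuous hb (g := fun z => α z.1 * h z.2) (by fun_prop)
  rw [spaceTime, integral_prod _ hi]
  refine integral_congr_ae (Eventually.of_forall fun t => ?_)
  simp only [spatialAverage, ← integral_const_mul]
  congr 1; ext x; ring

/-- A function of separated variables times an element of `L^{q'}(L^1)`. -/
lemma integrable_separated_mul {q q' : ℝ≥0∞} [q.HolderConjugate q'] {A : ℝ → ℝ}
    (hA : MemLp A q (timeMeasure T)) {φ : T3 → ℝ} (hφ : Continuous φ) {b : ℝ × T3 → ℝ}
    (hb : MemLqLp T q' 1 b) :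
    Integrable (fun z => φ z.2 * A z.1 * b z) (spaceTime T) := by
  obtain ⟨K, hK⟩ := exists_enorm_le_of_continuous hφ
  refine integrable_mul_of_mixed (q := q) (q' := q') (p := ⊤) (p' := 1)
    (f := fun z => φ z.2 * A z.1) ⟨?_, ?_⟩ hb
  · exact (hφ.comp continuous_snd).aestronglyMeasurable.mul
      (AEStronglyMeasurable.comp_fst (ν := (volume : Measure T3)) hA.1)
  · refine lt_of_le_of_lt ?_ (ENNReal.mul_lt_top (ENNReal.coe_lt_top (r := K)) hA.2)
    refine eLpNorm_le_mul_eLpNorm_of_ae_le_mul'' q hA.1 (Eventually.of_forall fun t => ?_)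
    rw [enorm_eq_self, eLpNorm_exponent_top]
    refine eLpNormEssSup_le_of_ae_enorm_bound (Eventually.of_forall fun x => ?_)
    rw [enorm_mul]
    gcongr
    exact hK x

lemma integral_separated_mul {q q' : ℝ≥0∞} [q.HolderConjugate q'] {A : ℝ → ℝ}
    (hA : MemLp A q (timeMeasure T)) {φ : T3 → ℝ} (hφ : Continuous φ) {b : ℝ × T3 → ℝ}
    (hb : MemLqLp T q' 1 b) {α : ℝ → ℝ} (hα : Continuous α) {h : T3 → ℝ} (hh : Continuous h) :
    ∫ z, φ z.2 * A z.1 * b z * (α z.1 * h z.2) ∂spaceTime T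
      = ∫ t, α t * A t * spatialAverage b (fun x => φ x * h x) t ∂timeMeasure T := by
  have hi := integrable_mul_of_continuous (integrable_separated_mul (q := q) (q' := q') hA hφ hb)
    (g := fun z => α z.1 * h z.2) (by fun_prop)
  rw [spaceTime, integral_prod _ hi]
  refine integral_congr_ae (Eventually.of_forall fun t => ?_)
  simp only [spatialAverage, ← integral_const_mul]
  congr 1; ext x; ring

end Averages

/-! ### Sobolev estimates in mixed norms. -/

section MixedSobolev

variable {T : ℝ} {q : ℝ≥0∞} {p s : ℝ}

lemma eLpNorm_sum_slices_le (hq : 1 ≤ q) {P : ℝ≥0∞} {v : Fin 3 → ℝ × T3 → ℝ}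
    (hv : ∀ i, AEStronglyMeasurable (v i) (spaceTime T)) :
    AEStronglyMeasurable (fun t => ∑ i, eLpNorm (fun x => v i (t, x)) P volume) (timeMeasure T) ∧
    eLpNorm (fun t => ∑ i, eLpNorm (fun x => v i (t, x)) P volume) q (timeMeasure T)
      ≤ ∑ i, mixedNorm T q P (v i) := by
  have hm : ∀ i, AEStronglyMeasurable (fun t => eLpNorm (fun x => v i (t, x)) P volume)
      (timeMeasure T) := fun i => by
    have := aemeasurable_eLpNorm_slice (ν := (volume : Measure T3)) (F := fun z => ‖v i z‖ₑ)
      (hv i).enorm P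
    simp only [eLpNorm_enorm] at this
    exact this.aestronglyMeasurable
  have e : (fun t => ∑ i, eLpNorm (fun x => v i (t, x)) P volume)
      = ∑ i, fun t => eLpNorm (fun x => v i (t, x)) P (volume : Measure T3) := by
    ext t; simp
  rw [e]
  exact ⟨Finset.aestronglyMeasurable_sum _ fun i _ => hm i, eLpNorm_sum_le (fun i _ => hm i) hq⟩

lemma ae_slices (hq : 1 ≤ q) (hp : 1 ≤ p) {a : ℝ × T3 → ℝ} {Da : Fin 3 → ℝ × T3 → ℝ}
    (ha : MemLqW1p T q (ENNReal.ofReal p) a Da) :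
    ∀ᵐ t ∂timeMeasure T, Integrable (fun x => a (t, x)) volume ∧
      (∀ i, AEStronglyMeasurable (fun x => Da i (t, x)) volume) ∧
      ∀ i, HasWeakPartial i (fun x => a (t, x)) (fun x => Da i (t, x)) := by
  have hP : 1 ≤ ENNReal.ofReal p := by simpa using ENNReal.ofReal_le_ofReal hp
  have h1 := ae_integrable_slice (integrable_of_mixedNorm hq hP ha.1)
  have h2 : ∀ᵐ t ∂timeMeasure T, ∀ i, AEStronglyMeasurable (fun x => Da i (t, x)) volume :=
    ae_all_iff.2 fun i => AEStronglyMeasurable.prodMk_left (μ := timeMeasure T)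
      (ν := (volume : Measure T3)) (ha.2.1 i).1
  filter_upwards [h1, h2, ha.2.2] with t h1 h2 h3
  exact ⟨h1, h2, h3⟩

/-- The error of the approximation of `a` by its convolution with the kernel. -/
lemma mixedNorm_sub_separated_le (hq : 1 ≤ q) (hp : 1 ≤ p) (hps : p ≤ s) {a : ℝ × T3 → ℝ}
    {Da : Fin 3 → ℝ × T3 → ℝ} (ha : MemLqW1p T q (ENNReal.ofReal p) a Da) {N m : ℕ}
    {φ ψ : Fin m → T3 → ℝ} (hψ : ∀ j, Continuous (ψ j))
    (hK : ∀ x y, torusKernel N (x - y) = ∑ j, φ j x * ψ j y) :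
    mixedNorm T q (ENNReal.ofReal s)
        (fun z => a z - ∑ j, φ j z.2 * spatialAverage a (ψ j) z.1)
      ≤ (∑' n, sobolevRate p s (n + N)) * ∑ i, mixedNorm T q (ENNReal.ofReal p) (Da i) := by
  obtain ⟨hm, hle⟩ := eLpNorm_sum_slices_le (P := ENNReal.ofReal p) hq fun i => (ha.2.1 i).1
  refine le_trans (eLpNorm_le_mul_eLpNorm_of_ae_le_mul'' q hm ?_) (mul_le_mul_right hle _)
  filter_upwards [ae_slices hq hp ha] with t ⟨h1, h2, h3⟩
  simp only [enorm_eq_self]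
  refine le_trans (le_of_eq ?_) (eLpNorm_torusConv_sub_le hp hps h1 h2 h3 N)
  congr 1
  ext x
  congr 1
  simp only [torusConv, hK, spatialAverage, Finset.mul_sum]
  rw [integral_finsetSum _ fun j _ => ?_]
  · refine Finset.sum_congr rfl fun j _ => ?_
    rw [← integral_const_mul]
    congr 1; ext y; ring
  · have := (integrable_mul_continuous h1 (hψ j)).const_mul (φ j x)
    refine this.congr (Eventually.of_forall fun y => ?_)
    simp only; ring

/-- The Sobolev embedding for `L^q(W^{1,p})`. -/
lemma exists_mixedNorm_le_sobolev (hq : 1 ≤ q) (hp : 1 ≤ p) (hps : p ≤ s)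
    (h : 1 / p - 1 / 3 < 1 / s) :
    ∃ K : ℝ≥0, ∀ (a : ℝ × T3 → ℝ) (Da : Fin 3 → ℝ × T3 → ℝ),
      MemLqW1p T q (ENNReal.ofReal p) a Da → mixedNorm T q (ENNReal.ofReal s) a
        ≤ K * (mixedNorm T q (ENNReal.ofReal p) a
          + ∑ i, mixedNorm T q (ENNReal.ofReal p) (Da i)) := by
  have hp0 : 0 < p := by linarith
  have hs0 : 0 < s := by linarith
  have hs1 : 1 ≤ ENNReal.ofReal s := by
    simpa using ENNReal.ofReal_le_ofReal (hp.trans hps)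
  obtain ⟨B, hB⟩ := exists_enorm_le_of_continuous (continuous_torusKernel 0)
  have hB' : (B : ℝ≥0∞) ^ (1 / p - 1 / s) ≠ ⊤ := ENNReal.rpow_ne_top_of_nonneg
    (sub_nonneg.2 (one_div_le_one_div_of_le hp0 hps)) ENNReal.coe_ne_top
  have hsum := tsum_sobolevRate_ne_top hp hps h
  set R : ℝ≥0∞ := (∑' n, sobolevRate p s n) + (B : ℝ≥0∞) ^ (1 / p - 1 / s) with hR
  have hRt : R ≠ ⊤ := ENNReal.add_ne_top.2 ⟨hsum, hB'⟩
  refine ⟨R.toNNReal, fun a Da ha => ?_⟩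
  rw [ENNReal.coe_toNNReal hRt]
  obtain ⟨hm, hle⟩ := eLpNorm_sum_slices_le (P := ENNReal.ofReal p) hq fun i => (ha.2.1 i).1
  have hma : AEStronglyMeasurable (fun t => eLpNorm (fun x => a (t, x)) (ENNReal.ofReal p) volume)
      (timeMeasure T) := by
    have := aemeasurable_eLpNorm_slice (ν := (volume : Measure T3)) (F := fun z => ‖a z‖ₑ)
      ha.1.1.enorm (ENNReal.ofReal p)
    simp only [eLpNorm_enorm] at this
    exact this.aestronglyMeasurable
  refine le_trans (eLpNorm_le_mul_eLpNorm_of_ae_le_mul'' q (hma.add hm) ?_)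
    (mul_le_mul_right ((eLpNorm_add_le hma hm hq).trans (add_le_add le_rfl hle)) _)
  filter_upwards [ae_slices hq hp ha] with t ⟨h1, h2, h3⟩
  simp only [enorm_eq_self, Pi.add_apply]
  have hc := aestronglyMeasurable_torusConv h1.1 (continuous_torusKernel 0)
  -- The kernel of index 0 is the constant 1, so this splits the slice into its mean and its
  -- oscillation; the gradient controls the latter.
  have e : (fun x => a (t, x)) = (fun x => a (t, x)
      - torusConv (fun x => a (t, x)) (torusKernel 0) x)
      + torusConv (fun x => a (t, x)) (torusKernel 0) := by ext x; simp
  have k1 := eLpNorm_torusConv_sub_le hp hps h1 h2 h3 0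
  have k2 := eLpNorm_torusConv_le hp hps h1.1 (continuous_torusKernel 0)
    (lintegral_enorm_torusKernel 0).le hB
  rw [ENNReal.one_rpow, one_mul] at k2
  calc eLpNorm (fun x => a (t, x)) (ENNReal.ofReal s) volume
      ≤ _ := by
        conv_lhs => rw [e]
        exact eLpNorm_add_le (h1.1.sub hc) hc hs1
    _ ≤ _ := add_le_add k1 k2
    _ ≤ R * (∑ i, eLpNorm (fun x => Da i (t, x)) (ENNReal.ofReal p) volume)
        + R * eLpNorm (fun x => a (t, x)) (ENNReal.ofReal p) volume := by
        gcongr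
        · exact le_self_add
        · exact le_add_self
    _ = _ := by rw [← mul_add, add_comm]

end MixedSobolev

/-! ### Limits of the products. -/

section Products

variable {T : ℝ} {q q' S S' : ℝ≥0∞} {p s : ℝ}

lemma MemLqLp.mono_exponent {P P' : ℝ≥0∞} {f : ℝ × T3 → ℝ} (hf : MemLqLp T q P' f) (h : P ≤ P') :
    MemLqLp T q P f :=
  ⟨hf.1, (mixedNorm_mono_exponent rfl h hf.1).trans_lt hf.2⟩

lemma memLp_spatialAverage {P : ℝ≥0∞} (hP : 1 ≤ P) {b : ℝ × T3 → ℝ} (hb : MemLqLp T q P b)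
    {h : T3 → ℝ} (hh : Continuous h) : MemLp (spatialAverage b h) q (timeMeasure T) := by
  obtain ⟨K, hK⟩ := exists_enorm_le_of_continuous hh
  exact ⟨aestronglyMeasurable_spatialAverage hb.1 hh, (eLpNorm_spatialAverage_le hb.1 hK).trans_lt
    (ENNReal.mul_lt_top ENNReal.coe_lt_top (hb.mono_exponent hP).2)⟩

/-- Replacing `a` by a separated approximation in the integral of `a * b * (α ⊗ h)`. -/
lemma enorm_integral_sub_sum_le [q.HolderConjugate q'] [S.HolderConjugate S']
    {a b : ℝ × T3 → ℝ} {P : ℝ≥0∞} (hP : 1 ≤ P) (ha : MemLqLp T q P a) (hb : MemLqLp T q' S' b)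
    (hab : Integrable (fun z => a z * b z) (spaceTime T)) {m : ℕ} {φ ψ : Fin m → T3 → ℝ}
    (hφ : ∀ j, Continuous (φ j)) (hψ : ∀ j, Continuous (ψ j)) {α : ℝ → ℝ} (hα : Continuous α)
    {h : T3 → ℝ} (hh : Continuous h) {K : ℝ≥0}
    (hK : ∀ᵐ z ∂spaceTime T, ‖α z.1 * h z.2‖ₑ ≤ K) :
    ‖(∫ z, a z * b z * (α z.1 * h z.2) ∂spaceTime T) - ∑ j, ∫ t, α t * spatialAverage a (ψ j) t
        * spatialAverage b (fun x => φ j x * h x) t ∂timeMeasure T‖ₑ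
      ≤ K * (mixedNorm T q S (fun z => a z - ∑ j, φ j z.2 * spatialAverage a (ψ j) z.1)
          * mixedNorm T q' S' b) := by
  have hb1 : MemLqLp T q' 1 b := hb.mono_exponent (ENNReal.HolderConjugate.one_le S' S)
  have hA := fun j => memLp_spatialAverage hP ha (hψ j)
  have hi := fun j => integrable_mul_of_continuous
    (integrable_separated_mul (q := q) (q' := q') (hA j) (hφ j) hb1)
    (g := fun z => α z.1 * h z.2) (by fun_prop)
  have hi0 := integrable_mul_of_continuous hab (g := fun z => α z.1 * h z.2) (by fun_prop)
  simp_rw [← integral_separated_mul (q := q) (q' := q') (hA _) (hφ _) hb1 hα hh]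
  rw [← integral_finsetSum _ fun j _ => hi j, ← integral_sub hi0 (integrable_finsetSum _ fun j _ => hi j)]
  set R : ℝ × T3 → ℝ := fun z => a z - ∑ j, φ j z.2 * spatialAverage a (ψ j) z.1 with hR
  have hRm : AEStronglyMeasurable R (spaceTime T) := by
    refine ha.1.sub ?_
    have : AEStronglyMeasurable (∑ j, fun z : ℝ × T3 => φ j z.2 * spatialAverage a (ψ j) z.1)
        (spaceTime T) := Finset.aestronglyMeasurable_sum _ fun j _ =>
      ((hφ j).comp continuous_snd).aestronglyMeasurable.mul
        (AEStronglyMeasurable.comp_fst (ν := (volume : Measure T3)) (hA j).1)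
    refine this.congr (Eventually.of_forall fun z => by simp)
  refine (enorm_integral_le_lintegral_enorm _).trans ?_
  calc _ ≤ ∫⁻ z, K * ‖R z * b z‖ₑ ∂spaceTime T := by
        refine lintegral_mono_ae (hK.mono fun z hz => ?_)
        have e : a z * b z * (α z.1 * h z.2)
            - ∑ j, φ j z.2 * spatialAverage a (ψ j) z.1 * b z * (α z.1 * h z.2)
            = (α z.1 * h z.2) * (R z * b z) := by
          rw [hR, ← Finset.sum_mul, ← Finset.sum_mul]; ring
        rw [e, enorm_mul]
        gcongr
    _ = K * ∫⁻ z, ‖R z * b z‖ₑ ∂spaceTime T := lintegral_const_mul' _ _ ENNReal.coe_ne_top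
    _ ≤ _ := by
        gcongr
        exact lintegral_enorm_mul_le hRm hb.1

variable {a b : ℕ → ℝ × T3 → ℝ} {Da : ℕ → Fin 3 → ℝ × T3 → ℝ} {a₀ b₀ : ℝ × T3 → ℝ}
  {Da₀ : Fin 3 → ℝ × T3 → ℝ}

/-- Convergence of the products tested with functions of separated variables. -/
lemma tendsto_integral_mul_separated (hT : 0 < T) [q.HolderConjugate q']
    [(ENNReal.ofReal s).HolderConjugate S'] (hp : 1 ≤ p) (hps : p ≤ s)
    (h : 1 / p - 1 / 3 < 1 / s)
    (ha : ∀ n, MemLqW1p T q (ENNReal.ofReal p) (a n) (Da n))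
    (ha₀ : MemLqW1p T q (ENNReal.ofReal p) a₀ Da₀)
    (hb : ∀ n, MemLqLp T q' S' (b n)) (hb₀ : MemLqLp T q' S' b₀)
    {C : ℝ≥0} (haC : ∀ n, mixedNorm T q (ENNReal.ofReal p) (a n) ≤ C)
    (haC₀ : mixedNorm T q (ENNReal.ofReal p) a₀ ≤ C)
    (hDC : ∀ n, ∑ i, mixedNorm T q (ENNReal.ofReal p) (Da n i) ≤ C)
    (hDC₀ : ∑ i, mixedNorm T q (ENNReal.ofReal p) (Da₀ i) ≤ C)
    (hbC : ∀ n, mixedNorm T q' S' (b n) ≤ C) (hbC₀ : mixedNorm T q' S' b₀ ≤ C)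
    (hab : ∀ n, Integrable (fun z => a n z * b n z) (spaceTime T))
    (hab₀ : Integrable (fun z => a₀ z * b₀ z) (spaceTime T))
    (halim : ∀ g : ℝ × T3 → ℝ, Continuous g →
      Tendsto (fun n => ∫ z, a n z * g z ∂spaceTime T) atTop (𝓝 (∫ z, a₀ z * g z ∂spaceTime T)))
    (hblim : ∀ g : ℝ × T3 → ℝ, Continuous g →
      Tendsto (fun n => ∫ z, b n z * g z ∂spaceTime T) atTop (𝓝 (∫ z, b₀ z * g z ∂spaceTime T)))
    {l : ℤ} {D : ℝ≥0} (hD : ∀ n, TimeDerivBound T q' l (b n) D)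
    {α : ℝ → ℝ} (hα : Continuous α) {g : T3 → ℝ} (hg : Continuous g) :
    Tendsto (fun n => ∫ z, a n z * b n z * (α z.1 * g z.2) ∂spaceTime T) atTop
      (𝓝 (∫ z, a₀ z * b₀ z * (α z.1 * g z.2) ∂spaceTime T)) := by
  have hq : 1 ≤ q := ENNReal.HolderConjugate.one_le q q'
  have hq' : 1 ≤ q' := ENNReal.HolderConjugate.one_le q' q
  have hS' : 1 ≤ S' := ENNReal.HolderConjugate.one_le S' (ENNReal.ofReal s)
  have hP : 1 ≤ ENNReal.ofReal p := by simpa using ENNReal.ofReal_le_ofReal hp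
  obtain ⟨K, hK⟩ := exists_ae_enorm_le_of_continuous (T := T) (g := fun z => α z.1 * g z.2)
    (by fun_prop)
  obtain ⟨Kα, hKα⟩ : ∃ Kα : ℝ≥0, ∀ᵐ t ∂timeMeasure T, ‖α t‖ₑ ≤ Kα := by
    obtain ⟨M, hM⟩ := (isCompact_Icc (a := 0) (b := T)).exists_bound_of_continuousOn
      hα.continuousOn
    refine ⟨M.toNNReal, (ae_restrict_mem measurableSet_Icc).mono fun t ht => ?_⟩
    rw [← ofReal_norm]
    exact ENNReal.ofReal_le_ofReal (hM t ht)
  refine tendsto_of_approx fun ε hε => ?_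
  -- The smoothing error is at most K · (δ C) · C: the test function, the tail of rates times the
  -- gradient bound, and the norm of b.
  obtain ⟨δ, hδ, -, hδε⟩ := exists_pos_mul_le hε (K := K * (C * C))
    (ENNReal.mul_ne_top ENNReal.coe_ne_top (ENNReal.mul_ne_top ENNReal.coe_ne_top
      ENNReal.coe_ne_top))
  have htail : Tendsto (fun N => ∑' n, sobolevRate p s (n + N)) atTop (𝓝 0) :=
    ENNReal.tendsto_sum_nat_add _ (tsum_sobolevRate_ne_top hp hps h)
  obtain ⟨N, hN⟩ := (htail.eventually (gt_mem_nhds hδ)).exists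
  obtain ⟨m, φ, ψ, hφ, hψ, hker⟩ := isSeparable_torusKernel N
  -- Stated for an arbitrary pair so that one smoothing index N serves all members of the sequence
  -- and the limit.
  have hrem : ∀ (f : ℝ × T3 → ℝ) (Df : Fin 3 → ℝ × T3 → ℝ) (k : ℝ × T3 → ℝ),
      MemLqW1p T q (ENNReal.ofReal p) f Df → ∑ i, mixedNorm T q (ENNReal.ofReal p) (Df i) ≤ C →
      MemLqLp T q' S' k → mixedNorm T q' S' k ≤ C →
      Integrable (fun z => f z * k z) (spaceTime T) →
      ‖(∫ z, f z * k z * (α z.1 * g z.2) ∂spaceTime T) - ∑ j, ∫ t, α t * spatialAverage f (ψ j) t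
        * spatialAverage k (fun x => φ j x * g x) t ∂timeMeasure T‖ₑ ≤ ε := by
    intro f Df k hf hDf hk hkC hfk
    refine (enorm_integral_sub_sum_le (q := q) (q' := q') (S := ENNReal.ofReal s) (S' := S') hP
      hf.1 hk hfk hφ hψ hα hg hK).trans (le_trans ?_ hδε)
    calc _ ≤ K * (δ * C * C) := by
          gcongr
          refine (mixedNorm_sub_separated_le hq hp hps hf hψ hker).trans ?_
          gcongr
      _ = K * (C * C) * δ := by ring
  refine ⟨fun n => ∑ j, ∫ t, α t * spatialAverage (a n) (ψ j) t
        * spatialAverage (b n) (fun x => φ j x * g x) t ∂timeMeasure T,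
    ∑ j, ∫ t, α t * spatialAverage a₀ (ψ j) t
        * spatialAverage b₀ (fun x => φ j x * g x) t ∂timeMeasure T, ?_,
    fun n => hrem _ _ _ (ha n) (hDC n) (hb n) (hbC n) (hab n),
    hrem _ _ _ ha₀ hDC₀ hb₀ hbC₀ hab₀⟩
  refine tendsto_finsetSum _ fun j _ => ?_
  have hφg : Continuous fun x => φ j x * g x := (hφ j).mul hg
  have hai := fun n => integrable_of_mixedNorm hq hP (ha n).1
  have hai₀ := integrable_of_mixedNorm hq hP ha₀.1
  obtain ⟨Kψ, hKψ⟩ := exists_enorm_le_of_continuous (hψ j)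
  have hA : ∀ f : ℝ × T3 → ℝ, AEStronglyMeasurable f (spaceTime T) →
      mixedNorm T q (ENNReal.ofReal p) f ≤ C →
      eLpNorm (fun t => α t * spatialAverage f (ψ j) t) q (timeMeasure T)
        ≤ ((Kα * (Kψ * C) : ℝ≥0) : ℝ≥0∞) := by
    intro f hf hfC
    push_cast
    refine (eLpNorm_le_mul_eLpNorm_of_ae_le_mul'' (c := Kα) q
      (aestronglyMeasurable_spatialAverage hf (hψ j)) ?_).trans ?_
    · filter_upwards [hKα] with t ht
      rw [enorm_mul]; gcongr
    · gcongr
      refine (eLpNorm_spatialAverage_le hf hKψ).trans ?_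
      gcongr
      exact (mixedNorm_mono_exponent rfl hP hf).trans hfC
  obtain ⟨hstrong, happrox⟩ := tendsto_eLpNorm_spatialAverage hT hq'
    (fun n => integrable_of_mixedNorm hq' hS' (hb n)) (integrable_of_mixedNorm hq' hS' hb₀) hblim
    (C := C) (fun n => (mixedNorm_mono_exponent rfl hS' (hb n).1).trans (hbC n))
    ((mixedNorm_mono_exponent rfl hS' hb₀.1).trans hbC₀) hD hφg
  -- The time weight α goes with the averages of a, where weak convergence absorbs it into the test
  -- function; the space weight g goes with b.
  refine tendsto_integral_mul_of_weak_of_strong (q := q) (q' := q')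
    (A := fun n t => α t * spatialAverage (a n) (ψ j) t)
    (A₀ := fun t => α t * spatialAverage a₀ (ψ j) t)
    (fun n => hα.aestronglyMeasurable.mul
      (aestronglyMeasurable_spatialAverage (ha n).1.1 (hψ j)))
    (fun n => hA _ (ha n).1.1 (haC n)) (hα.aestronglyMeasurable.mul
      (aestronglyMeasurable_spatialAverage ha₀.1.1 (hψ j))) (hA _ ha₀.1.1 haC₀)
    (fun n => memLp_spatialAverage hS' (hb n) hφg) (memLp_spatialAverage hS' hb₀ hφg)
    (fun c hc => ?_) hstrong happrox
  have e : ∀ f : ℝ × T3 → ℝ, Integrable f (spaceTime T) →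
      ∫ t, α t * spatialAverage f (ψ j) t * c t ∂timeMeasure T
        = ∫ z, f z * (α z.1 * c z.1 * ψ j z.2) ∂spaceTime T := by
    intro f hf
    rw [← integral_mul_spatialAverage (α := fun t => α t * c t) hf (hα.mul hc) (hψ j)]
    congr 1; ext t; ring
  rw [e _ hai₀]
  simp_rw [fun n => e _ (hai n)]
  have := hψ j
  exact halim _ (by fun_prop)

/-- Sums of products of a function of time and a function of space are uniformly dense. -/
lemma exists_span_separated_near (θ : C(Set.Icc 0 T × T3, ℝ)) {ε : ℝ} (hε : 0 < ε) :
    ∃ f ∈ Submodule.span ℝ {f : C(Set.Icc 0 T × T3, ℝ) |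
      ∃ (α : C(Set.Icc 0 T, ℝ)) (g : C(T3, ℝ)), ∀ z, f z = α z.1 * g z.2}, ‖f - θ‖ < ε := by
  -- Separated functions are closed under products, so the algebra they generate is their linear
  -- span.
  let M : Submonoid C(Set.Icc 0 T × T3, ℝ) :=
    { carrier := {f | ∃ (α : C(Set.Icc 0 T, ℝ)) (g : C(T3, ℝ)), ∀ z, f z = α z.1 * g z.2}
      one_mem' := ⟨1, 1, fun z => by simp⟩
      mul_mem' := by
        rintro f f' ⟨α, g, h⟩ ⟨α', g', h'⟩
        exact ⟨α * α', g * g', fun z => by simp [h, h']; ring⟩ }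
  -- Points with different times are separated by the time coordinate, the others by the distance to
  -- one of the two space points.
  have hsep : (Algebra.adjoin ℝ (M : Set C(Set.Icc 0 T × T3, ℝ))).SeparatesPoints := by
    intro z w hzw
    by_cases h1 : z.1 = w.1
    · have h2 : z.2 ≠ w.2 := fun h2 => hzw (Prod.ext h1 h2)
      refine ⟨_, ⟨⟨fun y : Set.Icc 0 T × T3 => dist y.2 w.2, by fun_prop⟩,
        Algebra.subset_adjoin ⟨1, ⟨fun x => dist x w.2, by fun_prop⟩, fun y => by simp⟩, rfl⟩, ?_⟩
      simpa using h2
    · refine ⟨_, ⟨⟨fun y : Set.Icc 0 T × T3 => (y.1 : ℝ), by fun_prop⟩,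
        Algebra.subset_adjoin ⟨⟨fun t => (t : ℝ), by fun_prop⟩, 1, fun y => by simp⟩, rfl⟩, ?_⟩
      simpa [Subtype.ext_iff] using h1
  obtain ⟨f, hf⟩ := ContinuousMap.exists_mem_subalgebra_near_continuousMap_of_separatesPoints
    _ hsep θ ε hε
  refine ⟨f, ?_, hf⟩
  have h1 : (f : C(Set.Icc 0 T × T3, ℝ)) ∈
      Subalgebra.toSubmodule (Algebra.adjoin ℝ (M : Set C(Set.Icc 0 T × T3, ℝ))) := f.2
  rw [Algebra.adjoin_eq_span, Submonoid.closure_eq] at h1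
  exact h1

/-- Density of separated test functions, for sequences of functions bounded in `L^1`. -/
lemma tendsto_integral_mul_of_separated (hT : 0 ≤ T) {f : ℕ → ℝ × T3 → ℝ} {f₀ : ℝ × T3 → ℝ}
    (hf : ∀ n, Integrable (f n) (spaceTime T)) (hf₀ : Integrable f₀ (spaceTime T)) {C : ℝ≥0}
    (hC : ∀ n, ∫⁻ z, ‖f n z‖ₑ ∂spaceTime T ≤ C) (hC₀ : ∫⁻ z, ‖f₀ z‖ₑ ∂spaceTime T ≤ C)
    (hsep : ∀ (α : ℝ → ℝ) (g : T3 → ℝ), Continuous α → Continuous g →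
      Tendsto (fun n => ∫ z, f n z * (α z.1 * g z.2) ∂spaceTime T) atTop
        (𝓝 (∫ z, f₀ z * (α z.1 * g z.2) ∂spaceTime T)))
    {θ : ℝ × T3 → ℝ} (hθ : ContinuousOn θ (Set.Icc 0 T ×ˢ Set.univ)) :
    Tendsto (fun n => ∫ z, f n z * θ z ∂spaceTime T) atTop
      (𝓝 (∫ z, f₀ z * θ z ∂spaceTime T)) := by
  -- The test function is continuous only over [0, T], so the argument is moved to the compact space
  -- where Stone–Weierstrass applies.
  let π : ℝ × T3 → Set.Icc 0 T × T3 := fun z => (Set.projIcc 0 T hT z.1, z.2)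
  have hπ : Continuous π := by fun_prop
  let Θ : C(Set.Icc 0 T × T3, ℝ) := ⟨fun z => θ (z.1, z.2), by
    refine hθ.comp_continuous (by fun_prop) fun z => ⟨z.1.2, Set.mem_univ _⟩⟩
  have hae : ∀ᵐ z ∂spaceTime T, Θ (π z) = θ z := by
    have h1 : ∀ᵐ z ∂spaceTime T, z.1 ∈ Set.Icc 0 T :=
      Measure.quasiMeasurePreserving_fst.ae (ae_restrict_mem measurableSet_Icc)
    filter_upwards [h1] with z hz
    change θ (Set.projIcc 0 T hT z.1, z.2) = θ z
    rw [Set.projIcc_of_mem hT hz]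
  have hcongr : ∀ k : ℝ × T3 → ℝ, ∫ z, k z * θ z ∂spaceTime T
      = ∫ z, k z * Θ (π z) ∂spaceTime T := fun k =>
    integral_congr_ae (hae.mono fun z hz => by simp only [hz])
  simp_rw [hcongr]
  have hi : ∀ (k : ℝ × T3 → ℝ), Integrable k (spaceTime T) → ∀ u : C(Set.Icc 0 T × T3, ℝ),
      Integrable (fun z => k z * u (π z)) (spaceTime T) := fun k hk u =>
    integrable_mul_of_continuous hk (u.continuous.comp hπ)
  have hspan : ∀ u ∈ Submodule.span ℝ {f : C(Set.Icc 0 T × T3, ℝ) |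
      ∃ (α : C(Set.Icc 0 T, ℝ)) (g : C(T3, ℝ)), ∀ z, f z = α z.1 * g z.2},
      Tendsto (fun n => ∫ z, f n z * u (π z) ∂spaceTime T) atTop
        (𝓝 (∫ z, f₀ z * u (π z) ∂spaceTime T)) := by
    intro u hu
    induction hu using Submodule.span_induction with
    | mem u hu =>
      obtain ⟨α, g, h⟩ := hu
      simp_rw [h]
      exact hsep (fun t => α (Set.projIcc 0 T hT t)) g (by fun_prop) g.continuous
    | zero => simp
    | add u v _ _ hu hv =>
      simp only [ContinuousMap.add_apply, mul_add]
      rw [integral_add (hi _ hf₀ u) (hi _ hf₀ v)]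
      simp_rw [fun n => integral_add (hi _ (hf n) u) (hi _ (hf n) v)]
      exact hu.add hv
    | smul c u _ hu =>
      simp only [ContinuousMap.smul_apply, smul_eq_mul, mul_left_comm _ c, integral_const_mul]
      exact hu.const_mul c
  refine tendsto_of_approx fun ε hε => ?_
  obtain ⟨δ, hδ, hδt, hδε⟩ := exists_pos_mul_le hε (ENNReal.coe_ne_top (r := C))
  obtain ⟨u, hu, hud⟩ := exists_span_separated_near Θ (ENNReal.toReal_pos hδ.ne' hδt)
  have hrem : ∀ k : ℝ × T3 → ℝ, Integrable k (spaceTime T) →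
      ∫⁻ z, ‖k z‖ₑ ∂spaceTime T ≤ C → ‖(∫ z, k z * Θ (π z) ∂spaceTime T)
        - ∫ z, k z * u (π z) ∂spaceTime T‖ₑ ≤ ε := by
    intro k hk hkC
    rw [← integral_sub (hi k hk Θ) (hi k hk u)]
    refine (enorm_integral_le_lintegral_enorm _).trans ?_
    calc _ ≤ ∫⁻ z, ‖k z‖ₑ * δ ∂spaceTime T := by
          refine lintegral_mono fun z => ?_
          rw [← mul_sub, enorm_mul]
          gcongr
          rw [enorm_sub_rev, ← ofReal_norm, ← ContinuousMap.sub_apply]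
          exact ENNReal.ofReal_le_of_le_toReal (((u - Θ).norm_coe_le_norm _).trans hud.le)
      _ = (∫⁻ z, ‖k z‖ₑ ∂spaceTime T) * δ := lintegral_mul_const' _ _ hδt
      _ ≤ C * δ := by gcongr
      _ ≤ ε := hδε
  exact ⟨_, _, hspan u hu, fun n => hrem _ (hf n) (hC n), hrem _ hf₀ hC₀⟩

end Products

/-! ### Consequences of weak-* convergence. -/

section WeakStar

variable {T : ℝ} {q P : ℝ≥0∞}

lemma conjExponent_antitone {P P' : ℝ≥0∞} (h : P ≤ P') : P'.conjExponent ≤ P.conjExponent := by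
  unfold ENNReal.conjExponent
  gcongr

/-- A smaller space exponent has a larger conjugate, hence a smaller predual and fewer test
functions. -/
lemma WeakStarLqLp.mono_exponent {P' : ℝ≥0∞} (h : P' ≤ P) {f : ℝ → ℝ × T3 → ℝ}
    {f₀ : ℝ × T3 → ℝ} (hf : WeakStarLqLp T q P f f₀) : WeakStarLqLp T q P' f f₀ := by
  refine fun g hg => hf g ⟨hg.1.mono_exponent (conjExponent_antitone h), fun δ hδ => ?_⟩
  obtain ⟨k, hk, hle⟩ := hg.2 δ hδ
  exact ⟨k, hk, (mixedNorm_mono_exponent rfl (conjExponent_antitone h)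
    (hg.1.1.sub hk.aestronglyMeasurable)).trans hle⟩

lemma WeakStarLqLp.tendsto_seq {f : ℝ → ℝ × T3 → ℝ} {f₀ : ℝ × T3 → ℝ}
    (hf : WeakStarLqLp T q P f f₀) {e : ℕ → ℝ} (he : Tendsto e atTop (𝓝[>] 0)) {g : ℝ × T3 → ℝ}
    (hg : MemPredual T q P g) : Tendsto (fun n => ∫ z, f (e n) z * g z ∂spaceTime T) atTop
      (𝓝 (∫ z, f₀ z * g z ∂spaceTime T)) :=
  (hf g hg).comp he

/-- Formulated along a sequence: convergence as ε → 0⁺ gives no bound on the family at values of ε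
away from 0. -/
lemma WeakStarLqLp.exists_mixedNorm_le (hq : 1 ≤ q) (hP : 1 ≤ P) (hPt : P ≠ ⊤)
    {f : ℝ → ℝ × T3 → ℝ} {f₀ : ℝ × T3 → ℝ} (hf : WeakStarLqLp T q P f f₀) {e : ℕ → ℝ}
    (he : Tendsto e atTop (𝓝[>] 0)) (hmem : ∀ n, MemLqLp T q P (f (e n))) :
    ∃ C : ℝ≥0, ∀ n, mixedNorm T q P (f (e n)) ≤ C := by
  refine WeakProduct.exists_mixedNorm_le hq hP hPt hmem fun g hg => ?_
  obtain ⟨C, hC⟩ := (Metric.isBounded_range_of_tendsto _ (hf.tendsto_seq he hg)).exists_norm_le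
  exact ⟨C, fun n => hC _ (Set.mem_range_self n)⟩

end WeakStar

/-! ### Assembly of the argument. -/

section Conclusion

variable {T : ℝ} {q S' : ℝ≥0∞} {p s : ℝ}

lemma integrable_mul_of_sobolev {q' : ℝ≥0∞} [q.HolderConjugate q']
    [(ENNReal.ofReal s).HolderConjugate S'] (hp : 1 ≤ p) (hps : p ≤ s)
    (h : 1 / p - 1 / 3 < 1 / s) {a b : ℝ × T3 → ℝ} {Da : Fin 3 → ℝ × T3 → ℝ}
    (ha : MemLqW1p T q (ENNReal.ofReal p) a Da) (hb : MemLqLp T q' S' b) :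
    Integrable (fun z => a z * b z) (spaceTime T) := by
  obtain ⟨K, hK⟩ := exists_mixedNorm_le_sobolev (T := T)
    (ENNReal.HolderConjugate.one_le q q') hp hps h
  refine integrable_mul_of_mixed (q := q) (q' := q') (p := ENNReal.ofReal s) (p' := S')
    ⟨ha.1.1, (hK a Da ha).trans_lt (ENNReal.mul_lt_top ENNReal.coe_lt_top ?_)⟩ hb
  exact ENNReal.add_lt_top.2 ⟨ha.1.2, ENNReal.sum_lt_top.2 fun i _ => (ha.2.1 i).2⟩

/-- Products of weakly convergent sequences, one bounded in `W^{1,p}` and the other with bounded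
time derivatives. -/
theorem tendsto_integral_mul_mul (hT : 0 < T) (hq : 1 ≤ q) (hp : 1 ≤ p) (hps : p ≤ s)
    (hs : 1 < s) (h : 1 / p - 1 / 3 < 1 / s)
    {a : ℝ → ℝ × T3 → ℝ} {Da : ℝ → Fin 3 → ℝ × T3 → ℝ} {a₀ : ℝ × T3 → ℝ}
    {Da₀ : Fin 3 → ℝ × T3 → ℝ} {b : ℝ → ℝ × T3 → ℝ} {b₀ : ℝ × T3 → ℝ}
    (ha : ∀ ε, 0 < ε → MemLqW1p T q (ENNReal.ofReal p) (a ε) (Da ε))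
    (ha₀ : MemLqW1p T q (ENNReal.ofReal p) a₀ Da₀)
    (hb : ∀ ε, 0 < ε → MemLqLp T q.conjExponent (ENNReal.ofReal s).conjExponent (b ε))
    (hb₀ : MemLqLp T q.conjExponent (ENNReal.ofReal s).conjExponent b₀)
    (ha_lim : WeakStarLqW1p T q (ENNReal.ofReal p) a Da a₀ Da₀)
    (hb_lim : WeakStarLqLp T q.conjExponent (ENNReal.ofReal s).conjExponent b b₀)
    {l : ℤ} {D : ℝ≥0} (hD : ∀ ε, 0 < ε → TimeDerivBound T q.conjExponent l (b ε) D)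
    {e : ℕ → ℝ} (he0 : ∀ n, 0 < e n) (he : Tendsto e atTop (𝓝 0)) {θ : ℝ × T3 → ℝ}
    (hθ : ContinuousOn θ (Set.Icc 0 T ×ˢ Set.univ)) :
    Tendsto (fun n => ∫ z, a (e n) z * b (e n) z * θ z ∂spaceTime T) atTop
      (𝓝 (∫ z, a₀ z * b₀ z * θ z ∂spaceTime T)) := by
  have hP : 1 ≤ ENNReal.ofReal p := by simpa using ENNReal.ofReal_le_ofReal hp
  have hS : 1 ≤ ENNReal.ofReal s := by simpa using ENNReal.ofReal_le_ofReal hs.le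
  have := ENNReal.HolderConjugate.conjExponent hq
  have := ENNReal.HolderConjugate.conjExponent hS
  set q' := q.conjExponent with hq'def
  set S' := (ENNReal.ofReal s).conjExponent with hS'def
  have hq' : 1 ≤ q' := ENNReal.HolderConjugate.one_le q' q
  have hS' : 1 ≤ S' := ENNReal.HolderConjugate.one_le S' (ENNReal.ofReal s)
  -- This is where s > 1 enters: the uniform boundedness argument for b requires a finite space
  -- exponent.
  have hS't : S' ≠ ⊤ := by
    have : 1 < ENNReal.ofReal s := by simpa using hs
    rw [hS'def, ENNReal.conjExponent]
    exact ENNReal.add_ne_top.2 ⟨by simp, ENNReal.inv_ne_top.2 (tsub_pos_of_lt this).ne'⟩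
  have he' : Tendsto e atTop (𝓝[>] 0) :=
    tendsto_nhdsWithin_iff.2 ⟨he, Eventually.of_forall he0⟩
  have hae := fun n => ha (e n) (he0 n)
  have hbe := fun n => hb (e n) (he0 n)
  obtain ⟨Ca, hCa⟩ := ha_lim.1.exists_mixedNorm_le hq hP ENNReal.ofReal_ne_top he'
    fun n => (hae n).1
  have hCD : ∀ i, ∃ C : ℝ≥0, ∀ n, mixedNorm T q (ENNReal.ofReal p) (Da (e n) i) ≤ C := fun i =>
    (ha_lim.2 i).exists_mixedNorm_le hq hP ENNReal.ofReal_ne_top he' fun n => (hae n).2.1 i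
  choose CD hCD using hCD
  obtain ⟨Cb, hCb⟩ := hb_lim.exists_mixedNorm_le hq' hS' hS't he' hbe
  have hDa₀ : ∑ i, mixedNorm T q (ENNReal.ofReal p) (Da₀ i) ≠ ⊤ :=
    (ENNReal.sum_lt_top.2 fun i _ => (ha₀.2.1 i).2).ne
  -- One constant dominates the norms of the sequences and of the limits.
  set C : ℝ≥0 := Ca + (mixedNorm T q (ENNReal.ofReal p) a₀).toNNReal + ∑ i, CD i
    + (∑ i, mixedNorm T q (ENNReal.ofReal p) (Da₀ i)).toNNReal + Cb
    + (mixedNorm T q' S' b₀).toNNReal with hC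
  have hle : ∀ {x y : ℝ≥0}, x ≤ y → ∀ {z : ℝ≥0∞}, z ≤ x → z ≤ y := fun h _ hz =>
    hz.trans (ENNReal.coe_le_coe.2 h)
  have haC : ∀ n, mixedNorm T q (ENNReal.ofReal p) (a (e n)) ≤ C := fun n =>
    hle (by rw [hC]; simp only [add_assoc]; exact le_self_add) (hCa n)
  have haC₀ : mixedNorm T q (ENNReal.ofReal p) a₀ ≤ C :=
    hle (by rw [hC, add_comm Ca]; simp only [add_assoc]; exact le_self_add)
      (ENNReal.coe_toNNReal ha₀.1.2.ne).ge
  have hDC : ∀ n, ∑ i, mixedNorm T q (ENNReal.ofReal p) (Da (e n) i) ≤ C := fun n => by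
    refine hle (x := ∑ i, CD i) ?_ ?_
    · rw [hC, add_comm _ (∑ i, CD i)]; simp only [add_assoc]; exact le_self_add
    · push_cast
      exact Finset.sum_le_sum fun i _ => hCD i n
  have hDC₀ : ∑ i, mixedNorm T q (ENNReal.ofReal p) (Da₀ i) ≤ C := by
    refine hle ?_ (ENNReal.coe_toNNReal hDa₀).ge
    rw [hC, add_assoc]
    exact le_add_self.trans le_self_add
  have hbC : ∀ n, mixedNorm T q' S' (b (e n)) ≤ C := fun n =>
    hle (by rw [hC]; exact le_add_self.trans le_self_add) (hCb n)
  have hbC₀ : mixedNorm T q' S' b₀ ≤ C :=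
    hle (by rw [hC]; exact le_add_self) (ENNReal.coe_toNNReal hb₀.2.ne).ge
  obtain ⟨K, hK⟩ := exists_mixedNorm_le_sobolev (T := T) hq hp hps h
  have hab : ∀ n, Integrable (fun z => a (e n) z * b (e n) z) (spaceTime T) := fun n =>
    integrable_mul_of_sobolev (q' := q') (S' := S') hp hps h (hae n) (hbe n)
  have hab₀ : Integrable (fun z => a₀ z * b₀ z) (spaceTime T) :=
    integrable_mul_of_sobolev (q' := q') (S' := S') hp hps h ha₀ hb₀
  have hL1 : ∀ (f : ℝ × T3 → ℝ) (Df : Fin 3 → ℝ × T3 → ℝ) (k : ℝ × T3 → ℝ),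
      MemLqW1p T q (ENNReal.ofReal p) f Df → mixedNorm T q (ENNReal.ofReal p) f ≤ C →
      ∑ i, mixedNorm T q (ENNReal.ofReal p) (Df i) ≤ C →
      MemLqLp T q' S' k → mixedNorm T q' S' k ≤ C →
      ∫⁻ z, ‖f z * k z‖ₑ ∂spaceTime T ≤ ((K * (C + C) * C : ℝ≥0) : ℝ≥0∞) := by
    intro f Df k hf hfC hDf hk hkC
    refine (lintegral_enorm_mul_le (q := q) (q' := q') (p := ENNReal.ofReal s) (p' := S')
      hf.1.1 hk.1).trans ?_
    push_cast
    gcongr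
    refine (hK f Df hf).trans ?_
    gcongr
  refine tendsto_integral_mul_of_separated hT.le hab hab₀
    (fun n => hL1 _ _ _ (hae n) (haC n) (hDC n) (hbe n) (hbC n))
    (hL1 _ _ _ ha₀ haC₀ hDC₀ hb₀ hbC₀) (fun α g hα hg => ?_) hθ
  exact tendsto_integral_mul_separated (q' := q') (S' := S') (a := fun n => a (e n))
    (b := fun n => b (e n)) hT hp hps h hae ha₀ hbe hb₀ haC haC₀ hDC hDC₀ hbC hbC₀ hab hab₀
    (fun g hg => ha_lim.1.tendsto_seq he'
      (memPredual_of_continuous hg (mixedNorm_lt_top_of_continuous hT.le hg)))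
    (fun g hg => hb_lim.tendsto_seq he'
      (memPredual_of_continuous hg (mixedNorm_lt_top_of_continuous hT.le hg)))
    (fun n => hD (e n) (he0 n)) hα hg

/-- The estimates need p ≤ σ, and σ > 1 so that its conjugate is finite. Both can be had below the
critical exponent because that exponent exceeds p. -/
lemma exists_subcritical_exponent (hp : 1 ≤ p) (hp3 : p < 3) (hsp : s < 3 * p / (3 - p)) :
    ∃ σ : ℝ, s ≤ σ ∧ p ≤ σ ∧ 1 < σ ∧ 1 / p - 1 / 3 < 1 / σ := by
  have h3 : 0 < 3 - p := by linarith
  have hlt : p < 3 * p / (3 - p) := by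
    rw [lt_div_iff₀ h3]; nlinarith
  obtain ⟨σ, h1, h2⟩ := exists_between (max_lt hsp hlt)
  have hσp : p < σ := (le_max_right _ _).trans_lt h1
  refine ⟨σ, ((le_max_left _ _).trans_lt h1).le, hσp.le, by linarith, ?_⟩
  have e : 1 / p - 1 / 3 = 1 / (3 * p / (3 - p)) := by
    have : p ≠ 0 := by linarith
    field_simp
  rw [e]
  exact one_div_lt_one_div_of_lt (by linarith) h2

end Conclusion

end WeakProduct

end

theorem proposition4p1
    (T : ℝ) (hT : 0 < T)
    (q : ℝ≥0∞) (hq : 1 ≤ q)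
    (p : ℝ) (hp : 1 ≤ p) (hp3 : p < 3)
    (s : ℝ) (hs : 1 ≤ s) (hsp : s < 3 * p / (3 - p))
    (a : ℝ → ℝ × WeakProduct.T3 → ℝ) (Da : ℝ → Fin 3 → ℝ × WeakProduct.T3 → ℝ)
    (a₀ : ℝ × WeakProduct.T3 → ℝ) (Da₀ : Fin 3 → ℝ × WeakProduct.T3 → ℝ)
    (b : ℝ → ℝ × WeakProduct.T3 → ℝ) (b₀ : ℝ × WeakProduct.T3 → ℝ)
    (ha : ∀ ε, 0 < ε → WeakProduct.MemLqW1p T q (ENNReal.ofReal p) (a ε) (Da ε))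
    (ha₀ : WeakProduct.MemLqW1p T q (ENNReal.ofReal p) a₀ Da₀)
    (hb : ∀ ε, 0 < ε →
      WeakProduct.MemLqLp T q.conjExponent (ENNReal.ofReal s).conjExponent (b ε))
    (hb₀ : WeakProduct.MemLqLp T q.conjExponent (ENNReal.ofReal s).conjExponent b₀)
    (ha_lim : WeakProduct.WeakStarLqW1p T q (ENNReal.ofReal p) a Da a₀ Da₀)
    (hb_lim : WeakProduct.WeakStarLqLp T q.conjExponent (ENNReal.ofReal s).conjExponent b b₀)
    (m : ℤ)
    (hdb : ∃ C : ℝ≥0, ∀ ε, 0 < ε → WeakProduct.TimeDerivBound T q.conjExponent (-m) (b ε) C) :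
    (∀ ε, 0 < ε → Integrable (fun z => a ε z * b ε z) (WeakProduct.spaceTime T)) ∧
    Integrable (fun z => a₀ z * b₀ z) (WeakProduct.spaceTime T) ∧
    ∀ e : ℕ → ℝ, (∀ n, 0 < e n) → Tendsto e atTop (𝓝 0) →
      ∃ φ : ℕ → ℕ, StrictMono φ ∧
        ∀ θ : ℝ × WeakProduct.T3 → ℝ, ContinuousOn θ (Set.Icc 0 T ×ˢ Set.univ) →
          Tendsto
            (fun n => ∫ z, a (e (φ n)) z * b (e (φ n)) z * θ z ∂WeakProduct.spaceTime T)
            atTop (𝓝 (∫ z, a₀ z * b₀ z * θ z ∂WeakProduct.spaceTime T)) := by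
  -- Passing from s to σ weakens every assumption on b, as the conjugate exponent decreases; in
  -- particular s = 1 needs no separate treatment.
  obtain ⟨σ, hsσ, hpσ, hσ1, hσ⟩ := WeakProduct.exists_subcritical_exponent hp hp3 hsp
  have hle := WeakProduct.conjExponent_antitone (ENNReal.ofReal_le_ofReal hsσ)
  have := ENNReal.HolderConjugate.conjExponent hq
  have := ENNReal.HolderConjugate.conjExponent
    (show 1 ≤ ENNReal.ofReal σ by simpa using ENNReal.ofReal_le_ofReal hσ1.le)
  have hb' := fun ε hε => (hb ε hε).mono_exponent hle
  have hb₀' := hb₀.mono_exponent hle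
  obtain ⟨D, hD⟩ := hdb
  exact ⟨fun ε hε => WeakProduct.integrable_mul_of_sobolev hp hpσ hσ (ha ε hε) (hb' ε hε),
    WeakProduct.integrable_mul_of_sobolev hp hpσ hσ ha₀ hb₀',
    -- The full sequence converges, so the subsequence is the sequence itself.
    fun e he0 he => ⟨id, strictMono_id, fun θ hθ =>
      WeakProduct.tendsto_integral_mul_mul hT hq hp hpσ hσ1 hσ ha ha₀ hb' hb₀' ha_lim
        (hb_lim.mono_exponent hle) hD he0 he hθ⟩⟩
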